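/- Consider one-dimensional control systems $\dot x=f(x,u,\dot u)$ and write $u_1=\dot u$. Let $J^k$ be the space of $k$-jets of smooth functions $f(x,u,u_1)$ of three variables, with coordinates $x,u,u_1$ and $f_\sigma$, $|\sigma|\le k$. A feedback vector field $a(x)\partial_x+b(x,u)\partial_u$ ($a,b$ smooth) acts on $J^0$ by the vector field $$\widehat X_{a,b}=a\,\partial_x+b\,\partial_u+(u_1b_u+f\,b_x)\,\partial_{u_1}+a_x f\,\partial_f ,$$ and on $J^k$ by its $k$-th prolongation $\widehat X_{a,b}^{(k)}$. A feedback differential invariant of order $\le k$ on an open set $U\subseteq J^k$ is a smooth function $I$ on $U$ with $\widehat X_{a,b}^{(k)}(I)=0$ for all $a,b$. The feedback orbit of a point of $J^k$ is the set of points that can be reached from it along the flows of smooth time-dependent families of prolonged feedback vector fields $\widehat X^{(k)}_{a_t,b_t}$ ($0\le t\le1$). For $k\ge 2$ a point of $J^k$ is called regular if $f\ne0$, $f_{u_1}\ne0$, $f_{u_1u_1}\ne0$ and $u_1f_{u_1}-f\neq 0$ at this point. Theorem. 1. Every feedback differential invariant of order $\le 1$, on any open set, is locally constant. The function $$J=\frac{f^{2}f_{u_1u_1}}{(u_1f_{u_1}-f)\,f_{u_1}^{2}}$$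 is a feedback differential invariant of order $2$ on the set of regular points of $J^2$, its differential vanishes nowhere there, and near every regular point every feedback differential invariant of order $\le 2$ is a smooth function of $J$. 2. For $k\ge2$, near every regular point of $J^k$ there are exactly $n=\frac{k(k+1)}2-2$ independent feedback differential invariants of pure order $k$: there are $n$ invariants of order $\le k$, defined on a neighbourhood $U$ of the point, whose differentials along the fibres of $J^k\to J^{k-1}$ are linearly independent at every point of $U$, and near every point of $U$ every invariant of order $\le k$ is a smooth function of these $n$ invariants and finitely many invariants of order $\le k-1$. 3. For $k\ge 2$, near every regular point of $J^k$ the algebra of feedback differential invariants of order $\le k$ has dimension $$n=\frac{k^3}{6}+\frac{k^2}{2}-\frac{5k}{3}+1 :$$ there are $n$ invariants of order $\le k$ on a neighbourhood $U$ of the point, with linearly independent differentials at every point of $U$, such that near every point of $U$ every invariant of order $\le k$ is a smooth function of them. 4. For $k\ge 2$, the feedback orbit of every regular point of $J^k$ is an embedded submanifold of $J^k$ of dimension $$d=\frac{(k+1)^2}{2}+\frac{5k}{2}+\frac52 ,$$ and $d$ is also the rank, at every regular point of $J^k$, of the distribution generated by the vector fields $\widehat X^{(k)}_{a,b}$. 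-/

import Mathlib

open scoped ContDiff Topology

noncomputable section

namespace FeedbackJets

/-- Infinite jets of functions `f (x, u, u₁)`: a base point with coordinates `0 ↦ x`, `1 ↦ u`,
`2 ↦ u₁`, and, for every multi-index `σ = (i, j, l)`, the coordinate `f_σ` standing for
`∂^(i+j+l) f / ∂x^i ∂u^j ∂u₁^l`. Being a vector space, it is its own tangent space. -/
abbrev JetInf : Type := (Fin 3 → ℝ) × ((Fin 3 → ℕ) → ℝ)

/-- Multi-indices of length at most `k`. -/
abbrev JetIndex (k : ℕ) : Type := {σ : Fin 3 → ℕ // ∑ i, σ i ≤ k}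

instance instFintypeJetIndex (k : ℕ) : Fintype (JetIndex k) :=
  Fintype.ofInjective
    (fun (σ : JetIndex k) (i : Fin 3) =>
      (⟨σ.1 i, Nat.lt_succ_of_le ((Finset.single_le_sum (f := σ.1)
        (fun _ _ => Nat.zero_le _) (Finset.mem_univ i)).trans σ.2)⟩ : Fin (k + 1)))
    (fun _ _ h => Subtype.ext (funext fun i => congrArg Fin.val (congrFun h i)))

/-- The space `J^k κ` of `k`-jets of functions `f (x, u, u₁)`, in its canonical coordinates. -/
abbrev Jet (k : ℕ) : Type := (Fin 3 → ℝ) × (JetIndex k → ℝ)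

/-- The `k`-jet of an infinite jet. -/
def JetInf.trunc (k : ℕ) (p : JetInf) : Jet k := (p.1, fun σ => p.2 σ.1)

/-- The infinite jet of the polynomial of degree `≤ k` that represents a given `k`-jet. -/
def Jet.ext {k : ℕ} (p : Jet k) : JetInf :=
  (p.1, fun σ => if h : ∑ i, σ i ≤ k then p.2 ⟨σ, h⟩ else 0)

/-- The projection `J^k κ → J^l κ`, for `l ≤ k`. -/
def Jet.proj {k : ℕ} (l : ℕ) (p : Jet k) : Jet l := p.ext.trunc l

/-- The multi-index `(i, j, l)`. -/
def idx (i j l : ℕ) : Fin 3 → ℕ := ![i, j, l]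

/-- Total derivative `d/dx`, `d/du`, `d/du₁` (for `i = 0, 1, 2`):
`D_i g = ∂g/∂y_i + ∑_σ f_{σ + e_i} ∂g/∂f_σ`, on functions `g` on the space of infinite jets. -/
def totalDeriv (i : Fin 3) (g : JetInf → ℝ) : JetInf → ℝ := fun p =>
  lineDeriv ℝ g p (Pi.single i 1, fun σ => p.2 (σ + Pi.single i 1))

/-- Iterated total derivative `D_σ`. -/
def totalDerivIter (σ : Fin 3 → ℕ) (g : JetInf → ℝ) : JetInf → ℝ :=
  (totalDeriv 0)^[σ 0] ((totalDeriv 1)^[σ 1] ((totalDeriv 2)^[σ 2] g))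

/-- The base components `(a, b, u₁ b_u + f b_x)` of the vector field on `J^0 κ`
`a ∂_x + b ∂_u + (u₁ b_u + f b_x) ∂_{u₁} + a_x f ∂_f`
which represents the feedback vector field `a(x) ∂_x + b(x, u) ∂_u`. -/
def baseComponent (a : ℝ → ℝ) (b : ℝ → ℝ → ℝ) (p : JetInf) : Fin 3 → ℝ :=
  ![a (p.1 0), b (p.1 0) (p.1 1),
    p.1 2 * deriv (fun u => b (p.1 0) u) (p.1 1)
      + p.2 (idx 0 0 0) * deriv (fun x => b x (p.1 1)) (p.1 0)]

/-- The generating function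
`φ = a_x f - a f_x - b f_u - (u₁ b_u + f b_x) f_{u₁}` of that vector field. -/
def generatingFunction (a : ℝ → ℝ) (b : ℝ → ℝ → ℝ) (p : JetInf) : ℝ :=
  deriv a (p.1 0) * p.2 (idx 0 0 0)
    - ∑ i, baseComponent a b p i * p.2 (Pi.single i 1)

/-- Prolongation to infinite jets: `∑_i ξ_i D_i + ∑_σ D_σ(φ) ∂/∂f_σ`, where `ξ_i` are the base
components and `φ` is the generating function. -/
def prolongInf (a : ℝ → ℝ) (b : ℝ → ℝ → ℝ) (p : JetInf) : JetInf :=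
  (baseComponent a b p, fun σ =>
    totalDerivIter σ (generatingFunction a b) p
      + ∑ i, baseComponent a b p i * p.2 (σ + Pi.single i 1))

/-- The `k`-th prolongation of the feedback vector field `a(x) ∂_x + b(x, u) ∂_u`, a vector field
on `J^k κ`. In the component along `f_σ` the jet coordinates of order `|σ| + 1` cancel, so its value
does not depend on the infinite jet chosen above a given `k`-jet. -/
def feedbackField (a : ℝ → ℝ) (b : ℝ → ℝ → ℝ) (k : ℕ) (p : Jet k) : Jet k :=
  (prolongInf a b p.ext).trunc k

/-- `I` is a feedback differential invariant of order `≤ k`, smooth on the open set `U ⊆ J^k κ`. -/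
def IsDiffInvariant (k : ℕ) (U : Set (Jet k)) (I : Jet k → ℝ) : Prop :=
  IsOpen U ∧ ContDiffOn ℝ ∞ I U ∧
    ∀ (a : ℝ → ℝ) (b : ℝ → ℝ → ℝ), ContDiff ℝ ∞ a → ContDiff ℝ ∞ (fun y : ℝ × ℝ => b y.1 y.2) →
      ∀ p ∈ U, fderiv ℝ I p (feedbackField a b k p) = 0

/-- Regular points of `J^k κ`, `k ≥ 2`:
`f ≠ 0`, `f_{u₁} ≠ 0`, `f_{u₁u₁} ≠ 0`, `u₁ f_{u₁} - f ≠ 0`. -/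
def IsRegular {k : ℕ} (p : Jet k) : Prop :=
  p.ext.2 (idx 0 0 0) ≠ 0 ∧ p.ext.2 (idx 0 0 1) ≠ 0 ∧ p.ext.2 (idx 0 0 2) ≠ 0 ∧
    p.1 2 * p.ext.2 (idx 0 0 1) - p.ext.2 (idx 0 0 0) ≠ 0

/-- `J = f² f_{u₁u₁} / ((u₁ f_{u₁} - f) f_{u₁}²)`. -/
def invariantJ (p : Jet 2) : ℝ :=
  p.ext.2 (idx 0 0 0) ^ 2 * p.ext.2 (idx 0 0 2) /
    ((p.1 2 * p.ext.2 (idx 0 0 1) - p.ext.2 (idx 0 0 0)) * p.ext.2 (idx 0 0 1) ^ 2)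

/-- Near `p`, the algebra of feedback differential invariants of order `≤ k` has dimension `n`:
there are `n` functionally independent invariants of which every other one is locally a smooth
function. -/
def HasInvariantDimension (k : ℕ) (p : Jet k) (n : ℕ) : Prop :=
  ∃ (U : Set (Jet k)) (I : Fin n → Jet k → ℝ), p ∈ U ∧
    (∀ i, IsDiffInvariant k U (I i)) ∧ IsOpen U ∧
    (∀ q ∈ U, LinearIndependent ℝ (fun i => fderiv ℝ (I i) q)) ∧
    ∀ q ∈ U, ∀ (W : Set (Jet k)) (I' : Jet k → ℝ), q ∈ W → IsDiffInvariant k W I' →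
      ∃ h : (Fin n → ℝ) → ℝ, ContDiff ℝ ∞ h ∧ ∀ᶠ r in 𝓝 q, I' r = h (fun i => I i r)

/-- The symbol of `I` at `q`: the partial derivatives with respect to the coordinates `f_σ` of order
exactly `k`, i.e. the differential of `I` along the fibre of `J^k κ → J^(k-1) κ`. -/
def jetSymbol (k : ℕ) (I : Jet k → ℝ) (q : Jet k) :
    {σ : JetIndex k // ∑ i, σ.1 i = k} → ℝ :=
  fun σ => fderiv ℝ I q (0, Pi.single σ.1 1)

/-- Near `p`, there are exactly `n` independent feedback differential invariants of pure order `k`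
(`k ≥ 1`): there are `n` invariants of order `≤ k` which are independent along the fibres of
`J^k κ → J^(k-1) κ`, and every invariant of order `≤ k` is locally a smooth function of these and of
finitely many invariants of order `≤ k - 1`. -/
def HasPureOrderDimension (k : ℕ) (p : Jet k) (n : ℕ) : Prop :=
  ∃ (U : Set (Jet k)) (I : Fin n → Jet k → ℝ), p ∈ U ∧
    (∀ i, IsDiffInvariant k U (I i)) ∧ IsOpen U ∧
    (∀ q ∈ U, LinearIndependent ℝ (fun i => jetSymbol k (I i) q)) ∧
    ∀ q ∈ U, ∀ (W : Set (Jet k)) (I' : Jet k → ℝ), q ∈ W → IsDiffInvariant k W I' →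
      ∃ (m : ℕ) (V : Set (Jet (k - 1))) (L : Fin m → Jet (k - 1) → ℝ)
        (h : (Fin n → ℝ) × (Fin m → ℝ) → ℝ),
        IsOpen V ∧ Jet.proj (k - 1) q ∈ V ∧ (∀ j, IsDiffInvariant (k - 1) V (L j)) ∧
        ContDiff ℝ ∞ h ∧
        ∀ᶠ r in 𝓝 q, I' r = h (fun i => I i r, fun j => L j (Jet.proj (k - 1) r))

/-- The distribution on `J^k κ` generated by the prolonged feedback vector fields. -/
def feedbackDistribution (k : ℕ) (p : Jet k) : Submodule ℝ (Jet k) :=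
  Submodule.span ℝ {v | ∃ (a : ℝ → ℝ) (b : ℝ → ℝ → ℝ), ContDiff ℝ ∞ a ∧
    ContDiff ℝ ∞ (fun y : ℝ × ℝ => b y.1 y.2) ∧ v = feedbackField a b k p}

/-- The feedback orbit of `p`: all points to which `p` can be moved along the flow of a smooth
time-dependent family of prolonged feedback vector fields. -/
def feedbackOrbit (k : ℕ) (p : Jet k) : Set (Jet k) :=
  {q | ∃ (a : ℝ → ℝ → ℝ) (b : ℝ → ℝ → ℝ → ℝ) (γ : ℝ → Jet k),
    ContDiff ℝ ∞ (fun y : ℝ × ℝ => a y.1 y.2) ∧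
    ContDiff ℝ ∞ (fun y : ℝ × ℝ × ℝ => b y.1 y.2.1 y.2.2) ∧
    γ 0 = p ∧ γ 1 = q ∧
    ∀ t ∈ Set.Icc (0 : ℝ) 1,
      HasDerivWithinAt γ (feedbackField (a t) (b t) k (γ t)) (Set.Icc 0 1) t}

/-- `S` is an embedded smooth submanifold of dimension `d` of the space `E`: locally it is a level
set of a submersion onto a space of dimension `dim E - d`. -/
def IsEmbeddedSubmanifold {E : Type*} [NormedAddCommGroup E] [NormedSpace ℝ E]
    (S : Set E) (d : ℕ) : Prop :=
  ∀ p ∈ S, ∃ (U : Set E) (c : ℕ) (Φ : E → Fin c → ℝ), IsOpen U ∧ p ∈ U ∧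
    d + c = Module.finrank ℝ E ∧ ContDiffOn ℝ ∞ Φ U ∧
    (∀ q ∈ U, Function.Surjective (fderiv ℝ Φ q)) ∧
    ∀ q ∈ U, q ∈ S ↔ Φ q = Φ p

end FeedbackJets

end

noncomputable section

namespace FeedbackJets

/-! ### Truncation and extension of jets -/

/-! Everything rests on one fact of linear algebra at a regular point of `J^k`: the covectors that
annihilate the feedback distribution have a basis of differentials of explicit invariants. Call a
multi-index `(i, j, l)` free if `l ≥ 2`, or `l = 1` and `i, j ≥ 1` (`IsFree`). The basis is indexed
by the free multi-indices of length at most `k`.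

Upper bound (`covector_eq_zero`): an annihilating covector with zero components on all free
coordinates is zero. It is tested on fields whose `a` or `b` is a monomial of degree `m + 1` centred
at the point. At level `i + j = m ≥ 1` the components left are those with `l = 0`, and those with `l
= 1` on the two edges `i = 0`, `j = 0`. They satisfy a square linear system, solved by descending
induction on `m`; its pivots are products of the quantities in the definition of regularity. Level
`0` is settled by five affine fields.

Lower bound: `frame` gives three derivations `∇₀, ∇₁, ∇₂`, combinations of total derivatives, that
commute with every prolonged feedback field (`feedbackDeriv_frameDeriv`), so they map invariants to
invariants. There are two seeds. One is `J`, of order 2. The other comes from `C = (∇₀ f) / f`, on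
which a field acts by `a_xx f`; as `∇₁` kills `f` and all functions of `x`, `∇₁ C` is an invariant
of order 3. The principal symbols of `J` and `C` are nonzero multiples of `y₂²` and `y₀ y₂`, where
`y_n` is the symbol of `∇_n`. Iterated derivatives therefore give, for each free `τ`, an invariant
of order `|τ|` with symbol proportional to `y^τ` (`symbol_basicInvariant`). The `y_n` are
independent linear forms, so distinct monomials are independent, and so are the differentials
(`linearIndependent_fderiv_jetInvariant`).

The two bounds meet in `dualAnnihilator_eq_span`. The rank of the distribution follows by counting
free indices, and every invariant is locally a smooth function of the basic ones because its
differential vanishes on their common kernel (`exists_eq_comp_of_fderiv_eq_zero`). For orbits,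
feedback paths preserve regularity and the invariants (`invariantMap_eq_of_mem_feedbackOrbit`).
Conversely, a path in a level set of the invariants has velocity in the distribution, hence is the
flow line of a time-dependent feedback field (`eventually_mem_feedbackOrbit`). So an orbit is
locally a level set of a submersion.

In order at most 1 no index is free, and the upper bound alone forces `dI = 0` at generic points,
hence everywhere by continuity.

Infinite jets carry no norm, so calculus on them is done by line derivatives of functions that
factor through some `J^k`. -/

/-- Truncation of infinite jets as a linear map. -/
def truncL (k : ℕ) : JetInf →ₗ[ℝ] Jet k where
  toFun := JetInf.trunc k
  map_add' _ _ := rfl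
  map_smul' _ _ := rfl

/-- Extension of jets by zero as a linear map. -/
def extL (k : ℕ) : Jet k →ₗ[ℝ] JetInf where
  toFun := Jet.ext
  map_add' p q := by
    refine Prod.ext rfl (funext fun σ => ?_)
    by_cases h : ∑ i, σ i ≤ k <;> simp [Jet.ext, h]
  map_smul' c p := by
    refine Prod.ext rfl (funext fun σ => ?_)
    by_cases h : ∑ i, σ i ≤ k <;> simp [Jet.ext, h]

lemma trunc_add_smul (k : ℕ) (p v : JetInf) (t : ℝ) :
    (p + t • v).trunc k = p.trunc k + t • v.trunc k := rfl

lemma Jet.ext_snd_of_le {k : ℕ} (p : Jet k) {σ : Fin 3 → ℕ} (h : ∑ i, σ i ≤ k) :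
    p.ext.2 σ = p.2 ⟨σ, h⟩ := dif_pos h

lemma Jet.ext_snd_of_lt {k : ℕ} (p : Jet k) {σ : Fin 3 → ℕ} (h : k < ∑ i, σ i) :
    p.ext.2 σ = 0 := dif_neg (not_le.2 h)

@[simp] lemma Jet.trunc_ext {k : ℕ} (p : Jet k) : p.ext.trunc k = p :=
  Prod.ext rfl (funext fun σ => p.ext_snd_of_le σ.2)

lemma trunc_eq_iff {k : ℕ} {p q : JetInf} :
    p.trunc k = q.trunc k ↔ p.1 = q.1 ∧ ∀ σ : Fin 3 → ℕ, ∑ i, σ i ≤ k → p.2 σ = q.2 σ := by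
  constructor
  · intro h
    exact ⟨(Prod.ext_iff.1 h).1, fun σ hσ => congrFun (Prod.ext_iff.1 h).2 ⟨σ, hσ⟩⟩
  · rintro ⟨h1, h2⟩
    exact Prod.ext h1 (funext fun σ => h2 σ.1 σ.2)

lemma trunc_eq_of_le {k l : ℕ} (hkl : k ≤ l) {p q : JetInf} (h : p.trunc l = q.trunc l) :
    p.trunc k = q.trunc k := by
  rw [trunc_eq_iff] at h ⊢
  exact ⟨h.1, fun σ hσ => h.2 σ (hσ.trans hkl)⟩

lemma trunc_ext_trunc {k l : ℕ} (hkl : k ≤ l) (p : JetInf) :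
    ((p.trunc l).ext).trunc k = p.trunc k :=
  trunc_eq_of_le hkl (Jet.trunc_ext _)

/-- The projection `J^k → J^l` as a continuous linear map. -/
def projCLM (k l : ℕ) : Jet k →L[ℝ] Jet l :=
  LinearMap.toContinuousLinearMap ((truncL l).comp (extL k))

@[simp] lemma projCLM_apply (k l : ℕ) (p : Jet k) : projCLM k l p = p.proj l := rfl

lemma proj_trunc {k l : ℕ} (hkl : k ≤ l) (p : JetInf) : (p.trunc l).proj k = p.trunc k :=
  trunc_ext_trunc hkl p

lemma continuous_ext (k : ℕ) : Continuous (Jet.ext : Jet k → JetInf) :=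
  (extL k).continuous_of_finiteDimensional

lemma contDiff_ext_snd (k : ℕ) (σ : Fin 3 → ℕ) :
    ContDiff ℝ ∞ fun z : Jet k => z.ext.2 σ := by
  by_cases h : ∑ i, σ i ≤ k
  · simp only [fun z : Jet k => z.ext_snd_of_le h]
    fun_prop
  · simp only [fun z : Jet k => z.ext_snd_of_lt (not_le.1 h)]
    fun_prop

lemma single_sum (i : Fin 3) : ∑ j, (Pi.single i 1 : Fin 3 → ℕ) j = 1 := by
  simp

lemma add_single_sum (σ : Fin 3 → ℕ) (i : Fin 3) :
    ∑ j, (σ + Pi.single i 1 : Fin 3 → ℕ) j = ∑ j, σ j + 1 := by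
  simp only [Pi.add_apply, Finset.sum_add_distrib, single_sum]

/-! ### Functions of finite order -/

/-- `g` depends only on the `k`-jet. -/
def HasOrder (k : ℕ) (g : JetInf → ℝ) : Prop :=
  ∀ p q : JetInf, p.trunc k = q.trunc k → g p = g q

/-- `g` is a function of the `k`-jet that is smooth at (the `k`-jet of) `p`. -/
def SmoothAt (k : ℕ) (g : JetInf → ℝ) (p : JetInf) : Prop :=
  HasOrder k g ∧ ContDiffAt ℝ ∞ (fun z : Jet k => g z.ext) (p.trunc k)

lemma HasOrder.mono {k l : ℕ} {g : JetInf → ℝ} (h : HasOrder k g) (hkl : k ≤ l) :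
    HasOrder l g := fun p q hpq => h p q (trunc_eq_of_le hkl hpq)

lemma HasOrder.ext_trunc {k : ℕ} {g : JetInf → ℝ} (h : HasOrder k g) (p : JetInf) :
    g (p.trunc k).ext = g p := h _ _ (Jet.trunc_ext _)

lemma SmoothAt.mono {k l : ℕ} {g : JetInf → ℝ} {p : JetInf} (h : SmoothAt k g p)
    (hkl : k ≤ l) : SmoothAt l g p := by
  refine ⟨h.1.mono hkl, ?_⟩
  have h1 : (fun z : Jet l => g z.ext) = (fun z : Jet k => g z.ext) ∘ projCLM l k := by
    funext z
    exact h.1 _ _ (Jet.trunc_ext _).symm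
  rw [h1]
  refine ContDiffAt.comp _ ?_ (projCLM l k).contDiff.contDiffAt
  rw [projCLM_apply, proj_trunc hkl]
  exact h.2

lemma HasOrder.comp_trunc {k : ℕ} (G : Jet k → ℝ) : HasOrder k fun p => G (p.trunc k) :=
  fun _ _ h => congrArg G h

lemma SmoothAt.comp_trunc {k : ℕ} {G : Jet k → ℝ} {p : JetInf}
    (h : ContDiffAt ℝ ∞ G (p.trunc k)) : SmoothAt k (fun p => G (p.trunc k)) p :=
  ⟨HasOrder.comp_trunc G, by simpa using h⟩

lemma SmoothAt.const (k : ℕ) (c : ℝ) (p : JetInf) : SmoothAt k (fun _ => c) p :=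
  ⟨fun _ _ _ => rfl, contDiffAt_const⟩

lemma SmoothAt.base (k : ℕ) (i : Fin 3) (p : JetInf) : SmoothAt k (fun p => p.1 i) p :=
  SmoothAt.comp_trunc (G := fun z => z.1 i) (by fun_prop)

lemma SmoothAt.coord {k : ℕ} {σ : Fin 3 → ℕ} (h : ∑ i, σ i ≤ k) (p : JetInf) :
    SmoothAt k (fun p => p.2 σ) p :=
  SmoothAt.comp_trunc (G := fun z : Jet k => z.2 ⟨σ, h⟩) (by fun_prop)

lemma HasOrder.add {k : ℕ} {g h : JetInf → ℝ} (hg : HasOrder k g)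
    (hh : HasOrder k h) : HasOrder k (fun q => g q + h q) := fun p q e => by
  simp only [hg p q e, hh p q e]

lemma HasOrder.mul {k : ℕ} {g h : JetInf → ℝ} (hg : HasOrder k g)
    (hh : HasOrder k h) : HasOrder k (fun q => g q * h q) := fun p q e => by
  simp only [hg p q e, hh p q e]

section Algebra

variable {k : ℕ} {g h : JetInf → ℝ} {p : JetInf}

lemma SmoothAt.add (hg : SmoothAt k g p) (hh : SmoothAt k h p) :
    SmoothAt k (fun q => g q + h q) p :=
  ⟨hg.1.add hh.1, hg.2.add hh.2⟩

lemma SmoothAt.mul (hg : SmoothAt k g p) (hh : SmoothAt k h p) :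
    SmoothAt k (fun q => g q * h q) p :=
  ⟨hg.1.mul hh.1, hg.2.mul hh.2⟩

lemma SmoothAt.neg (hg : SmoothAt k g p) : SmoothAt k (fun q => -g q) p :=
  ⟨fun p q e => by simp only [hg.1 p q e], hg.2.neg⟩

lemma SmoothAt.sub (hg : SmoothAt k g p) (hh : SmoothAt k h p) :
    SmoothAt k (fun q => g q - h q) p :=
  ⟨fun p q e => by simp only [hg.1 p q e, hh.1 p q e], hg.2.sub hh.2⟩

lemma SmoothAt.pow (hg : SmoothAt k g p) (n : ℕ) : SmoothAt k (fun q => g q ^ n) p :=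
  ⟨fun p q e => by simp only [hg.1 p q e], hg.2.pow n⟩

lemma SmoothAt.div (hg : SmoothAt k g p) (hh : SmoothAt k h p) (h0 : h p ≠ 0) :
    SmoothAt k (fun q => g q / h q) p :=
  ⟨fun p q e => by simp only [hg.1 p q e, hh.1 p q e],
    hg.2.div hh.2 (by simpa [hh.1.ext_trunc] using h0)⟩

lemma SmoothAt.sum {ι : Type*} (s : Finset ι) {g : ι → JetInf → ℝ}
    (hg : ∀ i ∈ s, SmoothAt k (g i) p) : SmoothAt k (fun q => ∑ i ∈ s, g i q) p :=
  ⟨fun p q e => Finset.sum_congr rfl fun i hi => (hg i hi).1 p q e,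
    ContDiffAt.sum fun i hi => (hg i hi).2⟩

end Algebra

/-! ### Line derivatives of functions of finite order -/

section LineDeriv

variable {k : ℕ} {g : JetInf → ℝ} {p : JetInf}

lemma SmoothAt.hasLineDerivAt (hg : SmoothAt k g p) (v : JetInf) :
    HasLineDerivAt ℝ g (fderiv ℝ (fun z : Jet k => g z.ext) (p.trunc k) (v.trunc k)) p v := by
  have h1 : HasFDerivAt (fun z : Jet k => g z.ext)
      (fderiv ℝ (fun z : Jet k => g z.ext) (p.trunc k)) (p.trunc k) :=
    (hg.2.differentiableAt (by simp)).hasFDerivAt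
  have h2 := h1.hasLineDerivAt (v.trunc k)
  unfold HasLineDerivAt at h2 ⊢
  refine h2.congr_of_eventuallyEq (Filter.Eventually.of_forall fun t => ?_)
  exact (hg.1.ext_trunc (p + t • v)).symm

lemma SmoothAt.lineDeriv_eq (hg : SmoothAt k g p) (v : JetInf) :
    lineDeriv ℝ g p v = fderiv ℝ (fun z : Jet k => g z.ext) (p.trunc k) (v.trunc k) :=
  (hg.hasLineDerivAt v).lineDeriv

lemma SmoothAt.hasLineDerivAt' (hg : SmoothAt k g p) (v : JetInf) :
    HasLineDerivAt ℝ g (lineDeriv ℝ g p v) p v := by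
  rw [hg.lineDeriv_eq]; exact hg.hasLineDerivAt v

lemma SmoothAt.lineDeriv_add (hg : SmoothAt k g p) (v w : JetInf) :
    lineDeriv ℝ g p (v + w) = lineDeriv ℝ g p v + lineDeriv ℝ g p w := by
  simp only [hg.lineDeriv_eq, ← map_add]; rfl

lemma SmoothAt.lineDeriv_smul (hg : SmoothAt k g p) (c : ℝ) (v : JetInf) :
    lineDeriv ℝ g p (c • v) = c * lineDeriv ℝ g p v := by
  simp only [hg.lineDeriv_eq]
  rw [← smul_eq_mul, ← map_smul]; rfl

lemma HasOrder.lineDeriv_congr (hg : HasOrder k g) {p q v w : JetInf}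
    (h : p.trunc k = q.trunc k) (h' : v.trunc k = w.trunc k) :
    lineDeriv ℝ g p v = lineDeriv ℝ g q w := by
  unfold lineDeriv
  congr 1
  funext t
  apply hg
  rw [trunc_add_smul, trunc_add_smul, h, h']

/-- Near a point where `g` is smooth, `g` is differentiable as a function of the `k`-jet. -/
lemma SmoothAt.eventually_differentiableAt (hg : SmoothAt k g p) :
    ∀ᶠ z in 𝓝 (p.trunc k), DifferentiableAt ℝ (fun z : Jet k => g z.ext) z := by
  have h1 : ContDiffAt ℝ 1 (fun z : Jet k => g z.ext) (p.trunc k) := hg.2.of_le (by simp)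
  exact (h1.eventually (by simp)).mono fun z hz => hz.differentiableAt (by simp)

lemma HasOrder.lineDeriv_eq_of_differentiableAt (hg : HasOrder k g)
    (h1 : DifferentiableAt ℝ (fun z : Jet k => g z.ext) (p.trunc k)) (v : JetInf) :
    lineDeriv ℝ g p v = fderiv ℝ (fun z : Jet k => g z.ext) (p.trunc k) (v.trunc k) := by
  rw [← h1.lineDeriv_eq_fderiv]
  unfold lineDeriv
  congr 1
  funext t
  rw [← trunc_add_smul]
  exact (hg.ext_trunc _).symm

/-- Second derivatives: the derivative in the direction `v` of the derivative of `g` along a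
vector field `W`. -/
lemma SmoothAt.hasLineDerivAt_lineDeriv (hg : SmoothAt k g p) {W : JetInf → JetInf}
    {v W' : JetInf}
    (h1 : ∀ i, HasLineDerivAt ℝ (fun q => (W q).1 i) (W'.1 i) p v)
    (h2 : ∀ σ : Fin 3 → ℕ, ∑ i, σ i ≤ k →
      HasLineDerivAt ℝ (fun q => (W q).2 σ) (W'.2 σ) p v) :
    HasLineDerivAt ℝ (fun q => lineDeriv ℝ g q (W q))
      (fderiv ℝ (fderiv ℝ (fun z : Jet k => g z.ext)) (p.trunc k) (v.trunc k)
        ((W p).trunc k) + lineDeriv ℝ g p W') p v := by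
  set G := fun z : Jet k => g z.ext with hG
  have hW : HasDerivAt (fun t : ℝ => (W (p + t • v)).trunc k) (W'.trunc k) 0 :=
    (hasDerivAt_pi.2 fun i => h1 i).prodMk (hasDerivAt_pi.2 fun σ => h2 σ.1 σ.2)
  have hc : HasDerivAt (fun t : ℝ => fderiv ℝ G (p.trunc k + t • v.trunc k))
      (fderiv ℝ (fderiv ℝ G) (p.trunc k) (v.trunc k)) 0 := by
    have h3 : ContDiffAt ℝ 1 (fderiv ℝ G) (p.trunc k) :=
      (hg.2.fderiv_right (m := ∞) (by simp)).of_le (by simp)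
    exact ((h3.differentiableAt (by simp)).hasFDerivAt).hasLineDerivAt (v.trunc k)
  have h4 := hc.clm_apply hW
  simp only [zero_smul, add_zero] at h4
  rw [hg.lineDeriv_eq]
  refine h4.congr_of_eventuallyEq ?_
  have hcont : Filter.Tendsto (fun t : ℝ => p.trunc k + t • v.trunc k) (𝓝 0)
      (𝓝 (p.trunc k)) := by
    have : Continuous fun t : ℝ => p.trunc k + t • v.trunc k := by fun_prop
    simpa using this.tendsto 0
  filter_upwards [hcont.eventually hg.eventually_differentiableAt] with t ht
  rw [← trunc_add_smul] at ht ⊢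
  exact hg.1.lineDeriv_eq_of_differentiableAt ht _

lemma SmoothAt.second_symm (hg : SmoothAt k g p) (v w : Jet k) :
    fderiv ℝ (fderiv ℝ (fun z : Jet k => g z.ext)) (p.trunc k) v w =
      fderiv ℝ (fderiv ℝ (fun z : Jet k => g z.ext)) (p.trunc k) w v :=
  (hg.2.of_le (m := 2) (by norm_cast)).isSymmSndFDerivAt (by simp) v w

end LineDeriv

/-! ### Total derivatives -/

/-- The direction of the total derivative `D_i`. -/
def dVec (i : Fin 3) (p : JetInf) : JetInf :=
  (Pi.single i 1, fun σ => p.2 (σ + Pi.single i 1))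

lemma totalDeriv_apply (i : Fin 3) (g : JetInf → ℝ) (p : JetInf) :
    totalDeriv i g p = lineDeriv ℝ g p (dVec i p) := rfl

lemma dVec_trunc (i : Fin 3) {k : ℕ} {p q : JetInf} (h : p.trunc (k + 1) = q.trunc (k + 1)) :
    (dVec i p).trunc k = (dVec i q).trunc k := by
  rw [trunc_eq_iff] at h ⊢
  refine ⟨rfl, fun σ hσ => h.2 _ ?_⟩
  rw [add_single_sum]
  omega

lemma HasOrder.totalDeriv {k : ℕ} {g : JetInf → ℝ} (hg : HasOrder k g) (i : Fin 3) :
    HasOrder (k + 1) (totalDeriv i g) := fun _ _ h =>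
  hg.lineDeriv_congr (trunc_eq_of_le (Nat.le_succ k) h) (dVec_trunc i h)

/-- `D_i g` pairs the differential of `g` at the projected jet with a direction that is linear in
the higher jet. The pairing formula is available only near the point, where `g` is differentiable,
and that is enough. -/
lemma SmoothAt.totalDeriv {k : ℕ} {g : JetInf → ℝ} {p : JetInf} (hg : SmoothAt k g p)
    (i : Fin 3) : SmoothAt (k + 1) (totalDeriv i g) p := by
  refine ⟨hg.1.totalDeriv i, ?_⟩
  have hp : projCLM (k + 1) k (p.trunc (k + 1)) = p.trunc k := proj_trunc (Nat.le_succ k) p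
  have h2 : ContDiff ℝ ∞ fun z : Jet (k + 1) => (dVec i z.ext).trunc k := by
    refine contDiff_const.prodMk (contDiff_pi.2 fun σ => ?_)
    exact contDiff_ext_snd (k + 1) (σ.1 + Pi.single i 1)
  have h3 : ContDiffAt ℝ ∞ (fun z : Jet (k + 1) =>
      fderiv ℝ (fun z : Jet k => g z.ext) (projCLM (k + 1) k z) ((dVec i z.ext).trunc k))
      (p.trunc (k + 1)) := by
    refine ContDiffAt.clm_apply ?_ h2.contDiffAt
    refine ContDiffAt.comp (p.trunc (k + 1)) ?_ (projCLM (k + 1) k).contDiff.contDiffAt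
    rw [hp]
    exact hg.2.fderiv_right (by simp)
  refine h3.congr_of_eventuallyEq ?_
  have hcont : Filter.Tendsto (projCLM (k + 1) k) (𝓝 (p.trunc (k + 1))) (𝓝 (p.trunc k)) := by
    rw [← hp]; exact (projCLM (k + 1) k).continuous.tendsto _
  filter_upwards [hcont.eventually hg.eventually_differentiableAt] with z hz
  exact hg.1.lineDeriv_eq_of_differentiableAt hz _

/-! ### Rules for line derivatives -/

section Rules

variable {g h : JetInf → ℝ} {g' h' : ℝ} {p v : JetInf}

lemma lineAdd (hg : HasLineDerivAt ℝ g g' p v) (hh : HasLineDerivAt ℝ h h' p v) :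
    HasLineDerivAt ℝ (fun q => g q + h q) (g' + h') p v := HasDerivAt.fun_add hg hh

lemma lineSub (hg : HasLineDerivAt ℝ g g' p v) (hh : HasLineDerivAt ℝ h h' p v) :
    HasLineDerivAt ℝ (fun q => g q - h q) (g' - h') p v := HasDerivAt.fun_sub hg hh

lemma lineNeg (hg : HasLineDerivAt ℝ g g' p v) :
    HasLineDerivAt ℝ (fun q => -g q) (-g') p v := HasDerivAt.fun_neg hg

lemma lineMul (hg : HasLineDerivAt ℝ g g' p v) (hh : HasLineDerivAt ℝ h h' p v) :
    HasLineDerivAt ℝ (fun q => g q * h q) (g' * h p + g p * h') p v := by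
  have := HasDerivAt.fun_mul hg hh
  simpa [HasLineDerivAt] using this

lemma lineDiv (hg : HasLineDerivAt ℝ g g' p v) (hh : HasLineDerivAt ℝ h h' p v)
    (h0 : h p ≠ 0) :
    HasLineDerivAt ℝ (fun q => g q / h q) ((g' * h p - g p * h') / h p ^ 2) p v := by
  have := HasDerivAt.fun_div hg hh (by simpa using h0)
  simpa [HasLineDerivAt] using this

lemma lineSum {ι : Type*} (s : Finset ι) {g : ι → JetInf → ℝ} {g' : ι → ℝ}
    (hg : ∀ i ∈ s, HasLineDerivAt ℝ (g i) (g' i) p v) :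
    HasLineDerivAt ℝ (fun q => ∑ i ∈ s, g i q) (∑ i ∈ s, g' i) p v :=
  HasDerivAt.fun_sum hg

lemma lineBase (i : Fin 3) (p v : JetInf) :
    HasLineDerivAt ℝ (fun q : JetInf => q.1 i) (v.1 i) p v := by
  unfold HasLineDerivAt
  simpa using ((hasDerivAt_id (0 : ℝ)).mul_const (v.1 i)).const_add (p.1 i)

lemma lineCoord (σ : Fin 3 → ℕ) (p v : JetInf) :
    HasLineDerivAt ℝ (fun q : JetInf => q.2 σ) (v.2 σ) p v := by
  unfold HasLineDerivAt
  simpa using ((hasDerivAt_id (0 : ℝ)).mul_const (v.2 σ)).const_add (p.2 σ)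

lemma lineConst (c : ℝ) (p v : JetInf) :
    HasLineDerivAt ℝ (fun _ : JetInf => c) 0 p v := hasDerivAt_const _ _

end Rules

/-! ### Partial derivatives of functions of `x` and `u` -/

/-- The partial derivative in `x`. -/
def partialX (b : ℝ → ℝ → ℝ) (x u : ℝ) : ℝ := deriv (fun x => b x u) x

/-- The partial derivative in `u`. -/
def partialU (b : ℝ → ℝ → ℝ) (x u : ℝ) : ℝ := deriv (fun u => b x u) u

/-- Smooth functions of `x` and `u`. -/
def Smooth₂ (b : ℝ → ℝ → ℝ) : Prop := ContDiff ℝ ∞ fun y : ℝ × ℝ => b y.1 y.2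

section Partial

variable {b : ℝ → ℝ → ℝ}

lemma Smooth₂.hasFDerivAt (hb : Smooth₂ b) (y : ℝ × ℝ) :
    HasFDerivAt (fun y : ℝ × ℝ => b y.1 y.2) (fderiv ℝ (fun y : ℝ × ℝ => b y.1 y.2) y) y :=
  (ContDiff.differentiable hb (by simp) y).hasFDerivAt

lemma Smooth₂.partialX_eq (hb : Smooth₂ b) (x u : ℝ) :
    partialX b x u = fderiv ℝ (fun y : ℝ × ℝ => b y.1 y.2) (x, u) (1, 0) := by
  have h1 : HasDerivAt (fun x : ℝ => (x, u)) ((1 : ℝ), (0 : ℝ)) x :=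
    (hasDerivAt_id x).prodMk (hasDerivAt_const x u)
  exact ((hb.hasFDerivAt (x, u)).comp_hasDerivAt x h1).deriv

lemma Smooth₂.partialU_eq (hb : Smooth₂ b) (x u : ℝ) :
    partialU b x u = fderiv ℝ (fun y : ℝ × ℝ => b y.1 y.2) (x, u) (0, 1) := by
  have h1 : HasDerivAt (fun u : ℝ => (x, u)) ((0 : ℝ), (1 : ℝ)) u :=
    (hasDerivAt_const u x).prodMk (hasDerivAt_id u)
  exact ((hb.hasFDerivAt (x, u)).comp_hasDerivAt u h1).deriv

lemma Smooth₂.partialX (hb : Smooth₂ b) : Smooth₂ (partialX b) := by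
  unfold Smooth₂
  simp only [hb.partialX_eq]
  exact (ContDiff.fderiv_right hb (by simp)).clm_apply contDiff_const

lemma Smooth₂.partialU (hb : Smooth₂ b) : Smooth₂ (partialU b) := by
  unfold Smooth₂
  simp only [hb.partialU_eq]
  exact (ContDiff.fderiv_right hb (by simp)).clm_apply contDiff_const

lemma Smooth₂.partial_comm (hb : Smooth₂ b) :
    FeedbackJets.partialX (FeedbackJets.partialU b) =
      FeedbackJets.partialU (FeedbackJets.partialX b) := by
  funext x u
  rw [hb.partialU.partialX_eq, hb.partialX.partialU_eq]
  simp only [hb.partialX_eq, hb.partialU_eq]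
  have hd : DifferentiableAt ℝ (fderiv ℝ fun y : ℝ × ℝ => b y.1 y.2) (x, u) :=
    (ContDiff.fderiv_right (m := ∞) hb (by simp)).differentiable (by simp) _
  rw [fderiv_clm_apply (c := fderiv ℝ fun y : ℝ × ℝ => b y.1 y.2) hd (by fun_prop),
    fderiv_clm_apply (c := fderiv ℝ fun y : ℝ × ℝ => b y.1 y.2) hd (by fun_prop)]
  have hs : IsSymmSndFDerivAt ℝ (fun y : ℝ × ℝ => b y.1 y.2) (x, u) :=
    ((ContDiff.contDiffAt hb).of_le (m := 2) (by norm_cast)).isSymmSndFDerivAt (by simp)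
  simpa using hs (1, 0) (0, 1)

lemma lineFun₁ {a : ℝ → ℝ} (ha : ContDiff ℝ ∞ a) (p v : JetInf) :
    HasLineDerivAt ℝ (fun q : JetInf => a (q.1 0)) (deriv a (p.1 0) * v.1 0) p v := by
  have h0 := lineBase 0 p v
  unfold HasLineDerivAt at h0 ⊢
  have h1 : HasDerivAt a (deriv a (p.1 0)) ((p + (0 : ℝ) • v).1 0) := by
    simpa using (ha.differentiable (by simp) (p.1 0)).hasDerivAt
  exact HasDerivAt.comp (h := fun t : ℝ => (p + t • v).1 0) 0 h1 h0

lemma lineFun₂ (hb : Smooth₂ b) (p v : JetInf) :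
    HasLineDerivAt ℝ (fun q : JetInf => b (q.1 0) (q.1 1))
      (FeedbackJets.partialX b (p.1 0) (p.1 1) * v.1 0 +
        FeedbackJets.partialU b (p.1 0) (p.1 1) * v.1 1) p v := by
  have h0 := lineBase 0 p v
  have h1 := lineBase 1 p v
  unfold HasLineDerivAt at h0 h1 ⊢
  have h2 : HasFDerivAt (fun y : ℝ × ℝ => b y.1 y.2)
      (fderiv ℝ (fun y : ℝ × ℝ => b y.1 y.2) (p.1 0, p.1 1))
      ((p + (0 : ℝ) • v).1 0, (p + (0 : ℝ) • v).1 1) := by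
    simpa using hb.hasFDerivAt (p.1 0, p.1 1)
  have h3 := h2.comp_hasDerivAt (0 : ℝ) (h0.prodMk h1)
  refine h3.congr_deriv ?_
  rw [hb.partialX_eq, hb.partialU_eq, mul_comm, mul_comm _ (v.1 1), ← smul_eq_mul,
    ← smul_eq_mul, ← map_smul, ← map_smul, ← map_add]
  simp

lemma SmoothAt.fun₁ {a : ℝ → ℝ} (ha : ContDiff ℝ ∞ a) (k : ℕ) (p : JetInf) :
    SmoothAt k (fun q => a (q.1 0)) p :=
  SmoothAt.comp_trunc (G := fun z : Jet k => a (z.1 0)) (by fun_prop)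

lemma SmoothAt.fun₂ (hb : Smooth₂ b) (k : ℕ) (p : JetInf) :
    SmoothAt k (fun q => b (q.1 0) (q.1 1)) p :=
  SmoothAt.comp_trunc (G := fun z : Jet k => b (z.1 0) (z.1 1))
    ((ContDiff.comp (g := fun y : ℝ × ℝ => b y.1 y.2) hb
      (f := fun z : Jet k => (z.1 0, z.1 1)) (by fun_prop)).contDiffAt)

end Partial

lemma smooth_deriv {a : ℝ → ℝ} (ha : ContDiff ℝ ∞ a) : ContDiff ℝ ∞ (deriv a) := by
  have : ContDiff ℝ (∞ + 1) a := by simpa using ha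
  exact (contDiff_succ_iff_deriv.1 this).2.2

/-! ### Commuting total derivatives -/

/-- Either order gives the second differential of `g` on the directions of `D_i` and `D_j`, plus a
first-order term involving `f_{σ+e_i+e_j}`. Both parts are symmetric in `i` and `j`. -/
lemma totalDeriv_comm {k : ℕ} {g : JetInf → ℝ} {p : JetInf} (hg : SmoothAt k g p)
    (i j : Fin 3) :
    totalDeriv i (totalDeriv j g) p = totalDeriv j (totalDeriv i g) p := by
  have key : ∀ i j : Fin 3, totalDeriv i (totalDeriv j g) p =
      fderiv ℝ (fderiv ℝ (fun z : Jet k => g z.ext)) (p.trunc k) ((dVec i p).trunc k)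
        ((dVec j p).trunc k) +
      lineDeriv ℝ g p (0, fun σ => p.2 (σ + Pi.single j 1 + Pi.single i 1)) := by
    intro i j
    exact (hg.hasLineDerivAt_lineDeriv (W := dVec j) (v := dVec i p)
      (W' := (0, fun σ => p.2 (σ + Pi.single j 1 + Pi.single i 1)))
      (fun l => lineConst _ p _) (fun σ _ => lineCoord _ p _)).lineDeriv
  rw [key, key, hg.second_symm]
  congr 3
  funext σ
  rw [add_right_comm]

/-- Functions of order `k`, smooth on the whole jet space. -/
def SmoothFun (k : ℕ) (g : JetInf → ℝ) : Prop := ∀ p, SmoothAt k g p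

lemma SmoothFun.totalDeriv {k : ℕ} {g : JetInf → ℝ} (hg : SmoothFun k g) (i : Fin 3) :
    SmoothFun (k + 1) (totalDeriv i g) := fun p => (hg p).totalDeriv i

lemma SmoothFun.iterate_totalDeriv {k : ℕ} {g : JetInf → ℝ} (hg : SmoothFun k g) (i : Fin 3)
    (n : ℕ) : SmoothFun (k + n) ((FeedbackJets.totalDeriv i)^[n] g) := by
  induction n with
  | zero => exact hg
  | succ n ih =>
    rw [Function.iterate_succ_apply']
    exact ih.totalDeriv i

lemma SmoothFun.totalDeriv_iterate_comm {k : ℕ} {g : JetInf → ℝ} (hg : SmoothFun k g)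
    (i j : Fin 3) (n : ℕ) :
    FeedbackJets.totalDeriv i ((FeedbackJets.totalDeriv j)^[n] g) =
      (FeedbackJets.totalDeriv j)^[n] (FeedbackJets.totalDeriv i g) := by
  induction n with
  | zero => rfl
  | succ n ih =>
    rw [Function.iterate_succ_apply', Function.iterate_succ_apply', ← ih]
    funext p
    exact totalDeriv_comm (hg.iterate_totalDeriv j n p) i j

lemma SmoothFun.totalDerivIter {k : ℕ} {g : JetInf → ℝ} (hg : SmoothFun k g)
    (σ : Fin 3 → ℕ) : SmoothFun (k + ∑ i, σ i) (totalDerivIter σ g) := by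
  have := ((hg.iterate_totalDeriv 2 (σ 2)).iterate_totalDeriv 1 (σ 1)).iterate_totalDeriv
    0 (σ 0)
  have h : k + ∑ i, σ i = k + σ 2 + σ 1 + σ 0 := by
    rw [Fin.sum_univ_three]; ring
  rw [h]
  exact this

lemma SmoothFun.totalDeriv_totalDerivIter {k : ℕ} {g : JetInf → ℝ} (hg : SmoothFun k g)
    (i : Fin 3) (σ : Fin 3 → ℕ) :
    FeedbackJets.totalDeriv i (FeedbackJets.totalDerivIter σ g) =
      FeedbackJets.totalDerivIter (σ + Pi.single i 1) g := by
  unfold FeedbackJets.totalDerivIter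
  fin_cases i
  · simp [← Function.iterate_succ_apply']
  · simp only [Fin.mk_one, Pi.add_apply, Pi.single_eq_same, Fin.isValue]
    rw [((hg.iterate_totalDeriv 2 _).iterate_totalDeriv 1 _).totalDeriv_iterate_comm,
      ← Function.iterate_succ_apply' (FeedbackJets.totalDeriv 1)]
    simp
  · simp only [Fin.reduceFinMk, Pi.add_apply, Pi.single_eq_same, Fin.isValue]
    rw [((hg.iterate_totalDeriv 2 _).iterate_totalDeriv 1 _).totalDeriv_iterate_comm,
      (hg.iterate_totalDeriv 2 _).totalDeriv_iterate_comm,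
      ← Function.iterate_succ_apply' (FeedbackJets.totalDeriv 2)]
    simp

lemma totalDerivIter_zero (g : JetInf → ℝ) : totalDerivIter 0 g = g := rfl

/-! ### Prolonged feedback fields -/

/-- A smooth feedback vector field `a(x) ∂_x + b(x, u) ∂_u`. -/
structure SmoothPair (a : ℝ → ℝ) (b : ℝ → ℝ → ℝ) : Prop where
  left : ContDiff ℝ ∞ a
  right : Smooth₂ b

section Prolong

variable {a : ℝ → ℝ} {b : ℝ → ℝ → ℝ}

lemma baseComponent_zero (p : JetInf) : baseComponent a b p 0 = a (p.1 0) := rfl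

lemma baseComponent_one (p : JetInf) : baseComponent a b p 1 = b (p.1 0) (p.1 1) := rfl

lemma baseComponent_two (p : JetInf) : baseComponent a b p 2 =
    p.1 2 * partialU b (p.1 0) (p.1 1) + p.2 (idx 0 0 0) * partialX b (p.1 0) (p.1 1) := rfl

lemma idx_sum (i j l : ℕ) : ∑ m, idx i j l m = i + j + l := by
  simp [idx, Fin.sum_univ_three]

lemma SmoothPair.baseComponent (h : SmoothPair a b) (i : Fin 3) :
    SmoothFun 0 (fun p => baseComponent a b p i) := by
  intro p
  fin_cases i
  · exact SmoothAt.fun₁ h.left 0 p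
  · exact SmoothAt.fun₂ h.right 0 p
  · exact ((SmoothAt.base 0 2 p).mul (SmoothAt.fun₂ h.right.partialU 0 p)).add
      ((SmoothAt.coord (by simp [idx_sum]) p).mul (SmoothAt.fun₂ h.right.partialX 0 p))

lemma SmoothPair.generatingFunction (h : SmoothPair a b) :
    SmoothFun 1 (generatingFunction a b) := by
  intro p
  refine ((SmoothAt.fun₁ (smooth_deriv h.left) 1 p).mul
    (SmoothAt.coord (by simp [idx_sum]) p)).sub (SmoothAt.sum _ fun i _ => ?_)
  exact ((h.baseComponent i p).mono (by simp)).mul (SmoothAt.coord (single_sum i).le p)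

lemma SmoothPair.prolongInf_snd (h : SmoothPair a b) (σ : Fin 3 → ℕ) :
    SmoothFun (1 + ∑ i, σ i) (fun p => (prolongInf a b p).2 σ) := by
  intro p
  refine ((h.generatingFunction.totalDerivIter σ) p).add (SmoothAt.sum _ fun i _ => ?_)
  refine ((h.baseComponent i p).mono (by simp)).mul (SmoothAt.coord ?_ p)
  rw [add_single_sum]
  omega

/-- The components of a prolonged field vanish recursively: the standard prolongation formula. -/
lemma SmoothPair.prolongInf_succ (h : SmoothPair a b) (σ : Fin 3 → ℕ) (i : Fin 3)
    (p : JetInf) :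
    (prolongInf a b p).2 (σ + Pi.single i 1) =
      totalDeriv i (fun q => (prolongInf a b q).2 σ) p -
        ∑ j, totalDeriv i (fun q => FeedbackJets.baseComponent a b q j) p *
          p.2 (σ + Pi.single j 1) := by
  have h1 : totalDeriv i (fun q => (prolongInf a b q).2 σ) p =
      FeedbackJets.totalDerivIter (σ + Pi.single i 1) (FeedbackJets.generatingFunction a b) p +
        ∑ j, (totalDeriv i (fun q => FeedbackJets.baseComponent a b q j) p *
          p.2 (σ + Pi.single j 1) + FeedbackJets.baseComponent a b p j *
            p.2 (σ + Pi.single j 1 + Pi.single i 1)) := by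
    rw [← h.generatingFunction.totalDeriv_totalDerivIter]
    refine HasLineDerivAt.lineDeriv (lineAdd ?_ (lineSum _ fun j _ => lineMul ?_ ?_))
    · exact (h.generatingFunction.totalDerivIter σ p).hasLineDerivAt' _
    · exact (h.baseComponent j p).hasLineDerivAt' _
    · exact lineCoord _ _ _
  rw [h1, Finset.sum_add_distrib]
  simp only [prolongInf, add_right_comm σ]
  ring

lemma prolongInf_zero (p : JetInf) :
    (prolongInf a b p).2 0 = deriv a (p.1 0) * p.2 (idx 0 0 0) := by
  simp [prolongInf, totalDerivIter_zero, generatingFunction]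

lemma exists_eq_add_single {σ : Fin 3 → ℕ} {n : ℕ} (h : ∑ i, σ i = n + 1) :
    ∃ (τ : Fin 3 → ℕ) (i : Fin 3), σ = τ + Pi.single i 1 ∧ ∑ i, τ i = n := by
  obtain ⟨i, -, hi⟩ := Finset.exists_ne_zero_of_sum_ne_zero (h.trans_ne (Nat.succ_ne_zero n))
  have h1 : σ = (σ - Pi.single i 1) + Pi.single i 1 := by
    funext j
    by_cases hj : j = i
    · subst hj; simp; omega
    · simp [hj]
  refine ⟨σ - Pi.single i 1, i, h1, ?_⟩
  rw [h1, add_single_sum] at h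
  omega

/-- The component along `f_σ` is a function of the `|σ|`-jet. -/
lemma SmoothPair.hasOrder_prolongInf (h : SmoothPair a b) (n : ℕ) :
    ∀ σ : Fin 3 → ℕ, ∑ i, σ i = n → HasOrder n (fun p => (prolongInf a b p).2 σ) := by
  induction n with
  | zero =>
    intro σ hσ
    have h0 : σ = 0 := by
      funext i
      exact (Finset.sum_eq_zero_iff.1 hσ) i (Finset.mem_univ i)
    subst h0
    simp only [prolongInf_zero]
    intro p q hpq
    rw [trunc_eq_iff] at hpq
    change deriv a (p.1 0) * p.2 (idx 0 0 0) = deriv a (q.1 0) * q.2 (idx 0 0 0)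
    rw [hpq.1, hpq.2 (idx 0 0 0) (by simp [idx_sum])]
  | succ n ih =>
    intro σ hσ
    -- In the recursive formula, unlike the defining one, no coordinate of order `|σ| + 1` occurs,
    -- so each step raises the order by exactly one.
    obtain ⟨τ, i, rfl, hτ⟩ := exists_eq_add_single hσ
    intro p q hpq
    simp only [h.prolongInf_succ]
    rw [(ih τ hτ).totalDeriv i p q hpq]
    congr 1
    refine Finset.sum_congr rfl fun j _ => ?_
    rw [(((h.baseComponent j p).1.totalDeriv i).mono (Nat.le_add_left _ _)) p q hpq,
      (trunc_eq_iff.1 hpq).2 _ (by rw [add_single_sum, hτ])]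

lemma SmoothPair.trunc_prolongInf (h : SmoothPair a b) {k : ℕ} {p q : JetInf}
    (hpq : p.trunc k = q.trunc k) :
    (prolongInf a b p).trunc k = (prolongInf a b q).trunc k := by
  rw [trunc_eq_iff]
  refine ⟨funext fun i => ((h.baseComponent i p).1.mono (Nat.zero_le k)) p q hpq,
    fun σ hσ => ((h.hasOrder_prolongInf _ σ rfl).mono hσ) p q hpq⟩

/-- The field on `J^k` may be computed at any infinite jet above the point, not only at the
extension by zero. This freedom is needed when `k` is too small for regularity to be visible on
`J^k`. -/
lemma SmoothPair.feedbackField_trunc (h : SmoothPair a b) (k : ℕ) (p : JetInf) :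
    feedbackField a b k (p.trunc k) = (prolongInf a b p).trunc k :=
  h.trunc_prolongInf (Jet.trunc_ext _)

/-- The defining formula shows smoothness of the `f_σ`-component only on `J^(|σ|+1)`; this transfers
it to the jet space on which the component really depends. -/
lemma SmoothFun.of_hasOrder {k l : ℕ} {g : JetInf → ℝ} (hg : SmoothFun l g)
    (h : HasOrder k g) : SmoothFun k g := by
  intro p
  refine ⟨h, ?_⟩
  have h1 : (fun z : Jet k => g z.ext) = (fun z : Jet l => g z.ext) ∘ projCLM k l := by
    funext z
    exact ((hg p).1.ext_trunc z.ext).symm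
  rw [h1]
  refine ContDiffAt.comp _ ?_ (projCLM k l).contDiff.contDiffAt
  exact (hg _).2

lemma SmoothPair.contDiff_feedbackField (h : SmoothPair a b) (k : ℕ) :
    ContDiff ℝ ∞ (feedbackField a b k) := by
  refine ContDiff.prodMk (contDiff_pi.2 fun i => ?_) (contDiff_pi.2 fun σ => ?_)
  · rw [contDiff_iff_contDiffAt]
    intro z
    simpa [prolongInf] using (((h.baseComponent i) z.ext).mono (Nat.zero_le k)).2
  · rw [contDiff_iff_contDiffAt]
    intro z
    simpa using ((((h.prolongInf_snd σ.1).of_hasOrder (h.hasOrder_prolongInf _ σ.1 rfl))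
      z.ext).mono σ.2).2

/-- The derivative along a prolonged feedback field. -/
def feedbackDeriv (a : ℝ → ℝ) (b : ℝ → ℝ → ℝ) (g : JetInf → ℝ) (p : JetInf) : ℝ :=
  lineDeriv ℝ g p (prolongInf a b p)

/-- Commutator of a prolonged field with a total derivative. -/
lemma SmoothPair.feedbackDeriv_totalDeriv (h : SmoothPair a b) {k : ℕ} {g : JetInf → ℝ}
    {p : JetInf} (hg : SmoothAt k g p) (i : Fin 3) :
    feedbackDeriv a b (totalDeriv i g) p = totalDeriv i (feedbackDeriv a b g) p -
      ∑ j, totalDeriv i (fun q => FeedbackJets.baseComponent a b q j) p * totalDeriv j g p := by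
  -- Differentiating along the two fields in either order produces the same second differential of
  -- `g`. The commutator is thus the difference of the first-order corrections `W'`.
  have e1 := (hg.hasLineDerivAt_lineDeriv (W := dVec i) (v := prolongInf a b p)
      (W' := (0, fun σ => (prolongInf a b p).2 (σ + Pi.single i 1)))
      (fun l => lineConst _ p _) (fun σ _ => lineCoord _ p _)).lineDeriv
  have e2 := (hg.hasLineDerivAt_lineDeriv (W := prolongInf a b) (v := dVec i p)
      (W' := (fun j => totalDeriv i (fun q => FeedbackJets.baseComponent a b q j) p,
        fun σ => totalDeriv i (fun q => (prolongInf a b q).2 σ) p))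
      (fun j => (h.baseComponent j p).hasLineDerivAt' _)
      (fun σ _ => (h.prolongInf_snd σ p).hasLineDerivAt' _)).lineDeriv
  -- This is the prolongation recursion in vector form: the derivative of the prolonged field along
  -- `D_i` is its shift plus `∑ D_i(ξ_j) D_j`.
  have e3 : ((fun j => totalDeriv i (fun q => FeedbackJets.baseComponent a b q j) p,
        fun σ => totalDeriv i (fun q => (prolongInf a b q).2 σ) p) : JetInf) =
      (0, fun σ => (prolongInf a b p).2 (σ + Pi.single i 1)) +
        ∑ j, totalDeriv i (fun q => FeedbackJets.baseComponent a b q j) p • dVec j p := by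
    refine Prod.ext (funext fun j => ?_) (funext fun σ => ?_)
    · fin_cases j <;> simp [Fin.sum_univ_three, dVec]
    · simp only [h.prolongInf_succ, Prod.snd_add, Pi.add_apply, Prod.snd_sum, Prod.smul_snd,
        Finset.sum_apply, Pi.smul_apply, dVec, smul_eq_mul]
      ring
  have e4 : lineDeriv ℝ g p (∑ j, totalDeriv i (fun q => FeedbackJets.baseComponent a b q j) p •
      dVec j p) = ∑ j, totalDeriv i (fun q => FeedbackJets.baseComponent a b q j) p *
        totalDeriv j g p := by
    simp only [Fin.sum_univ_three, hg.lineDeriv_add, hg.lineDeriv_smul]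
    rfl
  rw [e3, hg.lineDeriv_add, e4] at e2
  have e1' : feedbackDeriv a b (totalDeriv i g) p = _ := e1
  have e2' : totalDeriv i (feedbackDeriv a b g) p = _ := e2
  rw [e1', e2', hg.second_symm]
  ring

end Prolong

/-! ### Regular infinite jets and the invariant frame -/

/-- Regular infinite jets. -/
def RegInf (p : JetInf) : Prop :=
  p.2 (idx 0 0 0) ≠ 0 ∧ p.2 (idx 0 0 1) ≠ 0 ∧ p.2 (idx 0 0 2) ≠ 0 ∧
    p.1 2 * p.2 (idx 0 0 1) - p.2 (idx 0 0 0) ≠ 0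

lemma isOpen_regInf : IsOpen {p : JetInf | RegInf p} := by
  have h (σ : Fin 3 → ℕ) : Continuous fun p : JetInf => p.2 σ :=
    (continuous_apply σ).comp continuous_snd
  have h2 : Continuous fun p : JetInf => p.1 2 := (continuous_apply 2).comp continuous_fst
  exact (isOpen_ne_fun (h _) continuous_const).inter <|
    (isOpen_ne_fun (h _) continuous_const).inter <|
    (isOpen_ne_fun (h _) continuous_const).inter <|
    isOpen_ne_fun ((h2.mul (h _)).sub (h _)) continuous_const

/-- Regularity is an open condition along every line, so identities known only on the regular set
may be differentiated there. -/
lemma lineDeriv_congr_regInf {g h : JetInf → ℝ} (H : ∀ q, RegInf q → g q = h q) {p : JetInf}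
    (hp : RegInf p) (v : JetInf) : lineDeriv ℝ g p v = lineDeriv ℝ h p v := by
  unfold lineDeriv
  refine Filter.EventuallyEq.deriv_eq ?_
  have hc : Continuous fun t : ℝ => p + t • v := by fun_prop
  have : ∀ᶠ t in 𝓝 (0 : ℝ), p + t • v ∈ {p : JetInf | RegInf p} :=
    (hc.tendsto' 0 p (by simp)).eventually (isOpen_regInf.mem_nhds hp)
  exact this.mono fun t ht => H _ ht

/-- The expression `f₁ f_x - f f_{x1} - u₁ f_{u1} + f_u + (f f_x + u₁ f_u) f_{11} / f₁`, on which
feedback fields act, up to a multiple of itself, through `a_xx` only. -/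
def sprayTerm (p : JetInf) : ℝ :=
  p.2 (idx 0 0 1) * p.2 (idx 1 0 0) - p.2 (idx 0 0 0) * p.2 (idx 1 0 1) -
    p.1 2 * p.2 (idx 0 1 1) + p.2 (idx 0 1 0) +
    (p.2 (idx 0 0 0) * p.2 (idx 1 0 0) + p.1 2 * p.2 (idx 0 1 0)) * p.2 (idx 0 0 2) /
      p.2 (idx 0 0 1)

/-- The coefficient of `D_{u₁}` in the first invariant derivation. -/
def sprayCoeff (p : JetInf) : ℝ :=
  sprayTerm p / p.2 (idx 0 0 2) -
    (p.2 (idx 0 0 0) * p.2 (idx 1 0 0) + p.1 2 * p.2 (idx 0 1 0)) / p.2 (idx 0 0 1)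

/-- The coefficients of three invariant derivations with respect to `D_x, D_u, D_{u₁}`. -/
def frame (n i : Fin 3) (p : JetInf) : ℝ :=
  (![![p.2 (idx 0 0 0), p.1 2, sprayCoeff p],
    ![0, (p.1 2 * p.2 (idx 0 0 1) - p.2 (idx 0 0 0)) / p.2 (idx 0 0 1),
      -((p.1 2 * p.2 (idx 0 0 1) - p.2 (idx 0 0 0)) * p.2 (idx 0 1 0) / p.2 (idx 0 0 1) ^ 2)],
    ![0, 0, p.2 (idx 0 0 0) / p.2 (idx 0 0 1)]] : Fin 3 → Fin 3 → ℝ) n i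

/-- The invariant derivations. -/
def frameDeriv (n : Fin 3) (g : JetInf → ℝ) (p : JetInf) : ℝ :=
  ∑ i, frame n i p * totalDeriv i g p

lemma smoothAt_coord' (k : ℕ) (i j l : ℕ) (h : i + j + l ≤ k) (p : JetInf) :
    SmoothAt k (fun q => q.2 (idx i j l)) p := SmoothAt.coord (by rwa [idx_sum]) p

lemma smoothAt_sprayCoeff {p : JetInf} (hp : RegInf p) : SmoothAt 2 sprayCoeff p := by
  obtain ⟨h0, h1, h2, h3⟩ := hp
  have c (i j l : ℕ) (h : i + j + l ≤ 2) := smoothAt_coord' 2 i j l h p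
  have b := SmoothAt.base 2 2 p
  have e := ((c 0 0 0 (by simp)).mul (c 1 0 0 (by simp))).add (b.mul (c 0 1 0 (by simp)))
  exact ((((((c 0 0 1 (by simp)).mul (c 1 0 0 (by simp))).sub
    ((c 0 0 0 (by simp)).mul (c 1 0 1 (by simp)))).sub (b.mul (c 0 1 1 (by simp)))).add
    (c 0 1 0 (by simp))).add ((e.mul (c 0 0 2 (by simp))).div (c 0 0 1 (by simp)) h1)).div
    (c 0 0 2 (by simp)) h2 |>.sub (e.div (c 0 0 1 (by simp)) h1)

lemma smoothAt_frame {p : JetInf} (hp : RegInf p) (n i : Fin 3) :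
    SmoothAt 2 (frame n i) p := by
  have hs := smoothAt_sprayCoeff hp
  obtain ⟨h0, h1, h2, h3⟩ := hp
  have c (i j l : ℕ) (h : i + j + l ≤ 2) := smoothAt_coord' 2 i j l h p
  have b := SmoothAt.base 2 2 p
  have d := (b.mul (c 0 0 1 (by simp))).sub (c 0 0 0 (by simp))
  fin_cases n <;> fin_cases i
  · exact c 0 0 0 (by simp)
  · exact b
  · exact hs
  · exact SmoothAt.const 2 0 p
  · exact d.div (c 0 0 1 (by simp)) h1
  · exact ((d.mul (c 0 1 0 (by simp))).div ((c 0 0 1 (by simp)).pow 2) (pow_ne_zero 2 h1)).neg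
  · exact SmoothAt.const 2 0 p
  · exact SmoothAt.const 2 0 p
  · exact (c 0 0 0 (by simp)).div (c 0 0 1 (by simp)) h1

lemma SmoothAt.frameDeriv {k : ℕ} {g : JetInf → ℝ} {p : JetInf} (hg : SmoothAt k g p)
    (hk : 1 ≤ k) (hp : RegInf p) (n : Fin 3) : SmoothAt (k + 1) (frameDeriv n g) p :=
  SmoothAt.sum _ fun i _ => ((smoothAt_frame hp n i).mono (by omega)).mul (hg.totalDeriv i)

/-! ### Feedback action on jets of low order and on the invariant frame -/

section Action

variable {a : ℝ → ℝ} {b : ℝ → ℝ → ℝ}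

lemma totalDeriv_base_zero (h : SmoothPair a b) (p : JetInf) (i : Fin 3) :
    totalDeriv i (fun q => baseComponent a b q 0) p = ![deriv a (p.1 0), 0, 0] i := by
  refine ((lineFun₁ h.left p _).lineDeriv).trans ?_
  fin_cases i <;> simp

lemma totalDeriv_base_one (h : SmoothPair a b) (p : JetInf) (i : Fin 3) :
    totalDeriv i (fun q => baseComponent a b q 1) p =
      ![partialX b (p.1 0) (p.1 1), partialU b (p.1 0) (p.1 1), 0] i := by
  refine ((lineFun₂ h.right p _).lineDeriv).trans ?_
  fin_cases i <;> simp

lemma idx_zero : idx 0 0 0 = 0 := by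
  funext i; fin_cases i <;> rfl

lemma idx_add_single (i j l : ℕ) (m : Fin 3) : idx i j l + Pi.single m 1 =
    ![idx (i + 1) j l, idx i (j + 1) l, idx i j (l + 1)] m := by
  funext n; fin_cases m <;> fin_cases n <;> simp [idx]

lemma totalDeriv_base_two (h : SmoothPair a b) (p : JetInf) (i : Fin 3) :
    totalDeriv i (fun q => baseComponent a b q 2) p =
      ![p.1 2 * partialX (partialU b) (p.1 0) (p.1 1) +
          p.2 (idx 0 0 0) * partialX (partialX b) (p.1 0) (p.1 1) +
          p.2 (idx 1 0 0) * partialX b (p.1 0) (p.1 1),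
        p.1 2 * partialU (partialU b) (p.1 0) (p.1 1) +
          p.2 (idx 0 0 0) * partialX (partialU b) (p.1 0) (p.1 1) +
          p.2 (idx 0 1 0) * partialX b (p.1 0) (p.1 1),
        partialU b (p.1 0) (p.1 1) + p.2 (idx 0 0 1) * partialX b (p.1 0) (p.1 1)] i := by
  refine (lineAdd (lineMul (lineBase 2 p _) (lineFun₂ h.right.partialU p _))
    (lineMul (lineCoord (idx 0 0 0) p _) (lineFun₂ h.right.partialX p _))).lineDeriv.trans ?_
  rw [← h.right.partial_comm]
  fin_cases i <;> simp [idx_add_single] <;> ring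

lemma feedbackDeriv_coord (σ : Fin 3 → ℕ) (p : JetInf) :
    feedbackDeriv a b (fun q => q.2 σ) p = (prolongInf a b p).2 σ := (lineCoord _ _ _).lineDeriv

lemma prolongInf_f (p : JetInf) :
    (prolongInf a b p).2 (idx 0 0 0) = deriv a (p.1 0) * p.2 (idx 0 0 0) := by
  rw [idx_zero, prolongInf_zero, idx_zero]

/-- The recursion with explicit indices, from which the components along `f_x`, `f_u`, `f_1`,
`f_11`, `f_x1`, `f_u1` are computed one after another. -/
lemma SmoothPair.prolongInf_idx_succ (h : SmoothPair a b) (i j l : ℕ) (m : Fin 3)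
    (p : JetInf) :
    (prolongInf a b p).2 (![idx (i + 1) j l, idx i (j + 1) l, idx i j (l + 1)] m) =
      FeedbackJets.totalDeriv m (fun q => (prolongInf a b q).2 (idx i j l)) p -
      (FeedbackJets.totalDeriv m (fun q => FeedbackJets.baseComponent a b q 0) p *
          p.2 (idx (i + 1) j l) +
        FeedbackJets.totalDeriv m (fun q => FeedbackJets.baseComponent a b q 1) p *
          p.2 (idx i (j + 1) l) +
        FeedbackJets.totalDeriv m (fun q => FeedbackJets.baseComponent a b q 2) p *
          p.2 (idx i j (l + 1))) := by
  rw [← idx_add_single, h.prolongInf_succ, Fin.sum_univ_three]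
  simp [idx_add_single]

lemma totalDeriv_prolongInf_f (h : SmoothPair a b) (m : Fin 3) (p : JetInf) :
    totalDeriv m (fun q => (prolongInf a b q).2 (idx 0 0 0)) p =
      ![deriv (deriv a) (p.1 0) * p.2 (idx 0 0 0) + deriv a (p.1 0) * p.2 (idx 1 0 0),
        deriv a (p.1 0) * p.2 (idx 0 1 0), deriv a (p.1 0) * p.2 (idx 0 0 1)] m := by
  simp only [prolongInf_f]
  refine (lineMul (lineFun₁ (smooth_deriv h.left) p _) (lineCoord (idx 0 0 0) p _)).lineDeriv.trans
    ?_
  fin_cases m <;> simp [idx_add_single]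

lemma prolongInf_f₁ (h : SmoothPair a b) (p : JetInf) :
    (prolongInf a b p).2 (idx 0 0 1) =
      (deriv a (p.1 0) - (partialU b (p.1 0) (p.1 1) +
        p.2 (idx 0 0 1) * partialX b (p.1 0) (p.1 1))) * p.2 (idx 0 0 1) := by
  have := h.prolongInf_idx_succ 0 0 0 2 p
  rw [totalDeriv_base_zero h, totalDeriv_base_one h, totalDeriv_base_two h,
    totalDeriv_prolongInf_f h] at this
  simp at this
  rw [this]; ring

lemma prolongInf_fx (h : SmoothPair a b) (p : JetInf) :
    (prolongInf a b p).2 (idx 1 0 0) =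
      deriv (deriv a) (p.1 0) * p.2 (idx 0 0 0) -
        partialX b (p.1 0) (p.1 1) * p.2 (idx 0 1 0) -
        (p.1 2 * partialX (partialU b) (p.1 0) (p.1 1) +
          p.2 (idx 0 0 0) * partialX (partialX b) (p.1 0) (p.1 1) +
          p.2 (idx 1 0 0) * partialX b (p.1 0) (p.1 1)) * p.2 (idx 0 0 1) := by
  have := h.prolongInf_idx_succ 0 0 0 0 p
  rw [totalDeriv_base_zero h, totalDeriv_base_one h, totalDeriv_base_two h,
    totalDeriv_prolongInf_f h] at this
  simp at this
  rw [this]; ring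

lemma prolongInf_fu (h : SmoothPair a b) (p : JetInf) :
    (prolongInf a b p).2 (idx 0 1 0) =
      (deriv a (p.1 0) - partialU b (p.1 0) (p.1 1)) * p.2 (idx 0 1 0) -
        (p.1 2 * partialU (partialU b) (p.1 0) (p.1 1) +
          p.2 (idx 0 0 0) * partialX (partialU b) (p.1 0) (p.1 1) +
          p.2 (idx 0 1 0) * partialX b (p.1 0) (p.1 1)) * p.2 (idx 0 0 1) := by
  have := h.prolongInf_idx_succ 0 0 0 1 p
  rw [totalDeriv_base_zero h, totalDeriv_base_one h, totalDeriv_base_two h,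
    totalDeriv_prolongInf_f h] at this
  simp at this
  rw [this]; ring

lemma totalDeriv_prolongInf_f₁ (h : SmoothPair a b) (m : Fin 3) (p : JetInf) :
    totalDeriv m (fun q => (prolongInf a b q).2 (idx 0 0 1)) p =
      (deriv a (p.1 0) - (partialU b (p.1 0) (p.1 1) +
        p.2 (idx 0 0 1) * partialX b (p.1 0) (p.1 1))) *
          ![p.2 (idx 1 0 1), p.2 (idx 0 1 1), p.2 (idx 0 0 2)] m +
      ![deriv (deriv a) (p.1 0) - (partialX (partialU b) (p.1 0) (p.1 1) +
          p.2 (idx 0 0 1) * partialX (partialX b) (p.1 0) (p.1 1) +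
          p.2 (idx 1 0 1) * partialX b (p.1 0) (p.1 1)),
        -(partialU (partialU b) (p.1 0) (p.1 1) +
          p.2 (idx 0 0 1) * partialX (partialU b) (p.1 0) (p.1 1) +
          p.2 (idx 0 1 1) * partialX b (p.1 0) (p.1 1)),
        -(p.2 (idx 0 0 2) * partialX b (p.1 0) (p.1 1))] m * p.2 (idx 0 0 1) := by
  simp only [prolongInf_f₁ h]
  refine (lineMul (lineSub (lineFun₁ (smooth_deriv h.left) p _)
    (lineAdd (lineFun₂ h.right.partialU p _) (lineMul (lineCoord (idx 0 0 1) p _)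
      (lineFun₂ h.right.partialX p _)))) (lineCoord (idx 0 0 1) p _)).lineDeriv.trans ?_
  rw [← h.right.partial_comm]
  fin_cases m <;> simp [idx_add_single] <;> ring

lemma prolongInf_f₁₁ (h : SmoothPair a b) (p : JetInf) :
    (prolongInf a b p).2 (idx 0 0 2) =
      (deriv a (p.1 0) - 2 * partialU b (p.1 0) (p.1 1) -
        3 * p.2 (idx 0 0 1) * partialX b (p.1 0) (p.1 1)) * p.2 (idx 0 0 2) := by
  have := h.prolongInf_idx_succ 0 0 1 2 p
  rw [totalDeriv_base_zero h, totalDeriv_base_one h, totalDeriv_base_two h,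
    totalDeriv_prolongInf_f₁ h] at this
  simp at this
  rw [this]; ring

lemma prolongInf_fx₁ (h : SmoothPair a b) (p : JetInf) :
    (prolongInf a b p).2 (idx 1 0 1) =
      deriv (deriv a) (p.1 0) * p.2 (idx 0 0 1) -
        (partialX (partialU b) (p.1 0) (p.1 1) +
          p.2 (idx 0 0 1) * partialX (partialX b) (p.1 0) (p.1 1) +
          p.2 (idx 1 0 1) * partialX b (p.1 0) (p.1 1)) * p.2 (idx 0 0 1) -
        (partialU b (p.1 0) (p.1 1) + p.2 (idx 0 0 1) * partialX b (p.1 0) (p.1 1)) *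
          p.2 (idx 1 0 1) -
        partialX b (p.1 0) (p.1 1) * p.2 (idx 0 1 1) -
        (p.1 2 * partialX (partialU b) (p.1 0) (p.1 1) +
          p.2 (idx 0 0 0) * partialX (partialX b) (p.1 0) (p.1 1) +
          p.2 (idx 1 0 0) * partialX b (p.1 0) (p.1 1)) * p.2 (idx 0 0 2) := by
  have := h.prolongInf_idx_succ 0 0 1 0 p
  rw [totalDeriv_base_zero h, totalDeriv_base_one h, totalDeriv_base_two h,
    totalDeriv_prolongInf_f₁ h] at this
  simp at this
  rw [this]; ring

lemma prolongInf_fu₁ (h : SmoothPair a b) (p : JetInf) :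
    (prolongInf a b p).2 (idx 0 1 1) =
      (deriv a (p.1 0) - (partialU b (p.1 0) (p.1 1) +
          p.2 (idx 0 0 1) * partialX b (p.1 0) (p.1 1))) * p.2 (idx 0 1 1) -
        (partialU (partialU b) (p.1 0) (p.1 1) +
          p.2 (idx 0 0 1) * partialX (partialU b) (p.1 0) (p.1 1) +
          p.2 (idx 0 1 1) * partialX b (p.1 0) (p.1 1)) * p.2 (idx 0 0 1) -
        partialU b (p.1 0) (p.1 1) * p.2 (idx 0 1 1) -
        (p.1 2 * partialU (partialU b) (p.1 0) (p.1 1) +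
          p.2 (idx 0 0 0) * partialX (partialU b) (p.1 0) (p.1 1) +
          p.2 (idx 0 1 0) * partialX b (p.1 0) (p.1 1)) * p.2 (idx 0 0 2) := by
  have := h.prolongInf_idx_succ 0 0 1 1 p
  rw [totalDeriv_base_zero h, totalDeriv_base_one h, totalDeriv_base_two h,
    totalDeriv_prolongInf_f₁ h] at this
  simp at this
  rw [this]; ring

lemma prolongInf_u₁ (p : JetInf) : (prolongInf a b p).1 2 =
    p.1 2 * partialU b (p.1 0) (p.1 1) + p.2 (idx 0 0 0) * partialX b (p.1 0) (p.1 1) := rfl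

/-- The derivative of `sprayCoeff` along a prolonged feedback field. -/
lemma feedbackDeriv_sprayCoeff (h : SmoothPair a b) {p : JetInf} (hp : RegInf p) :
    feedbackDeriv a b sprayCoeff p =
      p.2 (idx 0 0 0) * totalDeriv 0 (fun q => baseComponent a b q 2) p +
        p.1 2 * totalDeriv 1 (fun q => baseComponent a b q 2) p +
        sprayCoeff p * totalDeriv 2 (fun q => baseComponent a b q 2) p := by
  obtain ⟨h0, h1, h2, h3⟩ := hp
  have c (i j l : ℕ) := lineCoord (idx i j l) p (prolongInf a b p)
  have u := lineBase 2 p (prolongInf a b p)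
  have e := lineAdd (lineMul (c 0 0 0) (c 1 0 0)) (lineMul u (c 0 1 0))
  have := (lineSub (lineDiv (lineAdd (lineAdd (lineSub (lineSub (lineMul (c 0 0 1) (c 1 0 0))
    (lineMul (c 0 0 0) (c 1 0 1))) (lineMul u (c 0 1 1))) (c 0 1 0))
    (lineDiv (lineMul e (c 0 0 2)) (c 0 0 1) h1)) (c 0 0 2) h2)
    (lineDiv e (c 0 0 1) h1)).lineDeriv
  refine Eq.trans this ?_
  simp only [totalDeriv_base_two h, prolongInf_f, prolongInf_f₁ h, prolongInf_f₁₁ h,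
    prolongInf_fx h, prolongInf_fu h, prolongInf_fx₁ h, prolongInf_fu₁ h, prolongInf_u₁]
  simp only [sprayCoeff, sprayTerm, Matrix.cons_val]
  generalize p.2 (idx 0 0 0) = f at *
  generalize p.2 (idx 0 0 1) = f1 at *
  generalize p.2 (idx 0 0 2) = f11 at *
  field_simp
  ring

/-- The transformation law needed to absorb the commutator `[X, D_i] = -∑ D_i(ξ_j) D_j`: once the
coefficients obey it, `∑ F_i D_i` commutes with `X`. -/
lemma feedbackDeriv_frame (h : SmoothPair a b) {p : JetInf} (hp : RegInf p) (n j : Fin 3) :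
    feedbackDeriv a b (frame n j) p =
      ∑ i, frame n i p * totalDeriv i (fun q => baseComponent a b q j) p := by
  have hs := feedbackDeriv_sprayCoeff h hp
  have h1 := hp.2.1
  have c (i j l : ℕ) := lineCoord (idx i j l) p (prolongInf a b p)
  have u := lineBase 2 p (prolongInf a b p)
  have d := lineSub (lineMul u (c 0 0 1)) (c 0 0 0)
  have sq := lineMul (c 0 0 1) (c 0 0 1)
  rw [Fin.sum_univ_three]
  fin_cases n <;> fin_cases j <;>
    simp only [Fin.zero_eta, Fin.mk_one, Fin.reduceFinMk, totalDeriv_base_zero h,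
      totalDeriv_base_one h]
  · exact (c 0 0 0).lineDeriv.trans (by rw [prolongInf_f]; simp [frame]; ring)
  · exact u.lineDeriv.trans (by rw [prolongInf_u₁]; simp [frame]; ring)
  · exact hs
  · exact (lineConst 0 p _).lineDeriv.trans (by simp [frame])
  · refine (lineDiv d (c 0 0 1) h1).lineDeriv.trans ?_
    simp [prolongInf_f, prolongInf_f₁ h, prolongInf_u₁, frame]
    field_simp
    ring
  · have := (lineNeg (lineDiv (lineMul d (c 0 1 0)) sq (mul_ne_zero h1 h1))).lineDeriv
    simp only [← pow_two] at this
    refine Eq.trans this ?_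
    simp [prolongInf_f, prolongInf_f₁ h, prolongInf_fu h, prolongInf_u₁, frame,
      totalDeriv_base_two h]
    field_simp
    ring
  · exact (lineConst 0 p _).lineDeriv.trans (by simp [frame])
  · exact (lineConst 0 p _).lineDeriv.trans (by simp [frame])
  · refine (lineDiv (c 0 0 0) (c 0 0 1) h1).lineDeriv.trans ?_
    simp [prolongInf_f, prolongInf_f₁ h, frame, totalDeriv_base_two h]
    field_simp
    ring

/-- The derivations `frameDeriv n` commute with prolonged feedback fields. -/
lemma feedbackDeriv_frameDeriv (h : SmoothPair a b) {k : ℕ} {g : JetInf → ℝ} {p : JetInf}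
    (hp : RegInf p) (hg : SmoothAt k g p) (n : Fin 3) :
    feedbackDeriv a b (frameDeriv n g) p = frameDeriv n (feedbackDeriv a b g) p := by
  have := (lineSum Finset.univ fun i _ => lineMul
    ((smoothAt_frame hp n i).hasLineDerivAt' (prolongInf a b p))
    ((hg.totalDeriv i).hasLineDerivAt' (prolongInf a b p))).lineDeriv
  refine Eq.trans this ?_
  have e1 (i : Fin 3) : lineDeriv ℝ (frame n i) p (prolongInf a b p) = _ :=
    feedbackDeriv_frame h hp n i
  have e2 (i : Fin 3) : lineDeriv ℝ (totalDeriv i g) p (prolongInf a b p) = _ :=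
    h.feedbackDeriv_totalDeriv hg i
  simp only [e1, e2, frameDeriv, Fin.sum_univ_three]
  ring

end Action

/-! ### Invariants -/

/-- Invariants of order `≤ k`, as functions of the infinite jet, on the regular set. -/
def IsInvariant (k : ℕ) (g : JetInf → ℝ) : Prop :=
  ∀ p, RegInf p → SmoothAt k g p ∧
    ∀ a b, SmoothPair a b → feedbackDeriv a b g p = 0

lemma frameDeriv_congr {g h : JetInf → ℝ} (H : ∀ q, RegInf q → g q = h q) {p : JetInf}
    (hp : RegInf p) (n : Fin 3) : frameDeriv n g p = frameDeriv n h p :=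
  Finset.sum_congr rfl fun i _ => by
    rw [totalDeriv_apply, totalDeriv_apply, lineDeriv_congr_regInf H hp]

lemma IsInvariant.mono {k l : ℕ} {g : JetInf → ℝ} (hg : IsInvariant k g) (h : k ≤ l) :
    IsInvariant l g := fun p hp => ⟨(hg p hp).1.mono h, (hg p hp).2⟩

lemma frameDeriv_zero (n : Fin 3) (p : JetInf) : frameDeriv n (fun _ => 0) p = 0 :=
  Finset.sum_eq_zero fun i _ => by
    rw [totalDeriv_apply, (lineConst 0 p _).lineDeriv, mul_zero]

/-- `X ∇I = ∇ X I`, and `X I` vanishes on the whole regular set, not merely at one point, so its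
derivative vanishes too. The bound `1 ≤ k` makes room for the frame coefficients, which have order
2. -/
lemma IsInvariant.frameDeriv {k : ℕ} {g : JetInf → ℝ} (hg : IsInvariant k g) (hk : 1 ≤ k)
    (n : Fin 3) : IsInvariant (k + 1) (frameDeriv n g) := fun p hp =>
  ⟨(hg p hp).1.frameDeriv hk hp n, fun a b h => by
    rw [feedbackDeriv_frameDeriv h hp (hg p hp).1,
      frameDeriv_congr (fun q hq => (hg q hq).2 a b h) hp, frameDeriv_zero]⟩

lemma IsInvariant.iterate_frameDeriv {k : ℕ} {g : JetInf → ℝ} (hg : IsInvariant k g)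
    (hk : 1 ≤ k) (n : Fin 3) (m : ℕ) :
    IsInvariant (k + m) ((FeedbackJets.frameDeriv n)^[m] g) := by
  induction m with
  | zero => exact hg
  | succ m ih =>
    rw [Function.iterate_succ_apply']
    exact ih.frameDeriv (by omega) n

/-- `J`, as a function of the infinite jet. -/
def basicJ (p : JetInf) : ℝ :=
  p.2 (idx 0 0 0) ^ 2 * p.2 (idx 0 0 2) /
    ((p.1 2 * p.2 (idx 0 0 1) - p.2 (idx 0 0 0)) * p.2 (idx 0 0 1) ^ 2)

/-- Each factor of `J` is multiplied by a weight: `f` by `a_x`, `f_1` by `a_x - b_u - f_1 b_x`,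
`f_11` by `a_x - 2 b_u - 3 f_1 b_x`, and `u₁ f_1 - f` by `a_x - f_1 b_x`. In `J` the weights add up
to zero. -/
lemma isInvariant_basicJ : IsInvariant 2 basicJ := by
  intro p hp
  obtain ⟨h0, h1, h2, h3⟩ := hp
  have c (i j l : ℕ) (h : i + j + l ≤ 2) := smoothAt_coord' 2 i j l h p
  have b := SmoothAt.base 2 2 p
  refine ⟨(((c 0 0 0 (by simp)).pow 2).mul (c 0 0 2 (by simp))).div
    (((b.mul (c 0 0 1 (by simp))).sub (c 0 0 0 (by simp))).mul ((c 0 0 1 (by simp)).pow 2))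
    (mul_ne_zero h3 (pow_ne_zero 2 h1)), fun a b h => ?_⟩
  have c (i j l : ℕ) := lineCoord (idx i j l) p (prolongInf a b p)
  have u := lineBase 2 p (prolongInf a b p)
  have d := lineSub (lineMul u (c 0 0 1)) (c 0 0 0)
  have := (lineDiv (lineMul (lineMul (c 0 0 0) (c 0 0 0)) (c 0 0 2))
    (lineMul d (lineMul (c 0 0 1) (c 0 0 1))) (mul_ne_zero h3 (mul_ne_zero h1 h1))).lineDeriv
  simp only [← pow_two] at this
  refine Eq.trans this ?_
  rw [div_eq_zero_iff]
  left
  simp only [prolongInf_f, prolongInf_f₁ h, prolongInf_f₁₁ h, prolongInf_u₁]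
  ring

/-- A function of second order on which feedback fields act by `a_xx f`. -/
def connectionTerm (p : JetInf) : ℝ :=
  frameDeriv 0 (fun q => q.2 (idx 0 0 0)) p / p.2 (idx 0 0 0)

lemma smoothAt_connectionTerm {p : JetInf} (hp : RegInf p) :
    SmoothAt 2 connectionTerm p :=
  ((smoothAt_coord' 1 0 0 0 (by simp) p).frameDeriv le_rfl hp 0).div
    (smoothAt_coord' 2 0 0 0 (by simp) p) hp.1

/-- The term is a logarithmic derivative of `f` along `∇₀`. Since `X f = a_x f` and `∇₀` commutes
with `X`, only `∇₀(a_x) = a_xx f` survives. -/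
lemma feedbackDeriv_connectionTerm {a : ℝ → ℝ} {b : ℝ → ℝ → ℝ} (h : SmoothPair a b)
    {p : JetInf} (hp : RegInf p) :
    feedbackDeriv a b connectionTerm p = deriv (deriv a) (p.1 0) * p.2 (idx 0 0 0) := by
  have hf := smoothAt_coord' 1 0 0 0 (by simp) p
  have e := (lineDiv ((hf.frameDeriv le_rfl hp 0).hasLineDerivAt' (prolongInf a b p))
    (lineCoord (idx 0 0 0) p _) hp.1).lineDeriv
  refine Eq.trans e ?_
  have e2 : lineDeriv ℝ (frameDeriv 0 fun q => q.2 (idx 0 0 0)) p (prolongInf a b p) = _ :=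
    feedbackDeriv_frameDeriv h hp hf 0
  have e3 (i : Fin 3) : totalDeriv i (fun q : JetInf => q.2 (idx 0 0 0)) p =
    p.2 (idx 0 0 0 + Pi.single i 1) := (lineCoord _ _ _).lineDeriv
  have e4 : feedbackDeriv a b (fun q => q.2 (idx 0 0 0)) =
      fun q => (prolongInf a b q).2 (idx 0 0 0) := funext fun q => feedbackDeriv_coord _ q
  rw [e2, frameDeriv, frameDeriv]
  simp only [e4, totalDeriv_prolongInf_f h, e3, Fin.sum_univ_three, idx_add_single]
  rw [prolongInf_f]
  have h0 := hp.1
  simp [frame]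
  field_simp
  ring

/-- The defect `a_xx f` is killed by `∇₁`: this derivation has no `D_x` part and is proportional to
`D_u - (f_u / f_1) D_{u₁}`, which annihilates `f`. -/
lemma isInvariant_frameDeriv_connectionTerm :
    IsInvariant 3 (frameDeriv 1 connectionTerm) := fun p hp =>
  ⟨(smoothAt_connectionTerm hp).frameDeriv (by simp) hp 1, fun a b h => by
    rw [feedbackDeriv_frameDeriv h hp (smoothAt_connectionTerm hp),
      frameDeriv_congr (fun q hq => feedbackDeriv_connectionTerm h hq) hp, frameDeriv]
    have e (i : Fin 3) : totalDeriv i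
        (fun q : JetInf => deriv (deriv a) (q.1 0) * q.2 (idx 0 0 0)) p = _ :=
      (lineMul (lineFun₁ (smooth_deriv (smooth_deriv h.left)) p _)
        (lineCoord (idx 0 0 0) p _)).lineDeriv
    have h1 := hp.2.1
    simp only [e, Fin.sum_univ_three, idx_add_single]
    simp [frame]
    field_simp
    ring⟩

/-- A system of invariants, indexed by multi-indices of their principal symbols. -/
def basicInvariant (τ : Fin 3 → ℕ) : JetInf → ℝ :=
  if 2 ≤ τ 2 then
    (frameDeriv 0)^[τ 0] ((frameDeriv 1)^[τ 1] ((frameDeriv 2)^[τ 2 - 2] basicJ))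
  else (frameDeriv 0)^[τ 0 - 1] ((frameDeriv 1)^[τ 1 - 1] (frameDeriv 1 connectionTerm))

/-- The multi-indices of the coordinates that cannot be normalized by feedback. -/
def IsFree (τ : Fin 3 → ℕ) : Prop := 2 ≤ τ 2 ∨ (τ 2 = 1 ∧ 1 ≤ τ 0 ∧ 1 ≤ τ 1)

lemma isInvariant_basicInvariant {τ : Fin 3 → ℕ} (hτ : IsFree τ) :
    IsInvariant (∑ i, τ i) (basicInvariant τ) := by
  rw [Fin.sum_univ_three]
  unfold basicInvariant
  split_ifs with h
  · exact (((isInvariant_basicJ.iterate_frameDeriv (by simp) 2 _).iterate_frameDeriv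
      (by omega) 1 _).iterate_frameDeriv (by omega) 0 _).mono (by omega)
  · rcases hτ with h' | h'
    · exact absurd h' h
    · exact ((isInvariant_frameDeriv_connectionTerm.iterate_frameDeriv (by simp) 1
        _).iterate_frameDeriv (by omega) 0 _).mono (by omega)

/-! ### Principal symbols -/

/-- The vector along the fibre of `J^k → J^(k-1)` with components `w^σ`. -/
def symbolVec (k : ℕ) (w : Fin 3 → ℝ) : JetInf :=
  (0, fun σ => if ∑ i, σ i = k then ∏ i, w i ^ σ i else 0)

/-- The principal symbol of order `k`, as a polynomial function. -/
def symbol (k : ℕ) (g : JetInf → ℝ) (p : JetInf) (w : Fin 3 → ℝ) : ℝ :=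
  lineDeriv ℝ g p (symbolVec k w)

lemma trunc_symbolVec {k l : ℕ} (h : l < k) (w : Fin 3 → ℝ) :
    (symbolVec k w).trunc l = 0 := by
  refine Prod.ext rfl (funext fun σ => ?_)
  exact if_neg (ne_of_lt (σ.2.trans_lt h))

/-- The symbol vector of order `k` is invisible on jets of lower order, so lower-order factors act
as constants in symbol computations. -/
lemma HasOrder.line_symbolVec {k l : ℕ} {g : JetInf → ℝ} (hg : HasOrder l g) (h : l < k)
    (p : JetInf) (w : Fin 3 → ℝ) : HasLineDerivAt ℝ g 0 p (symbolVec k w) := by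
  unfold HasLineDerivAt
  refine (hasDerivAt_const (0 : ℝ) (g p)).congr_of_eventuallyEq
    (Filter.Eventually.of_forall fun t => hg _ _ ?_)
  rw [trunc_add_smul, trunc_symbolVec h, smul_zero, add_zero]

/-- Moving along the symbol vector of order `k + 1` keeps the `k`-jet fixed and shifts the direction
of `D_i` by `w i` times the symbol vector of order `k`. Hence `D_i g` is affine along that line. -/
lemma SmoothAt.line_totalDeriv_symbolVec {k : ℕ} {g : JetInf → ℝ} {p : JetInf}
    (hg : SmoothAt k g p) (i : Fin 3) (w : Fin 3 → ℝ) :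
    HasLineDerivAt ℝ (FeedbackJets.totalDeriv i g) (w i * symbol k g p w) p
      (symbolVec (k + 1) w) := by
  have key (t : ℝ) : FeedbackJets.totalDeriv i g (p + t • symbolVec (k + 1) w) =
      FeedbackJets.totalDeriv i g p + t * (w i * symbol k g p w) := by
    have e1 : (p + t • symbolVec (k + 1) w).trunc k = p.trunc k := by
      rw [trunc_add_smul, trunc_symbolVec (Nat.lt_succ_self k), smul_zero, add_zero]
    have e2 : (dVec i (p + t • symbolVec (k + 1) w)).trunc k =
        (dVec i p + (t * w i) • symbolVec k w).trunc k := by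
      rw [trunc_eq_iff]
      refine ⟨by simp [dVec, symbolVec], fun σ _ => ?_⟩
      have e3 : ∏ j, w j ^ (σ + Pi.single i 1 : Fin 3 → ℕ) j = w i * ∏ j, w j ^ σ j := by
        fin_cases i <;> simp [Fin.prod_univ_three, pow_succ] <;> ring
      simp only [dVec, symbolVec, Prod.snd_add, Prod.smul_snd, Pi.add_apply, Pi.smul_apply,
        smul_eq_mul] at e3 ⊢
      rw [e3]
      have e4 : ∑ j, (σ j + (Pi.single i 1 : Fin 3 → ℕ) j) = ∑ j, σ j + 1 := add_single_sum σ i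
      rw [e4]
      by_cases hσ : ∑ j, σ j = k
      · simp [hσ]; ring
      · simp [hσ]
    rw [totalDeriv_apply, hg.1.lineDeriv_congr e1 e2, hg.lineDeriv_add, hg.lineDeriv_smul,
      totalDeriv_apply, symbol]
    ring
  unfold HasLineDerivAt
  simp only [key]
  simpa using ((hasDerivAt_id (0 : ℝ)).mul_const (w i * symbol k g p w)).const_add
    (FeedbackJets.totalDeriv i g p)

/-- The principal symbols of the invariant derivations. -/
def frameSymbol (p : JetInf) (w : Fin 3 → ℝ) (n : Fin 3) : ℝ := ∑ i, frame n i p * w i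

/-- The frame coefficients have order 2, which is below `k + 1`, so only the total derivatives
contribute. -/
lemma SmoothAt.symbol_frameDeriv {k : ℕ} {g : JetInf → ℝ} {p : JetInf} (hg : SmoothAt k g p)
    (hk : 2 ≤ k) (hp : RegInf p) (n : Fin 3) (w : Fin 3 → ℝ) :
    symbol (k + 1) (FeedbackJets.frameDeriv n g) p w = frameSymbol p w n * symbol k g p w := by
  have := (lineSum Finset.univ fun i _ => lineMul
    ((smoothAt_frame hp n i).1.line_symbolVec (by omega : 2 < k + 1) p w)
    (hg.line_totalDeriv_symbolVec i w)).lineDeriv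
  refine Eq.trans this ?_
  rw [frameSymbol, Finset.sum_mul]
  exact Finset.sum_congr rfl fun i _ => by ring

lemma IsInvariant.symbol_iterate_frameDeriv {k : ℕ} {g : JetInf → ℝ} {p : JetInf}
    (hg : IsInvariant k g) (hk : 2 ≤ k) (hp : RegInf p) (n : Fin 3) (w : Fin 3 → ℝ) (m : ℕ) :
    symbol (k + m) ((FeedbackJets.frameDeriv n)^[m] g) p w =
      frameSymbol p w n ^ m * symbol k g p w := by
  induction m with
  | zero => simp
  | succ m ih =>
    rw [Function.iterate_succ_apply', ← add_assoc,
      ((hg.iterate_frameDeriv (by omega) n m) p hp).1.symbol_frameDeriv (by omega) hp, ih]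
    ring

lemma symbolVec_idx (k i j l : ℕ) (w : Fin 3 → ℝ) :
    (symbolVec k w).2 (idx i j l) = if i + j + l = k then w 0 ^ i * w 1 ^ j * w 2 ^ l else 0 := by
  simp only [symbolVec, idx_sum, Fin.prod_univ_three]
  rfl

lemma symbolVec_base (k : ℕ) (i : Fin 3) (w : Fin 3 → ℝ) : (symbolVec k w).1 i = 0 := rfl

lemma symbol_basicJ {p : JetInf} (hp : RegInf p) (w : Fin 3 → ℝ) :
    symbol 2 basicJ p w = (1 / (p.1 2 * p.2 (idx 0 0 1) - p.2 (idx 0 0 0))) *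
      frameSymbol p w 2 ^ 2 := by
  obtain ⟨h0, h1, h2, h3⟩ := hp
  have c (i j l : ℕ) := lineCoord (idx i j l) p (symbolVec 2 w)
  have u := lineBase 2 p (symbolVec 2 w)
  have d := lineSub (lineMul u (c 0 0 1)) (c 0 0 0)
  have := (lineDiv (lineMul (lineMul (c 0 0 0) (c 0 0 0)) (c 0 0 2))
    (lineMul d (lineMul (c 0 0 1) (c 0 0 1))) (mul_ne_zero h3 (mul_ne_zero h1 h1))).lineDeriv
  simp only [← pow_two] at this
  refine Eq.trans this ?_
  simp [symbolVec_idx, symbolVec_base, frameSymbol, Fin.sum_univ_three, frame]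
  field_simp

/-- Second-order jets enter only through `sprayCoeff`, whose symbol factors as `-(w₂ / f_11)` times
the symbol of `∇₀`. The second factor `w₂` is in turn a multiple of the symbol of `∇₂`. -/
lemma symbol_connectionTerm {p : JetInf} (hp : RegInf p) (w : Fin 3 → ℝ) :
    symbol 2 connectionTerm p w =
      -(p.2 (idx 0 0 1) ^ 2 / (p.2 (idx 0 0 0) ^ 2 * p.2 (idx 0 0 2))) *
        (frameSymbol p w 0 * frameSymbol p w 2) := by
  obtain ⟨h0, h1, h2, h3⟩ := hp
  have c (i j l : ℕ) := lineCoord (idx i j l) p (symbolVec 2 w)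
  have u := lineBase 2 p (symbolVec 2 w)
  have e := lineAdd (lineMul (c 0 0 0) (c 1 0 0)) (lineMul u (c 0 1 0))
  have s := lineSub (lineDiv (lineAdd (lineAdd (lineSub (lineSub (lineMul (c 0 0 1) (c 1 0 0))
    (lineMul (c 0 0 0) (c 1 0 1))) (lineMul u (c 0 1 1))) (c 0 1 0))
    (lineDiv (lineMul e (c 0 0 2)) (c 0 0 1) h1)) (c 0 0 2) h2)
    (lineDiv e (c 0 0 1) h1)
  have hfun : connectionTerm = fun q : JetInf => (q.2 (idx 0 0 0) * q.2 (idx 1 0 0) +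
      q.1 2 * q.2 (idx 0 1 0) + sprayCoeff q * q.2 (idx 0 0 1)) / q.2 (idx 0 0 0) := by
    funext q
    have e3 (i : Fin 3) : totalDeriv i (fun q : JetInf => q.2 (idx 0 0 0)) q =
      q.2 (idx 0 0 0 + Pi.single i 1) := (lineCoord _ _ _).lineDeriv
    simp [connectionTerm, frameDeriv, Fin.sum_univ_three, e3, idx_add_single, frame]
  have := (lineDiv (lineAdd e (lineMul s (c 0 0 1))) (c 0 0 0) h0).lineDeriv
  rw [hfun]
  refine Eq.trans this ?_
  simp [symbolVec_idx, symbolVec_base, frameSymbol, Fin.sum_univ_three, frame, sprayCoeff,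
    sprayTerm]
  field_simp
  ring

/-- The principal symbol of a basic invariant is a nonzero multiple of a monomial. -/
lemma symbol_basicInvariant {p : JetInf} (hp : RegInf p) {τ : Fin 3 → ℕ} (hτ : IsFree τ) :
    ∃ κ : ℝ, κ ≠ 0 ∧ ∀ w, symbol (∑ i, τ i) (basicInvariant τ) p w =
      κ * ∏ n, frameSymbol p w n ^ τ n := by
  obtain ⟨h0, h1, h2, h3⟩ := id hp
  have i1 := isInvariant_basicJ
  by_cases h : 2 ≤ τ 2
  · refine ⟨1 / (p.1 2 * p.2 (idx 0 0 1) - p.2 (idx 0 0 0)), one_div_ne_zero h3, fun w => ?_⟩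
    have i2 := i1.iterate_frameDeriv (by simp) 2 (τ 2 - 2)
    have i3 := i2.iterate_frameDeriv (by omega) 1 (τ 1)
    have e : ∑ i, τ i = 2 + (τ 2 - 2) + τ 1 + τ 0 := by rw [Fin.sum_univ_three]; omega
    rw [e, basicInvariant, if_pos h, i3.symbol_iterate_frameDeriv (by omega) hp,
      i2.symbol_iterate_frameDeriv (by omega) hp, i1.symbol_iterate_frameDeriv le_rfl hp,
      symbol_basicJ hp, Fin.prod_univ_three]
    obtain ⟨m, hm⟩ := Nat.exists_eq_add_of_le h
    rw [hm, Nat.add_sub_cancel_left]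
    ring
  · obtain ⟨h4, h5, h6⟩ := hτ.resolve_left h
    refine ⟨-(p.2 (idx 0 0 1) ^ 2 / (p.2 (idx 0 0 0) ^ 2 * p.2 (idx 0 0 2))),
      by simp [h0, h1, h2], fun w => ?_⟩
    have i2 := isInvariant_frameDeriv_connectionTerm
    have i3 := i2.iterate_frameDeriv (by omega) 1 (τ 1 - 1)
    have e : ∑ i, τ i = 3 + (τ 1 - 1) + (τ 0 - 1) := by rw [Fin.sum_univ_three]; omega
    rw [e, basicInvariant, if_neg h, i3.symbol_iterate_frameDeriv (by omega) hp,
      i2.symbol_iterate_frameDeriv (by omega) hp,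
      (smoothAt_connectionTerm hp).symbol_frameDeriv le_rfl hp,
      symbol_connectionTerm hp, Fin.prod_univ_three, h4]
    obtain ⟨m, hm⟩ := Nat.exists_eq_add_of_le h5
    obtain ⟨l, hl⟩ := Nat.exists_eq_add_of_le h6
    rw [hm, hl, Nat.add_sub_cancel_left, Nat.add_sub_cancel_left]
    ring

lemma SmoothFun.mono {k l : ℕ} {g : JetInf → ℝ} (hg : SmoothFun k g) (h : k ≤ l) :
    SmoothFun l g := fun p => (hg p).mono h

/-! ### Additivity of iterated total derivatives -/

lemma SmoothFun.add {k : ℕ} {g h : JetInf → ℝ} (hg : SmoothFun k g) (hh : SmoothFun k h) :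
    SmoothFun k (fun q => g q + h q) := fun p => (hg p).add (hh p)

lemma SmoothFun.iterate_totalDeriv_add {k : ℕ} {g h : JetInf → ℝ} (hg : SmoothFun k g)
    (hh : SmoothFun k h) (i : Fin 3) (n : ℕ) :
    (FeedbackJets.totalDeriv i)^[n] (fun q => g q + h q) = fun q =>
      (FeedbackJets.totalDeriv i)^[n] g q + (FeedbackJets.totalDeriv i)^[n] h q := by
  induction n with
  | zero => rfl
  | succ n ih =>
    simp only [Function.iterate_succ_apply', ih]
    funext p
    exact (lineAdd ((hg.iterate_totalDeriv i n p).hasLineDerivAt' _)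
      ((hh.iterate_totalDeriv i n p).hasLineDerivAt' _)).lineDeriv

lemma SmoothFun.totalDerivIter_add {k : ℕ} {g h : JetInf → ℝ} (hg : SmoothFun k g)
    (hh : SmoothFun k h) (σ : Fin 3 → ℕ) :
    FeedbackJets.totalDerivIter σ (fun q => g q + h q) = fun q =>
      FeedbackJets.totalDerivIter σ g q + FeedbackJets.totalDerivIter σ h q := by
  unfold FeedbackJets.totalDerivIter
  rw [hg.iterate_totalDeriv_add hh, (hg.iterate_totalDeriv 2 _).iterate_totalDeriv_add
    (hh.iterate_totalDeriv 2 _), ((hg.iterate_totalDeriv 2 _).iterate_totalDeriv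
    1 _).iterate_totalDeriv_add ((hh.iterate_totalDeriv 2 _).iterate_totalDeriv 1 _)]

lemma iterate_totalDeriv_zero (i : Fin 3) (n : ℕ) :
    (totalDeriv i)^[n] (fun _ => 0) = fun _ => 0 := by
  induction n with
  | zero => rfl
  | succ n ih =>
    rw [Function.iterate_succ_apply', ih]
    funext p
    exact (lineConst 0 p _).lineDeriv

/-! ### Divided powers as test functions -/

/-- The divided powers `(x - x₀)^(r-1) / (r-1)!`, with value `0` for `r = 0`. -/
def divPow (x₀ : ℝ) : ℕ → ℝ → ℝ
  | 0 => fun _ => 0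
  | r + 1 => fun x => (x - x₀) ^ r / r.factorial

lemma contDiff_divPow (x₀ : ℝ) (r : ℕ) : ContDiff ℝ ∞ (divPow x₀ r) := by
  cases r with
  | zero => exact contDiff_const
  | succ r => unfold divPow; fun_prop

/-- The shifted index, with value zero at `0`, makes this rule uniform: the constant at `1` needs no
separate treatment. -/
lemma deriv_divPow_succ (x₀ : ℝ) (r : ℕ) : deriv (divPow x₀ (r + 1)) = divPow x₀ r := by
  funext x
  cases r with
  | zero => simp [divPow]
  | succ r =>
    have h : HasDerivAt (fun x => (x - x₀) ^ (r + 1) / ((r + 1).factorial : ℝ))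
        (((r + 1 : ℕ) : ℝ) * (x - x₀) ^ r * 1 / ((r + 1).factorial : ℝ)) x := by
      simpa using (((hasDerivAt_id x).sub_const x₀).pow (r + 1)).div_const
        ((r + 1).factorial : ℝ)
    refine h.deriv.trans ?_
    have h1 : ((r.factorial : ℕ) : ℝ) ≠ 0 := by positivity
    simp only [divPow, Nat.factorial_succ, Nat.cast_mul]
    field_simp

lemma divPow_self (x₀ : ℝ) (r : ℕ) : divPow x₀ r x₀ = if r = 1 then 1 else 0 := by
  rcases r with _ | _ | r <;> simp [divPow]

/-- A product of divided powers of `x - x₀` and `u - u₀`, times `g`. -/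
def divMul (x₀ u₀ : ℝ) (r s : ℕ) (g : JetInf → ℝ) (q : JetInf) : ℝ :=
  divPow x₀ r (q.1 0) * divPow u₀ s (q.1 1) * g q

section DivMul

variable {x₀ u₀ : ℝ} {k : ℕ} {g : JetInf → ℝ}

lemma SmoothFun.divMul (hg : SmoothFun k g) (r s : ℕ) : SmoothFun k (divMul x₀ u₀ r s g) :=
  fun p => ((SmoothAt.fun₁ (contDiff_divPow x₀ r) k p).mul
    (SmoothAt.comp_trunc (G := fun z : Jet k => divPow u₀ s (z.1 1))
      (ContDiff.contDiffAt ((contDiff_divPow u₀ s).comp (by fun_prop))))).mul (hg p)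

lemma line_divPow_one (s : ℕ) (p v : JetInf) :
    HasLineDerivAt ℝ (fun q : JetInf => divPow u₀ s (q.1 1))
      (deriv (divPow u₀ s) (p.1 1) * v.1 1) p v := by
  have := lineFun₂ (b := fun _ u => divPow u₀ s u)
    ((contDiff_divPow u₀ s).comp contDiff_snd) p v
  simpa [partialX, partialU] using this

lemma line_divMul (hg : SmoothFun k g) (r s : ℕ) (p v : JetInf) :
    HasLineDerivAt ℝ (divMul x₀ u₀ r s g)
      ((deriv (divPow x₀ r) (p.1 0) * v.1 0 * divPow u₀ s (p.1 1) +
        divPow x₀ r (p.1 0) * (deriv (divPow u₀ s) (p.1 1) * v.1 1)) * g p +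
        divPow x₀ r (p.1 0) * divPow u₀ s (p.1 1) * lineDeriv ℝ g p v) p v :=
  lineMul (lineMul (lineFun₁ (contDiff_divPow x₀ r) p v) (line_divPow_one s p v))
    ((hg p).hasLineDerivAt' v)

lemma totalDeriv_two_divMul (hg : SmoothFun k g) (r s : ℕ) :
    totalDeriv 2 (divMul x₀ u₀ r s g) = divMul x₀ u₀ r s (totalDeriv 2 g) := by
  funext p
  refine (line_divMul hg r s p _).lineDeriv.trans ?_
  simp [divMul, totalDeriv]

lemma totalDeriv_one_divMul (hg : SmoothFun k g) (r s : ℕ) :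
    totalDeriv 1 (divMul x₀ u₀ r (s + 1) g) = fun q =>
      divMul x₀ u₀ r s g q + divMul x₀ u₀ r (s + 1) (totalDeriv 1 g) q := by
  funext p
  refine (line_divMul hg r (s + 1) p _).lineDeriv.trans ?_
  simp [divMul, totalDeriv, deriv_divPow_succ]

lemma totalDeriv_zero_divMul (hg : SmoothFun k g) (r s : ℕ) :
    totalDeriv 0 (divMul x₀ u₀ (r + 1) s g) = fun q =>
      divMul x₀ u₀ r s g q + divMul x₀ u₀ (r + 1) s (totalDeriv 0 g) q := by
  funext p
  refine (line_divMul hg (r + 1) s p _).lineDeriv.trans ?_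
  simp [divMul, totalDeriv, deriv_divPow_succ]

lemma iterate_totalDeriv_two_divMul (hg : SmoothFun k g) (r s l : ℕ) :
    (totalDeriv 2)^[l] (divMul x₀ u₀ r s g) = divMul x₀ u₀ r s ((totalDeriv 2)^[l] g) := by
  induction l with
  | zero => rfl
  | succ l ih =>
    rw [Function.iterate_succ_apply', Function.iterate_succ_apply', ih,
      totalDeriv_two_divMul (hg.iterate_totalDeriv 2 l)]

lemma divMul_zero_left (s : ℕ) (g : JetInf → ℝ) : divMul x₀ u₀ 0 s g = fun _ => 0 := by
  funext q; simp [divMul, divPow]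

lemma divMul_zero_right (r : ℕ) (g : JetInf → ℝ) : divMul x₀ u₀ r 0 g = fun _ => 0 := by
  funext q; simp [divMul, divPow]

/-- The monomial has degree `(r - 1) + (s - 1) ≥ i + j`, so at its centre every derivative must hit
the monomial, and the degrees must match in each variable. The induction varies `g`, since the
product rule replaces it by its total derivatives. -/
lemma iterate_totalDeriv_divMul (n : ℕ) : ∀ (i j : ℕ), i + j = n → ∀ (r s k : ℕ)
    (g : JetInf → ℝ) (p : JetInf), SmoothFun k g → i + j + 2 ≤ r + s →
    (totalDeriv 0)^[i] ((totalDeriv 1)^[j] (divMul (p.1 0) (p.1 1) r s g)) p =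
      if i + 1 = r ∧ j + 1 = s then g p else 0 := by
  induction n with
  | zero =>
    intro i j hij r s k g p _ _
    obtain ⟨rfl, rfl⟩ : i = 0 ∧ j = 0 := by omega
    simp only [Function.iterate_zero, id, divMul, divPow_self, zero_add, eq_comm (a := 1)]
    by_cases h1 : r = 1 <;> by_cases h2 : s = 1 <;> simp [h1, h2]
  | succ n ih =>
    intro i j hij r s k g p hg hle
    rcases r with _ | r
    · simp only [divMul_zero_left, iterate_totalDeriv_zero]
      simp
    rcases s with _ | s
    · simp only [divMul_zero_right, iterate_totalDeriv_zero]
      simp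
    rcases j with _ | j
    · obtain ⟨i, rfl⟩ : ∃ i', i = i' + 1 := ⟨i - 1, by omega⟩
      have h1 := ih i 0 (by omega) r (s + 1) k g p hg (by omega)
      have h2 := ih i 0 (by omega) (r + 1) (s + 1) (k + 1) _ p (hg.totalDeriv 0) (by omega)
      simp only [Function.iterate_zero, id] at h1 h2 ⊢
      rw [Function.iterate_succ_apply, totalDeriv_zero_divMul hg,
        ((hg.mono (Nat.le_succ k)).divMul r (s + 1)).iterate_totalDeriv_add
        ((hg.totalDeriv 0).divMul (r + 1) (s + 1))]
      beta_reduce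
      -- The summand in which a derivative is spent on `g` has too few derivatives left to reduce
      -- the monomial to a constant.
      rw [h1, h2, if_neg (c := i + 1 = r + 1 ∧ 0 + 1 = s + 1) (by omega), add_zero]
      simp
    · have h1 := ih i j (by omega) (r + 1) s k g p hg (by omega)
      have h2 := ih i j (by omega) (r + 1) (s + 1) (k + 1) _ p (hg.totalDeriv 1) (by omega)
      have e1 := (hg.mono (Nat.le_succ k)).divMul (x₀ := p.1 0) (u₀ := p.1 1) (r + 1) s
      have e2 := (hg.totalDeriv 1).divMul (x₀ := p.1 0) (u₀ := p.1 1) (r + 1) (s + 1)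
      rw [Function.iterate_succ_apply, totalDeriv_one_divMul hg,
        e1.iterate_totalDeriv_add e2, (e1.iterate_totalDeriv 1 j).iterate_totalDeriv_add
        (e2.iterate_totalDeriv 1 j)]
      beta_reduce
      rw [h1, h2, if_neg (c := i + 1 = r + 1 ∧ j + 1 = s + 1) (by omega), add_zero]
      simp

lemma totalDerivIter_divMul {r s k : ℕ} {g : JetInf → ℝ} (hg : SmoothFun k g) (p : JetInf)
    {σ : Fin 3 → ℕ} (h : σ 0 + σ 1 + 2 ≤ r + s) :
    totalDerivIter σ (divMul (p.1 0) (p.1 1) r s g) p =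
      if σ 0 + 1 = r ∧ σ 1 + 1 = s then (totalDeriv 2)^[σ 2] g p else 0 := by
  rw [totalDerivIter, iterate_totalDeriv_two_divMul hg]
  exact iterate_totalDeriv_divMul _ _ _ rfl _ _ _ _ p (hg.iterate_totalDeriv 2 _) h

end DivMul

/-! ### Values of test fields -/

lemma smoothPair_right (x₀ u₀ : ℝ) (r s : ℕ) :
    SmoothPair (fun _ => 0) (fun x u => divPow x₀ r x * divPow u₀ s u) :=
  ⟨contDiff_const, ((contDiff_divPow x₀ r).comp contDiff_fst).mul
    ((contDiff_divPow u₀ s).comp contDiff_snd)⟩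

lemma smoothPair_left (x₀ : ℝ) (r : ℕ) : SmoothPair (divPow x₀ r) (fun _ _ => 0) :=
  ⟨contDiff_divPow x₀ r, contDiff_const⟩

/-- Here `b = (x - x₀)^r (u - u₀)^s / (r! s!)` vanishes at the point with its first derivatives,
since `r + s ≥ 2`. At levels below `r + s` the term `-b f_u` of the generating function drops out,
leaving the terms with `b_u` and `b_x`. -/
lemma prolongInf_right_snd (p : JetInf) {r s : ℕ} (hrs : 2 ≤ r + s) {σ : Fin 3 → ℕ}
    (hσ : σ 0 + σ 1 + 1 ≤ r + s) :
    (prolongInf (fun _ => 0)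
      (fun x u => divPow (p.1 0) (r + 1) x * divPow (p.1 1) (s + 1) u) p).2 σ =
      (if σ 0 = r ∧ σ 1 + 1 = s then
        (totalDeriv 2)^[σ 2] (fun q => -(q.1 2 * q.2 (idx 0 0 1))) p else 0) +
      (if σ 0 + 1 = r ∧ σ 1 = s then
        (totalDeriv 2)^[σ 2] (fun q => -(q.2 (idx 0 0 0) * q.2 (idx 0 0 1))) p else 0) ∧
    (prolongInf (fun _ => 0)
      (fun x u => divPow (p.1 0) (r + 1) x * divPow (p.1 1) (s + 1) u) p).1 = 0 := by
  set b : ℝ → ℝ → ℝ := fun x u => divPow (p.1 0) (r + 1) x * divPow (p.1 1) (s + 1) u with hb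
  have hX : ∀ x u, partialX b x u = divPow (p.1 0) r x * divPow (p.1 1) (s + 1) u := by
    intro x u
    simp only [partialX, hb]
    rw [deriv_mul_const_field, deriv_divPow_succ]
  have hU : ∀ x u, partialU b x u = divPow (p.1 0) (r + 1) x * divPow (p.1 1) s u := by
    intro x u
    simp only [partialU, hb]
    rw [deriv_const_mul_field, deriv_divPow_succ]
  have hξ : ∀ i, baseComponent (fun _ => 0) b p i = 0 := by
    intro i
    fin_cases i
    · rfl
    · simp only [Fin.mk_one, baseComponent_one, hb, divPow_self]
      by_cases h1 : r = 0 <;> by_cases h2 : s = 0 <;> simp [h1, h2]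
      omega
    · simp only [Fin.reduceFinMk, baseComponent_two, hX, hU, divPow_self]
      have : ¬(r = 0 ∧ s = 1) := by omega
      have : ¬(r = 1 ∧ s = 0) := by omega
      by_cases h1 : r = 0 <;> by_cases h2 : s = 0 <;> by_cases h3 : r = 1 <;>
        by_cases h4 : s = 1 <;> simp_all
  have g1 : SmoothFun 1 (fun q => -q.2 (idx 0 1 0)) := fun q =>
    (smoothAt_coord' 1 0 1 0 (by simp) q).neg
  have g2 : SmoothFun 1 (fun q => -(q.1 2 * q.2 (idx 0 0 1))) := fun q =>
    ((SmoothAt.base 1 2 q).mul (smoothAt_coord' 1 0 0 1 (by simp) q)).neg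
  have g3 : SmoothFun 1 (fun q => -(q.2 (idx 0 0 0) * q.2 (idx 0 0 1))) := fun q =>
    ((smoothAt_coord' 1 0 0 0 (by simp) q).mul (smoothAt_coord' 1 0 0 1 (by simp) q)).neg
  have hφ : generatingFunction (fun _ => 0) b = fun q =>
      (divMul (p.1 0) (p.1 1) (r + 1) (s + 1) (fun q => -q.2 (idx 0 1 0)) q +
      divMul (p.1 0) (p.1 1) (r + 1) s (fun q => -(q.1 2 * q.2 (idx 0 0 1))) q) +
      divMul (p.1 0) (p.1 1) r (s + 1) (fun q => -(q.2 (idx 0 0 0) * q.2 (idx 0 0 1))) q := by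
    funext q
    have e := idx_add_single 0 0 0
    simp only [idx_zero, zero_add] at e
    simp only [generatingFunction, Fin.sum_univ_three, baseComponent_zero, baseComponent_one,
      baseComponent_two, hX, hU, divMul, e]
    simp [hb]
    ring
  refine ⟨?_, funext hξ⟩
  simp only [prolongInf, hξ, zero_mul, Finset.sum_const_zero, add_zero, hφ]
  have d1 := g1.divMul (x₀ := p.1 0) (u₀ := p.1 1) (r + 1) (s + 1)
  have d2 := g2.divMul (x₀ := p.1 0) (u₀ := p.1 1) (r + 1) s
  have d3 := g3.divMul (x₀ := p.1 0) (u₀ := p.1 1) r (s + 1)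
  rw [(d1.add d2).totalDerivIter_add d3, d1.totalDerivIter_add d2]
  beta_reduce
  rw [totalDerivIter_divMul g1 p (by omega), totalDerivIter_divMul g2 p (by omega),
    totalDerivIter_divMul g3 p (by omega), if_neg (by omega)]
  simp

/-- Here `a = (x - x₀)^r / r!`. Below level `r` the term `-a f_x` contributes nothing, and `a_x f`
contributes only along `(r - 1, 0, l)`. -/
lemma prolongInf_left_snd (p : JetInf) {r : ℕ} (hr : 2 ≤ r) {σ : Fin 3 → ℕ}
    (hσ : σ 0 + σ 1 + 1 ≤ r) :
    (prolongInf (divPow (p.1 0) (r + 1)) (fun _ _ => 0) p).2 σ =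
      (if σ 0 + 1 = r ∧ σ 1 = 0 then
        (totalDeriv 2)^[σ 2] (fun q => q.2 (idx 0 0 0)) p else 0) ∧
    (prolongInf (divPow (p.1 0) (r + 1)) (fun _ _ => 0) p).1 = 0 := by
  have hξ : ∀ q i, baseComponent (divPow (p.1 0) (r + 1)) (fun _ _ => 0) q i =
      ![divPow (p.1 0) (r + 1) (q.1 0), 0, 0] i := by
    intro q i
    fin_cases i
    · rfl
    · rfl
    · simp [baseComponent_two, partialX, partialU]
  have hξp : ∀ i, baseComponent (divPow (p.1 0) (r + 1)) (fun _ _ => 0) p i = 0 := by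
    intro i
    rw [hξ, divPow_self, if_neg (by omega)]
    fin_cases i <;> rfl
  have g1 : SmoothFun 1 (fun q => q.2 (idx 0 0 0)) := smoothAt_coord' 1 0 0 0 (by simp)
  have g2 : SmoothFun 1 (fun q => -q.2 (idx 1 0 0)) := fun q =>
    (smoothAt_coord' 1 1 0 0 (by simp) q).neg
  have hφ : generatingFunction (divPow (p.1 0) (r + 1)) (fun _ _ => 0) = fun q =>
      divMul (p.1 0) (p.1 1) r 1 (fun q => q.2 (idx 0 0 0)) q +
      divMul (p.1 0) (p.1 1) (r + 1) 1 (fun q => -q.2 (idx 1 0 0)) q := by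
    funext q
    have e := idx_add_single 0 0 0
    simp only [idx_zero, zero_add] at e
    simp only [generatingFunction, hξ, Fin.sum_univ_three, divMul, e, deriv_divPow_succ]
    simp [divPow]
    ring
  refine ⟨?_, funext hξp⟩
  simp only [prolongInf, hξp, zero_mul, Finset.sum_const_zero, add_zero, hφ]
  rw [(g1.divMul r 1).totalDerivIter_add (g2.divMul (r + 1) 1)]
  beta_reduce
  rw [totalDerivIter_divMul g1 p (by omega), totalDerivIter_divMul g2 p (by omega),
    if_neg (c := σ 0 + 1 = r + 1 ∧ σ 1 + 1 = 1) (by omega)]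
  simp

/-! ### Covectors annihilating the feedback distribution -/

lemma jet_sum {k : ℕ} (v : Jet k) : v = ∑ i, v.1 i • ((Pi.single i 1, 0) : Jet k) +
    ∑ σ, v.2 σ • ((0, Pi.single σ 1) : Jet k) := by
  refine Prod.ext (funext fun i => ?_) (funext fun σ => ?_)
  · simp [Prod.fst_sum, Finset.sum_apply, Pi.single_apply]
  · simp [Prod.snd_sum, Finset.sum_apply, Pi.single_apply]

/-- The coefficients of a covector along the coordinates `f_σ`. -/
def covCoeff {k : ℕ} (η : Jet k →ₗ[ℝ] ℝ) (σ : Fin 3 → ℕ) : ℝ :=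
  if h : ∑ i, σ i ≤ k then η (0, Pi.single ⟨σ, h⟩ 1) else 0

lemma covector_apply {k : ℕ} (η : Jet k →ₗ[ℝ] ℝ) (v : Jet k) :
    η v = ∑ i, η (Pi.single i 1, 0) * v.1 i + ∑ σ : JetIndex k, covCoeff η σ.1 * v.2 σ := by
  conv_lhs => rw [jet_sum v]
  simp only [map_add, map_sum, map_smul, smul_eq_mul]
  congr 1
  · exact Finset.sum_congr rfl fun i _ => mul_comm _ _
  · refine Finset.sum_congr rfl fun σ _ => ?_
    rw [covCoeff, dif_pos σ.2, mul_comm]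

lemma covCoeff_of_lt {k : ℕ} (η : Jet k →ₗ[ℝ] ℝ) {σ : Fin 3 → ℕ} (h : k < ∑ i, σ i) :
    covCoeff η σ = 0 := dif_neg (not_le.2 h)

lemma eq_idx (σ : Fin 3 → ℕ) : σ = idx (σ 0) (σ 1) (σ 2) := by
  funext i; fin_cases i <;> rfl

/-- Indices with `l ≥ 2` are free, so two components remain in each slice with `i` and `j` fixed. -/
lemma sum_covCoeff_slice {k : ℕ} (η : Jet k →ₗ[ℝ] ℝ)
    (hη : ∀ σ, IsFree σ → covCoeff η σ = 0) (i j : ℕ) (G : ℕ → ℝ) :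
    ∑ σ : JetIndex k, covCoeff η σ.1 * (if σ.1 0 = i ∧ σ.1 1 = j then G (σ.1 2) else 0) =
      covCoeff η (idx i j 0) * G 0 + covCoeff η (idx i j 1) * G 1 := by
  have h1 : ∀ σ : JetIndex k,
      covCoeff η σ.1 * (if σ.1 0 = i ∧ σ.1 1 = j then G (σ.1 2) else 0) =
      (if σ.1 = idx i j 0 then covCoeff η (idx i j 0) * G 0 else 0) +
        (if σ.1 = idx i j 1 then covCoeff η (idx i j 1) * G 1 else 0) := by
    intro σ
    by_cases h : σ.1 0 = i ∧ σ.1 1 = j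
    · obtain ⟨rfl, rfl⟩ := h
      have e (m : ℕ) : σ.1 = idx (σ.1 0) (σ.1 1) m ↔ σ.1 2 = m := by
        constructor
        · intro h; exact congrFun h 2
        · intro h; rw [← h]; exact eq_idx _
      simp only [e, and_self, if_true]
      by_cases hl : 2 ≤ σ.1 2
      · rw [hη _ (Or.inl hl), if_neg (by omega), if_neg (by omega)]; simp
      · obtain h0 | h0 : σ.1 2 = 0 ∨ σ.1 2 = 1 := by omega
        · rw [← (e 0).2 h0]; simp [h0]
        · rw [← (e 1).2 h0]; simp [h0]
    · rw [if_neg h, if_neg, if_neg]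
      · simp
      · intro h'; exact h ⟨congrFun h' 0, congrFun h' 1⟩
      · intro h'; exact h ⟨congrFun h' 0, congrFun h' 1⟩
  have h2 : ∀ (τ : Fin 3 → ℕ) (c : ℝ), (∑ σ : JetIndex k,
      if σ.1 = τ then covCoeff η τ * c else 0) = covCoeff η τ * c := by
    intro τ c
    -- `covCoeff` is zero beyond length `k`, so the formula also holds when the slice leaves `J^k`.
    by_cases hτ : ∑ m, τ m ≤ k
    · rw [Finset.sum_eq_single ⟨τ, hτ⟩ (fun σ _ hσ => if_neg fun h => hσ (Subtype.ext h))
        (fun h => absurd (Finset.mem_univ _) h), if_pos rfl]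
    · rw [covCoeff_of_lt η (not_le.1 hτ)]; simp
  rw [Finset.sum_congr rfl fun σ _ => h1 σ, Finset.sum_add_distrib, h2, h2]

lemma totalDeriv_two_momentum (p : JetInf) :
    totalDeriv 2 (fun q => -(q.1 2 * q.2 (idx 0 0 1))) p =
      -(p.2 (idx 0 0 1) + p.1 2 * p.2 (idx 0 0 2)) := by
  refine (lineNeg (lineMul (lineBase 2 p _) (lineCoord (idx 0 0 1) p _))).lineDeriv.trans ?_
  simp [idx_add_single]

lemma totalDeriv_two_product (p : JetInf) :
    totalDeriv 2 (fun q => -(q.2 (idx 0 0 0) * q.2 (idx 0 0 1))) p =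
      -(p.2 (idx 0 0 1) ^ 2 + p.2 (idx 0 0 0) * p.2 (idx 0 0 2)) := by
  refine (lineNeg (lineMul (lineCoord (idx 0 0 0) p _)
    (lineCoord (idx 0 0 1) p _))).lineDeriv.trans ?_
  simp [idx_add_single]
  ring

lemma totalDeriv_two_f (p : JetInf) :
    totalDeriv 2 (fun q => q.2 (idx 0 0 0)) p = p.2 (idx 0 0 1) := by
  refine (lineCoord (idx 0 0 0) p _).lineDeriv.trans ?_
  simp [idx_add_single]

section Annihilator

variable {k : ℕ} {η : Jet k →ₗ[ℝ] ℝ} {p : JetInf}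

/-- The value of a monomial test field of degree `m + 1` is known explicitly only up to level `m`.
The vanishing of the components above level `m` removes the rest of the pairing. -/
lemma covCoeff_test_right (hX : ∀ a b, SmoothPair a b → η ((prolongInf a b p).trunc k) = 0)
    {m r s : ℕ} (hm : 1 ≤ m) (hrs : r + s = m + 1)
    (hlt : ∀ σ, m < σ 0 + σ 1 → covCoeff η σ = 0) :
    ∑ σ : JetIndex k, (covCoeff η σ.1 * (if σ.1 0 = r ∧ σ.1 1 + 1 = s then
        (totalDeriv 2)^[σ.1 2] (fun q => -(q.1 2 * q.2 (idx 0 0 1))) p else 0) +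
      covCoeff η σ.1 * (if σ.1 0 + 1 = r ∧ σ.1 1 = s then
        (totalDeriv 2)^[σ.1 2] (fun q => -(q.2 (idx 0 0 0) * q.2 (idx 0 0 1))) p else 0)) =
      0 := by
  refine Eq.trans ?_ (hX _ _ (smoothPair_right (p.1 0) (p.1 1) (r + 1) (s + 1)))
  rw [covector_apply]
  have h0 := (prolongInf_right_snd p (r := r) (s := s) (by omega) (σ := 0) (by simp; omega)).2
  have h1 : ∀ i, (JetInf.trunc k (prolongInf (fun _ => 0)
      (fun x u => divPow (p.1 0) (r + 1) x * divPow (p.1 1) (s + 1) u) p)).1 i = 0 :=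
    fun i => congrFun h0 i
  simp only [h1, mul_zero, Finset.sum_const_zero, zero_add]
  refine Finset.sum_congr rfl fun σ _ => ?_
  by_cases hσ : m < σ.1 0 + σ.1 1
  · rw [hlt _ hσ]; simp
  · rw [← mul_add, ← (prolongInf_right_snd p (by omega) (by omega)).1]
    rfl

lemma covCoeff_test_left (hX : ∀ a b, SmoothPair a b → η ((prolongInf a b p).trunc k) = 0)
    (hη : ∀ σ, IsFree σ → covCoeff η σ = 0) {m : ℕ} (hm : 1 ≤ m)
    (hlt : ∀ σ, m < σ 0 + σ 1 → covCoeff η σ = 0) :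
    covCoeff η (idx m 0 0) * p.2 (idx 0 0 0) + covCoeff η (idx m 0 1) * p.2 (idx 0 0 1) =
      0 := by
  have e := sum_covCoeff_slice η hη m 0
    (fun l => (totalDeriv 2)^[l] (fun q => q.2 (idx 0 0 0)) p)
  simp only [Function.iterate_zero, id, Function.iterate_one, totalDeriv_two_f] at e
  rw [← e]
  refine Eq.trans ?_ (hX _ _ (smoothPair_left (p.1 0) (m + 1 + 1)))
  rw [covector_apply]
  have h0 := (prolongInf_left_snd p (r := m + 1) (by omega) (σ := 0) (by simp)).2
  have h1 : ∀ i, (JetInf.trunc k (prolongInf (divPow (p.1 0) (m + 1 + 1))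
      (fun _ _ => 0) p)).1 i = 0 := fun i => congrFun h0 i
  simp only [h1, mul_zero, Finset.sum_const_zero, zero_add]
  refine Finset.sum_congr rfl fun σ _ => ?_
  by_cases hσ : m < σ.1 0 + σ.1 1
  · rw [hlt _ hσ]; simp
  · have := (prolongInf_left_snd p (r := m + 1) (by omega) (σ := σ.1) (by omega)).1
    simp only [add_left_inj] at this
    rw [← this]
    rfl

/-- The equations of level `m ≥ 1`. -/
lemma covCoeff_level (hX : ∀ a b, SmoothPair a b → η ((prolongInf a b p).trunc k) = 0)
    (hη : ∀ σ, IsFree σ → covCoeff η σ = 0) {m : ℕ} (hm : 1 ≤ m)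
    (hlt : ∀ σ, m < σ 0 + σ 1 → covCoeff η σ = 0) (h0 : p.2 (idx 0 0 0) ≠ 0)
    (h1 : p.2 (idx 0 0 1) ≠ 0) (h2 : 2 ≤ k → p.2 (idx 0 0 2) ≠ 0)
    (h3 : p.1 2 * p.2 (idx 0 0 1) - p.2 (idx 0 0 0) ≠ 0) :
    ∀ σ, σ 0 + σ 1 = m → covCoeff η σ = 0 := by
  -- `A` and `B` are, up to sign, the contributions of the `b_u`-term and the `b_x`-term of a test
  -- field along the slice `(i, j, ·)`.
  set A : ℕ → ℕ → ℝ := fun i j => covCoeff η (idx i j 0) * (p.1 2 * p.2 (idx 0 0 1)) +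
    covCoeff η (idx i j 1) * (p.2 (idx 0 0 1) + p.1 2 * p.2 (idx 0 0 2)) with hA
  set B : ℕ → ℕ → ℝ := fun i j => covCoeff η (idx i j 0) * (p.2 (idx 0 0 0) * p.2 (idx 0 0 1)) +
    covCoeff η (idx i j 1) * (p.2 (idx 0 0 1) ^ 2 + p.2 (idx 0 0 0) * p.2 (idx 0 0 2)) with hB
  have sA (i j : ℕ) := sum_covCoeff_slice η hη i j
    (fun l => (totalDeriv 2)^[l] (fun q => -(q.1 2 * q.2 (idx 0 0 1))) p)
  have sB (i j : ℕ) := sum_covCoeff_slice η hη i j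
    (fun l => (totalDeriv 2)^[l] (fun q => -(q.2 (idx 0 0 0) * q.2 (idx 0 0 1))) p)
  simp only [Function.iterate_zero, id, Function.iterate_one, totalDeriv_two_momentum,
    totalDeriv_two_product] at sA sB
  have tl := covCoeff_test_left hX hη hm hlt
  have t1 : B m 0 = 0 := by
    have := covCoeff_test_right hX (r := m + 1) (s := 0) hm (by omega) hlt
    simp only [Nat.add_eq_zero_iff, one_ne_zero, and_false, if_false, mul_zero, zero_add,
      add_left_inj] at this
    rw [sB] at this
    rw [hB]; linarith
  have t2 : ∀ i j, i + j + 1 = m → A (i + 1) j + B i (j + 1) = 0 := by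
    intro i j hij
    have := covCoeff_test_right hX (r := i + 1) (s := j + 1) hm (by omega) hlt
    simp only [add_left_inj] at this
    rw [Finset.sum_add_distrib, sA, sB] at this
    rw [hA, hB]; linarith
  have t3 : A 0 m = 0 := by
    have := covCoeff_test_right hX (r := 0) (s := m + 1) hm (by omega) hlt
    simp only [Nat.add_eq_zero_iff, one_ne_zero, and_false, false_and, if_false, mul_zero,
      add_zero, add_left_inj] at this
    rw [sA] at this
    rw [hA]; linarith
  -- At the corner `(m, 0)` the equations from `a` and from `b = x^(m+1)` form a `2 × 2` system, and
  -- eliminating one unknown leaves the pivot `f f_11`. If `m + 1 > k` this component does not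
  -- exist; otherwise `k ≥ 2`, which is why `f_11 ≠ 0` is required only then.
  have c1 : covCoeff η (idx m 0 1) = 0 := by
    by_cases hk : m + 1 ≤ k
    · have e : p.2 (idx 0 0 0) * p.2 (idx 0 0 2) * covCoeff η (idx m 0 1) = 0 := by
        rw [hB] at t1
        linear_combination t1 - p.2 (idx 0 0 1) * tl
      exact (mul_eq_zero.1 e).resolve_left (mul_ne_zero h0 (h2 (by omega)))
    · exact covCoeff_of_lt η (by rw [idx_sum]; omega)
  have c0 : covCoeff η (idx m 0 0) = 0 := by
    rw [c1, zero_mul, add_zero] at tl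
    exact (mul_eq_zero.1 tl).resolve_right h0
  -- Moving from `(m, 0)` towards `(0, m)`, each interior slice has a single unknown, because `(i,
  -- j, 1)` is free there, and its pivot is `f f_1`.
  have c2 : ∀ j i, i + j = m → (1 ≤ i → covCoeff η (idx i j 0) = 0 ∧ covCoeff η (idx i j 1) = 0) := by
    intro j
    induction j with
    | zero =>
      intro i hi _
      obtain rfl : i = m := by omega
      exact ⟨c0, c1⟩
    | succ j ih =>
      intro i hi h
      obtain ⟨e0, e1⟩ := ih (i + 1) (by omega) (by omega)
      have e2 : covCoeff η (idx i (j + 1) 1) = 0 :=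
        hη _ (Or.inr ⟨rfl, h, Nat.le_add_left _ _⟩)
      have := t2 i j (by omega)
      simp only [hA, hB, e0, e1, e2, zero_mul, add_zero, zero_add] at this
      exact ⟨(mul_eq_zero.1 this).resolve_right (mul_ne_zero h0 h1), e2⟩
  -- At the other corner two unknowns remain, with two equations whose determinant is `f_1² (u₁ f_1
  -- - f)` up to a nonzero factor.
  have c3 : covCoeff η (idx 0 m 0) = 0 ∧ covCoeff η (idx 0 m 1) = 0 := by
    obtain ⟨n, rfl⟩ : ∃ n, m = n + 1 := ⟨m - 1, by omega⟩
    obtain ⟨e0, e1⟩ := c2 n 1 (by omega) le_rfl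
    have t4 := t2 0 n (by omega)
    simp only [hA, hB] at t3 t4
    rw [e0, e1] at t4
    have e : p.2 (idx 0 0 1) ^ 2 * (p.1 2 * p.2 (idx 0 0 1) - p.2 (idx 0 0 0)) *
        covCoeff η (idx 0 (n + 1) 1) = 0 := by
      linear_combination p.1 2 * p.2 (idx 0 0 1) * t4 - p.2 (idx 0 0 0) * p.2 (idx 0 0 1) * t3
    have e' := (mul_eq_zero.1 e).resolve_left (mul_ne_zero (pow_ne_zero 2 h1) h3)
    rw [e'] at t4
    refine ⟨?_, e'⟩
    simp only [zero_mul, add_zero, zero_add] at t4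
    exact (mul_eq_zero.1 t4).resolve_right (mul_ne_zero h0 h1)
  have c4 : ∀ i j, i + j = m → covCoeff η (idx i j 0) = 0 ∧ covCoeff η (idx i j 1) = 0 := by
    intro i j hij
    rcases Nat.eq_zero_or_pos i with rfl | hi
    · obtain rfl : j = m := by omega
      exact c3
    · exact c2 j i hij hi
  intro σ hσ
  by_cases hl : 2 ≤ σ 2
  · exact hη _ (Or.inl hl)
  · rw [eq_idx σ]
    obtain h | h : σ 2 = 0 ∨ σ 2 = 1 := by omega
    · rw [h]; exact (c4 _ _ hσ).1
    · rw [h]; exact (c4 _ _ hσ).2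

/-- A covector that annihilates the feedback distribution and whose coefficients along the free
coordinates vanish is zero. -/
lemma covector_eq_zero
    (hX : ∀ a b, SmoothPair a b → η ((prolongInf a b p).trunc k) = 0)
    (hη : ∀ σ, IsFree σ → covCoeff η σ = 0) (h0 : p.2 (idx 0 0 0) ≠ 0)
    (h1 : p.2 (idx 0 0 1) ≠ 0) (h2 : 2 ≤ k → p.2 (idx 0 0 2) ≠ 0)
    (h3 : p.1 2 * p.2 (idx 0 0 1) - p.2 (idx 0 0 0) ≠ 0) : η = 0 := by
  -- Descending induction on the level `m`, with `n = k + 1 - m`: level `k + 1` is empty, and each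
  -- level needs all higher ones.
  have key : ∀ n m, k + 1 = n + m → 1 ≤ m → ∀ σ, m ≤ σ 0 + σ 1 → covCoeff η σ = 0 := by
    intro n
    induction n with
    | zero =>
      intro m hm _ σ hσ
      exact covCoeff_of_lt η (by rw [Fin.sum_univ_three]; omega)
    | succ n ih =>
      intro m hm h σ hσ
      have hlt : ∀ σ, m < σ 0 + σ 1 → covCoeff η σ = 0 := fun σ hσ =>
        ih (m + 1) (by omega) (by omega) σ hσ
      rcases hσ.lt_or_eq with h' | h'
      · exact hlt σ h'
      · exact covCoeff_level hX hη h hlt h0 h1 h2 h3 σ h'.symm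
  have hpos : ∀ σ, 1 ≤ σ 0 + σ 1 → covCoeff η σ = 0 := fun σ hσ => key k 1 rfl le_rfl σ hσ
  have hv : ∀ v : JetInf, η (v.trunc k) = η (Pi.single 0 1, 0) * v.1 0 +
      η (Pi.single 1 1, 0) * v.1 1 + η (Pi.single 2 1, 0) * v.1 2 +
      (covCoeff η (idx 0 0 0) * v.2 (idx 0 0 0) + covCoeff η (idx 0 0 1) * v.2 (idx 0 0 1)) := by
    intro v
    rw [covector_apply, Fin.sum_univ_three]
    congr 1
    rw [← sum_covCoeff_slice η hη 0 0 (fun l => v.2 (idx 0 0 l))]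
    refine Finset.sum_congr rfl fun σ _ => ?_
    by_cases hσ : 1 ≤ σ.1 0 + σ.1 1
    · rw [hpos _ hσ]; simp
    · have e0 : σ.1 0 = 0 := by omega
      have e1 : σ.1 1 = 0 := by omega
      rw [if_pos ⟨e0, e1⟩]
      congr 1
      change v.2 σ.1 = _
      conv_lhs => rw [eq_idx σ.1, e0, e1]
  have T : ∀ a b, SmoothPair a b → η (Pi.single 0 1, 0) * (prolongInf a b p).1 0 +
      η (Pi.single 1 1, 0) * (prolongInf a b p).1 1 +
      η (Pi.single 2 1, 0) * (prolongInf a b p).1 2 +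
      (covCoeff η (idx 0 0 0) * (deriv a (p.1 0) * p.2 (idx 0 0 0)) +
        covCoeff η (idx 0 0 1) * ((deriv a (p.1 0) - (partialU b (p.1 0) (p.1 1) +
          p.2 (idx 0 0 1) * partialX b (p.1 0) (p.1 1))) * p.2 (idx 0 0 1))) = 0 := by
    intro a b h
    rw [← prolongInf_f (b := b), ← prolongInf_f₁ h, ← hv]
    exact hX a b h
  -- Five unknowns remain, three base components and those along `f` and `f_1`. They are matched by
  -- `∂_x`, `∂_u`, `(x - x₀) ∂_x`, `(x - x₀) ∂_u` and `(u - u₀) ∂_u`.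
  have T0 := T (fun _ => 1) (fun _ _ => 0) ⟨contDiff_const, contDiff_const⟩
  have T1 := T (fun _ => 0) (fun _ _ => 1) ⟨contDiff_const, contDiff_const⟩
  have T2 := T (fun x => x - p.1 0) (fun _ _ => 0) ⟨by fun_prop, contDiff_const⟩
  have T3 := T (fun _ => 0) (fun x _ => x - p.1 0) ⟨contDiff_const, by unfold Smooth₂; fun_prop⟩
  have T4 := T (fun _ => 0) (fun _ u => u - p.1 1) ⟨contDiff_const, by unfold Smooth₂; fun_prop⟩
  simp [prolongInf, baseComponent, partialX, partialU] at T0 T1 T2 T3 T4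
  have e1 : covCoeff η (idx 0 0 1) = 0 := by
    have e : p.2 (idx 0 0 1) * (p.1 2 * p.2 (idx 0 0 1) - p.2 (idx 0 0 0)) *
      covCoeff η (idx 0 0 1) = 0 := by
      linear_combination p.2 (idx 0 0 0) * T4 - p.1 2 * T3
    exact (mul_eq_zero.1 e).resolve_left (mul_ne_zero h1 h3)
  simp only [e1, zero_mul, add_zero, h0, or_false, mul_eq_zero] at T2 T3
  have e2 : η (Pi.single 2 1, 0) = 0 := by simpa [h0] using T3
  have hz : ∀ σ, covCoeff η σ = 0 := by
    intro σ
    by_cases hσ : 1 ≤ σ 0 + σ 1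
    · exact hpos σ hσ
    · by_cases hl : 2 ≤ σ 2
      · exact hη _ (Or.inl hl)
      · rw [eq_idx σ, show σ 0 = 0 by omega, show σ 1 = 0 by omega]
        obtain h | h : σ 2 = 0 ∨ σ 2 = 1 := by omega
        · rw [h]; exact T2
        · rw [h]; exact e1
  refine LinearMap.ext fun v => ?_
  rw [covector_apply, Fin.sum_univ_three, T0, T1, e2]
  simp [hz]

end Annihilator

/-! ### Counting multi-indices -/

/-- Pairs `(i, j)` with `i + j < n`, with their sum. -/
def triangle (n : ℕ) : Finset (Σ _ : ℕ, ℕ × ℕ) :=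
  (Finset.range n).sigma fun m => Finset.HasAntidiagonal.antidiagonal m

lemma mem_triangle {n : ℕ} {x : Σ _ : ℕ, ℕ × ℕ} :
    x ∈ triangle n ↔ x.1 < n ∧ x.2.1 + x.2.2 = x.1 := by
  simp [triangle]

lemma card_triangle (n : ℕ) : ((triangle n).card : ℝ) = n * (n + 1) / 2 := by
  simp only [triangle, Finset.card_sigma, Finset.Nat.card_antidiagonal]
  induction n with
  | zero => simp
  | succ n ih => rw [Finset.sum_range_succ]; push_cast at ih ⊢; rw [ih]; ring

/-- The multi-index `(i, j, k - i - j)`. -/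
def toIndex (k : ℕ) (x : Σ _ : ℕ, ℕ × ℕ) : Fin 3 → ℕ := idx x.2.1 x.2.2 (k - x.1)

lemma toIndex_injOn (k n : ℕ) : Set.InjOn (toIndex k) (triangle n : Set (Σ _ : ℕ, ℕ × ℕ)) := by
  rintro ⟨a, i, j⟩ hx ⟨b, i', j'⟩ hy h
  have h0 : i = i' := congrFun h 0
  have h1 : j = j' := congrFun h 1
  have hx := (mem_triangle.1 hx).2
  have hy := (mem_triangle.1 hy).2
  simp only at hx hy
  subst h0 h1 hx hy
  rfl

/-- Multi-indices of length `k`. -/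
def indexEq (k : ℕ) : Finset (Fin 3 → ℕ) := (triangle (k + 1)).image (toIndex k)

lemma mem_indexEq {k : ℕ} {σ : Fin 3 → ℕ} : σ ∈ indexEq k ↔ ∑ i, σ i = k := by
  simp only [indexEq, Finset.mem_image, mem_triangle]
  constructor
  · rintro ⟨x, ⟨h1, h2⟩, rfl⟩
    rw [toIndex, idx_sum]; omega
  · intro h
    rw [Fin.sum_univ_three] at h
    refine ⟨⟨σ 0 + σ 1, σ 0, σ 1⟩, ⟨by dsimp only; omega, rfl⟩, ?_⟩
    conv_rhs => rw [eq_idx σ]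
    rw [toIndex]
    congr 1
    dsimp only; omega

lemma card_indexEq (k : ℕ) : ((indexEq k).card : ℝ) = (k + 1) * (k + 2) / 2 := by
  rw [indexEq, Finset.card_image_of_injOn (toIndex_injOn k _), card_triangle]
  push_cast; ring

/-- Free multi-indices of length `k`. -/
def freeEq (k : ℕ) : Finset (Fin 3 → ℕ) :=
  (triangle k \ {⟨k - 1, k - 1, 0⟩, ⟨k - 1, 0, k - 1⟩}).image (toIndex k)

lemma mem_freeEq {k : ℕ} {σ : Fin 3 → ℕ} : σ ∈ freeEq k ↔ ∑ i, σ i = k ∧ IsFree σ := by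
  simp only [freeEq, Finset.mem_image, Finset.mem_sdiff, mem_triangle, Finset.mem_insert,
    Finset.mem_singleton, IsFree]
  constructor
  · rintro ⟨⟨a, i, j⟩, ⟨⟨h1, h2⟩, h3⟩, rfl⟩
    dsimp only at h1 h2
    rw [toIndex, idx_sum]
    dsimp only
    refine ⟨by omega, ?_⟩
    change 2 ≤ k - a ∨ (k - a = 1 ∧ 1 ≤ i ∧ 1 ≤ j)
    by_cases h : 2 ≤ k - a
    · exact Or.inl h
    · obtain rfl : a = k - 1 := by omega
      refine Or.inr ⟨by omega, ?_, ?_⟩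
      · by_contra hi
        obtain rfl : i = 0 := by omega
        obtain rfl : j = k - 1 := by omega
        exact h3 (Or.inr rfl)
      · by_contra hj
        obtain rfl : j = 0 := by omega
        obtain rfl : i = k - 1 := by omega
        exact h3 (Or.inl rfl)
  · rintro ⟨h, h'⟩
    rw [Fin.sum_univ_three] at h
    refine ⟨⟨σ 0 + σ 1, σ 0, σ 1⟩, ⟨⟨by dsimp only; omega, rfl⟩, ?_⟩, ?_⟩
    · rintro (e | e)
      · have e2 : (σ 0, σ 1) = (k - 1, 0) := congrArg (fun x : Σ _ : ℕ, ℕ × ℕ => x.2) e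
        simp only [Prod.mk.injEq] at e2
        omega
      · have e2 : (σ 0, σ 1) = (0, k - 1) := congrArg (fun x : Σ _ : ℕ, ℕ × ℕ => x.2) e
        simp only [Prod.mk.injEq] at e2
        omega
    · conv_rhs => rw [eq_idx σ]
      rw [toIndex]
      congr 1
      dsimp only; omega

/-- Free indices of length `k` have `l ≥ 1`, that is `i + j < k`, and omit the two end points of the
row `l = 1`. These end points are distinct because `k ≥ 2`. -/
lemma card_freeEq {k : ℕ} (hk : 2 ≤ k) : ((freeEq k).card : ℝ) = k * (k + 1) / 2 - 2 := by
  have h1 : ({⟨k - 1, k - 1, 0⟩, ⟨k - 1, 0, k - 1⟩} : Finset (Σ _ : ℕ, ℕ × ℕ)) ⊆ triangle k := by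
    intro x hx
    simp only [Finset.mem_insert, Finset.mem_singleton] at hx
    rw [mem_triangle]
    rcases hx with rfl | rfl <;> dsimp only <;> omega
  have h2 : ({⟨k - 1, k - 1, 0⟩, ⟨k - 1, 0, k - 1⟩} : Finset (Σ _ : ℕ, ℕ × ℕ)).card = 2 := by
    rw [Finset.card_pair]
    intro e
    have e2 : (k - 1, 0) = (0, k - 1) := congrArg (fun x : Σ _ : ℕ, ℕ × ℕ => x.2) e
    simp only [Prod.mk.injEq] at e2
    omega
  rw [freeEq, Finset.card_image_of_injOn ((toIndex_injOn k k).mono (by simp)),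
    Finset.card_sdiff_of_subset h1, h2, Nat.cast_sub (h2 ▸ Finset.card_le_card h1), card_triangle]
  simp

lemma freeEq_eq_empty {k : ℕ} (hk : k < 2) : freeEq k = ∅ := by
  ext σ
  rw [mem_freeEq, Fin.sum_univ_three, IsFree]
  simp only [Finset.notMem_empty, iff_false]
  omega

lemma pairwiseDisjoint_of_sum {s : ℕ → Finset (Fin 3 → ℕ)}
    (h : ∀ m, ∀ σ ∈ s m, ∑ i, σ i = m) (t : Set ℕ) : t.PairwiseDisjoint s := by
  intro a _ b _ hab
  refine Finset.disjoint_left.2 fun σ h1 h2 => hab ?_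
  rw [← h a σ h1, h b σ h2]

/-- Indices of the basic invariants of order `≤ k`. -/
abbrev FreeIndex (k : ℕ) : Type := {τ : Fin 3 → ℕ // ∑ i, τ i ≤ k ∧ IsFree τ}

/-- Indices of the basic invariants of pure order `k`. -/
abbrev PureIndex (k : ℕ) : Type := {τ : Fin 3 → ℕ // ∑ i, τ i = k ∧ IsFree τ}

/-- Free multi-indices of length `≤ k`. -/
def freeLe (k : ℕ) : Finset (Fin 3 → ℕ) := (Finset.range (k + 1)).biUnion freeEq

lemma mem_freeLe {k : ℕ} {σ : Fin 3 → ℕ} : σ ∈ freeLe k ↔ ∑ i, σ i ≤ k ∧ IsFree σ := by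
  simp only [freeLe, Finset.mem_biUnion, Finset.mem_range, mem_freeEq]
  constructor
  · rintro ⟨m, h1, h2, h3⟩; exact ⟨by omega, h3⟩
  · rintro ⟨h1, h2⟩; exact ⟨_, by omega, rfl, h2⟩

instance instFintypeFreeIndex (k : ℕ) : Fintype (FreeIndex k) :=
  Fintype.subtype (freeLe k) fun _ => mem_freeLe

instance instFintypePureIndex (k : ℕ) : Fintype (PureIndex k) :=
  Fintype.subtype (freeEq k) fun _ => mem_freeEq

lemma card_pureIndex {k : ℕ} (hk : 2 ≤ k) :
    (Fintype.card (PureIndex k) : ℝ) = (k : ℝ) * (k + 1) / 2 - 2 := by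
  rw [Fintype.card_of_subtype (freeEq k) fun _ => mem_freeEq, card_freeEq hk]

lemma card_freeIndex {k : ℕ} (hk : 2 ≤ k) : (Fintype.card (FreeIndex k) : ℝ) =
    (k : ℝ) ^ 3 / 6 + (k : ℝ) ^ 2 / 2 - 5 * (k : ℝ) / 3 + 1 := by
  rw [Fintype.card_of_subtype (freeLe k) fun _ => mem_freeLe, freeLe,
    Finset.card_biUnion (pairwiseDisjoint_of_sum (fun m σ h => (mem_freeEq.1 h).1) _)]
  induction k, hk using Nat.le_induction with
  | base =>
    have := card_freeEq (le_refl 2)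
    simp only [Finset.sum_range_succ, Finset.sum_range_zero, freeEq_eq_empty (k := 0) (by simp),
      freeEq_eq_empty (k := 1) (by simp), Finset.card_empty]
    push_cast at this ⊢
    rw [this]; norm_num
  | succ k hk ih =>
    rw [Finset.sum_range_succ, Nat.cast_add, ih, card_freeEq (by omega)]
    push_cast
    ring

lemma card_jetIndex (k : ℕ) :
    (Fintype.card (JetIndex k) : ℝ) = (k + 1) * (k + 2) * (k + 3) / 6 := by
  have h : ∀ σ : Fin 3 → ℕ, σ ∈ (Finset.range (k + 1)).biUnion indexEq ↔ ∑ i, σ i ≤ k := by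
    intro σ
    simp only [Finset.mem_biUnion, Finset.mem_range, mem_indexEq]
    constructor
    · rintro ⟨m, h1, h2⟩; omega
    · intro h; exact ⟨_, by omega, rfl⟩
  rw [Fintype.card_of_subtype _ h,
    Finset.card_biUnion (pairwiseDisjoint_of_sum (fun m σ h => mem_indexEq.1 h) _)]
  clear h
  induction k with
  | zero => rw [Finset.sum_range_succ]; push_cast; rw [card_indexEq]; norm_num
  | succ k ih =>
    rw [Finset.sum_range_succ, Nat.cast_add, ih, card_indexEq]
    push_cast
    ring

lemma finrank_jet (k : ℕ) : Module.finrank ℝ (Jet k) = 3 + Fintype.card (JetIndex k) := by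
  simp [Module.finrank_prod]

lemma card_freeIndex_le (k : ℕ) : Fintype.card (FreeIndex k) ≤ Module.finrank ℝ (Jet k) := by
  rw [finrank_jet]
  refine le_trans ?_ (Nat.le_add_left _ _)
  exact Fintype.card_le_of_injective (fun τ : FreeIndex k => (⟨τ.1, τ.2.1⟩ : JetIndex k))
    fun _ _ h => Subtype.ext (congrArg (fun x : JetIndex k => x.1) h)

/-! ### Independence of monomials in the principal symbols -/

/-- The frame is triangular with diagonal `f`, `(u₁ f_1 - f) / f_1`, `f / f_1`, all nonzero at
regular jets; `w` is found by back substitution. -/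
lemma frameSymbol_surjective {p : JetInf} (hp : RegInf p) (y : Fin 3 → ℝ) :
    ∃ w : Fin 3 → ℝ, ∀ n, frameSymbol p w n = y n := by
  obtain ⟨h0, h1, h2, h3⟩ := hp
  set w2 := y 2 * p.2 (idx 0 0 1) / p.2 (idx 0 0 0) with hw2
  set w1 := (y 1 - frame 1 2 p * w2) / frame 1 1 p with hw1
  refine ⟨![(y 0 - frame 0 1 p * w1 - frame 0 2 p * w2) / p.2 (idx 0 0 0), w1, w2], fun n => ?_⟩
  have hf : frame 1 1 p ≠ 0 := div_ne_zero h3 h1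
  fin_cases n
  · simp [frameSymbol, Fin.sum_univ_three]
    have : frame 0 0 p = p.2 (idx 0 0 0) := rfl
    rw [this]
    field_simp
    ring
  · simp [frameSymbol, Fin.sum_univ_three]
    have : frame 1 0 p = 0 := rfl
    rw [this, hw1]
    field_simp
    ring
  · simp [frameSymbol, Fin.sum_univ_three]
    have e1 : frame 2 0 p = 0 := rfl
    have e2 : frame 2 1 p = 0 := rfl
    have e3 : frame 2 2 p = p.2 (idx 0 0 0) / p.2 (idx 0 0 1) := rfl
    rw [e1, e2, e3, hw2]
    field_simp
    ring

lemma coeff_eq_zero_of_monomials {ι : Type*} [Fintype ι] {e : ι → Fin 3 → ℕ}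
    (he : Function.Injective e) {c : ι → ℝ}
    (h : ∀ y : Fin 3 → ℝ, ∑ i, c i * ∏ n, y n ^ e i n = 0) (i : ι) : c i = 0 := by
  classical
  set P : MvPolynomial (Fin 3) ℝ :=
    ∑ i, MvPolynomial.monomial (Finsupp.equivFunOnFinite.symm (e i)) (c i) with hP
  have h1 : P = 0 := by
    refine MvPolynomial.funext fun y => ?_
    rw [hP, map_sum, map_zero, ← h y]
    refine Finset.sum_congr rfl fun i _ => ?_
    rw [MvPolynomial.eval_monomial, Finsupp.prod_fintype _ _ (by simp)]
    simp
  have h2 := congrArg (MvPolynomial.coeff (Finsupp.equivFunOnFinite.symm (e i))) h1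
  rw [hP, MvPolynomial.coeff_sum, Finset.sum_eq_single i, MvPolynomial.coeff_monomial,
    if_pos rfl] at h2
  · simpa using h2
  · intro j _ hj
    rw [MvPolynomial.coeff_monomial, if_neg]
    exact fun h => hj (he (Finsupp.equivFunOnFinite.symm.injective h))
  · simp

/-! ### The system of invariants on `J^k` -/

/-- The basic invariants as functions on `J^k`. -/
def jetInvariant (k : ℕ) (τ : Fin 3 → ℕ) (z : Jet k) : ℝ := basicInvariant τ z.ext

lemma isOpen_isRegular (k : ℕ) : IsOpen {z : Jet k | IsRegular z} :=
  isOpen_regInf.preimage (continuous_ext k)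

section System

variable {k : ℕ} {z : Jet k} {τ : Fin 3 → ℕ}

lemma smoothAt_basicInvariant (hz : IsRegular z) (hτ : IsFree τ) (h : ∑ i, τ i ≤ k) :
    SmoothAt k (basicInvariant τ) z.ext :=
  ((isInvariant_basicInvariant hτ) z.ext hz).1.mono h

lemma contDiffAt_jetInvariant (hz : IsRegular z) (hτ : IsFree τ) (h : ∑ i, τ i ≤ k) :
    ContDiffAt ℝ ∞ (jetInvariant k τ) z := by
  have := (smoothAt_basicInvariant hz hτ h).2
  rwa [Jet.trunc_ext] at this

lemma fderiv_jetInvariant (hz : IsRegular z) (hτ : IsFree τ) (h : ∑ i, τ i ≤ k) (v : JetInf) :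
    fderiv ℝ (jetInvariant k τ) z (v.trunc k) = lineDeriv ℝ (basicInvariant τ) z.ext v := by
  rw [(smoothAt_basicInvariant hz hτ h).lineDeriv_eq, Jet.trunc_ext]
  rfl

lemma fderiv_jetInvariant_feedbackField (hz : IsRegular z) (hτ : IsFree τ) (h : ∑ i, τ i ≤ k)
    {a : ℝ → ℝ} {b : ℝ → ℝ → ℝ} (hab : SmoothPair a b) :
    fderiv ℝ (jetInvariant k τ) z (feedbackField a b k z) = 0 :=
  (fderiv_jetInvariant hz hτ h _).trans (((isInvariant_basicInvariant hτ) z.ext hz).2 a b hab)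

lemma isDiffInvariant_jetInvariant (hτ : IsFree τ) (h : ∑ i, τ i ≤ k) :
    IsDiffInvariant k {z | IsRegular z} (jetInvariant k τ) :=
  ⟨isOpen_isRegular k, fun _ hz => (contDiffAt_jetInvariant hz hτ h).contDiffWithinAt,
    fun _ _ ha hb _ hz => fderiv_jetInvariant_feedbackField hz hτ h ⟨ha, hb⟩⟩

lemma fderiv_jetInvariant_symbolVec (hz : IsRegular z) (hτ : IsFree τ) (h : ∑ i, τ i ≤ k) :
    ∃ κ : ℝ, κ ≠ 0 ∧ ∀ w,
      fderiv ℝ (jetInvariant k τ) z ((symbolVec (∑ i, τ i) w).trunc k) =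
        κ * ∏ n, frameSymbol z.ext w n ^ τ n := by
  obtain ⟨κ, h1, h2⟩ := symbol_basicInvariant (p := z.ext) hz hτ
  exact ⟨κ, h1, fun w => (fderiv_jetInvariant hz hτ h _).trans (h2 w)⟩

lemma fderiv_jetInvariant_symbolVec_of_lt (hz : IsRegular z) (hτ : IsFree τ)
    (h : ∑ i, τ i ≤ k) {m : ℕ} (hm : ∑ i, τ i < m) (w : Fin 3 → ℝ) :
    fderiv ℝ (jetInvariant k τ) z ((symbolVec m w).trunc k) = 0 :=
  (fderiv_jetInvariant hz hτ h _).trans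
    (((isInvariant_basicInvariant hτ) z.ext hz).1.1.line_symbolVec hm _ _).lineDeriv

/-- The invariants of pure order `m` have independent symbols. -/
lemma pure_coeff_eq_zero (hz : IsRegular z) {m : ℕ} (hm : m ≤ k) {c : PureIndex m → ℝ}
    (h : ∀ w, ∑ τ, c τ * fderiv ℝ (jetInvariant k τ.1) z ((symbolVec m w).trunc k) = 0)
    (τ : PureIndex m) : c τ = 0 := by
  have hκ (τ : PureIndex m) := fderiv_jetInvariant_symbolVec hz τ.2.2 (τ.2.1.trans_le hm)
  choose κ h1 h2 using hκ
  have key := coeff_eq_zero_of_monomials (e := fun τ : PureIndex m => τ.1)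
    Subtype.val_injective (c := fun τ => c τ * κ τ) (fun y => ?_) τ
  · exact (mul_eq_zero.1 key).resolve_right (h1 τ)
  -- The symbols of the frame can be prescribed freely, which turns the hypothesis into a polynomial
  -- identity in independent variables.
  · obtain ⟨w, hw⟩ := frameSymbol_surjective (p := z.ext) hz y
    rw [← h w]
    refine Finset.sum_congr rfl fun τ _ => ?_
    have := h2 τ w
    rw [τ.2.1] at this
    rw [this]
    simp only [hw]
    ring

/-- In a linear relation, symbol vectors of order `m` do not see invariants of order below `m`. With
the higher coefficients already known to vanish, the relation at order `m` is one between pure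
symbols. -/
lemma linearIndependent_fderiv_jetInvariant (hz : IsRegular z) :
    LinearIndependent ℝ fun τ : FreeIndex k => fderiv ℝ (jetInvariant k τ.1) z := by
  rw [Fintype.linearIndependent_iff]
  intro c hc
  have key : ∀ n m, k + 1 = n + m → ∀ τ : FreeIndex k, m ≤ ∑ i, τ.1 i → c τ = 0 := by
    intro n
    induction n with
    | zero => intro m hm τ hτ; have := τ.2.1; omega
    | succ n ih =>
      intro m hm τ hτ
      rcases hτ.lt_or_eq with h | h
      · exact ih (m + 1) (by omega) τ h
      · refine pure_coeff_eq_zero (m := m) hz (by omega)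
          (c := fun τ : PureIndex m => c ⟨τ.1, τ.2.1.trans_le (by omega), τ.2.2⟩) (fun w => ?_)
          ⟨τ.1, h.symm, τ.2.2⟩
        have h1 := congrArg (fun L : Jet k →L[ℝ] ℝ => L ((symbolVec m w).trunc k)) hc
        simp only [sum_apply, smul_apply, smul_eq_mul,
          zero_apply] at h1
        rw [← h1]
        refine Finset.sum_of_injOn
          (fun τ : PureIndex m => (⟨τ.1, τ.2.1.trans_le (by omega), τ.2.2⟩ : FreeIndex k))
          (fun a _ b _ hab => Subtype.ext (congrArg (fun x : FreeIndex k => x.1) hab))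
          (fun _ _ => Finset.mem_coe.2 (Finset.mem_univ _)) (fun τ' _ hτ' => ?_)
          (fun _ _ => rfl)
        rcases lt_trichotomy (∑ i, τ'.1 i) m with h' | h' | h'
        · rw [fderiv_jetInvariant_symbolVec_of_lt hz τ'.2.2 τ'.2.1 h', mul_zero]
        · exact absurd ⟨⟨τ'.1, h', τ'.2.2⟩, Finset.mem_coe.2 (Finset.mem_univ _), rfl⟩ hτ'
        · rw [ih (m + 1) (by omega) τ' h', zero_mul]
  exact fun τ => key (k + 1) 0 rfl τ (Nat.zero_le _)

end System

/-! ### The feedback distribution at regular points -/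

section Distribution

variable {k : ℕ} {z : Jet k}

lemma feedbackField_mem (z : Jet k) {a : ℝ → ℝ} {b : ℝ → ℝ → ℝ} (h : SmoothPair a b) :
    feedbackField a b k z ∈ feedbackDistribution k z :=
  Submodule.subset_span ⟨a, b, h.left, h.right, rfl⟩

lemma mem_dualAnnihilator_iff {η : Module.Dual ℝ (Jet k)} :
    η ∈ (feedbackDistribution k z).dualAnnihilator ↔
      ∀ a b, SmoothPair a b → η (feedbackField a b k z) = 0 := by
  rw [Submodule.mem_dualAnnihilator]
  constructor
  · exact fun h a b hab => h _ (feedbackField_mem z hab)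
  · intro h v hv
    refine Submodule.span_induction (p := fun v _ => η v = 0) ?_ (map_zero η) ?_ ?_ hv
    · rintro v ⟨a, b, ha, hb, rfl⟩
      exact h a b ⟨ha, hb⟩
    · intro v w _ _ h1 h2; rw [map_add, h1, h2, add_zero]
    · intro c v _ h1; rw [map_smul, h1, smul_zero]

/-- The differentials of the basic invariants, as elements of the dual space. -/
def invariantCovector (k : ℕ) (z : Jet k) (τ : FreeIndex k) : Module.Dual ℝ (Jet k) :=
  (fderiv ℝ (jetInvariant k τ.1) z : Jet k →ₗ[ℝ] ℝ)

lemma linearIndependent_invariantCovector (hz : IsRegular z) :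
    LinearIndependent ℝ (invariantCovector k z) :=
  (linearIndependent_fderiv_jetInvariant hz).map'
    (ContinuousLinearMap.coeLM ℝ : (Jet k →L[ℝ] ℝ) →ₗ[ℝ] (Jet k →ₗ[ℝ] ℝ))
    (LinearMap.ker_eq_bot.2 ContinuousLinearMap.coe_injective)

/-- The independent differentials span a subspace of dimension equal to the number of free indices,
and the annihilator has at most that dimension. -/
lemma dualAnnihilator_eq_span (hz : IsRegular z) :
    (feedbackDistribution k z).dualAnnihilator =
      Submodule.span ℝ (Set.range (invariantCovector k z)) ∧
    Module.finrank ℝ (feedbackDistribution k z).dualAnnihilator =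
      Fintype.card (FreeIndex k) := by
  have hle : Submodule.span ℝ (Set.range (invariantCovector k z)) ≤
      (feedbackDistribution k z).dualAnnihilator := by
    rw [Submodule.span_le]
    rintro _ ⟨τ, rfl⟩
    exact mem_dualAnnihilator_iff.2 fun a b hab =>
      fderiv_jetInvariant_feedbackField hz τ.2.2 τ.2.1 hab
  have h1 : Module.finrank ℝ (Submodule.span ℝ (Set.range (invariantCovector k z))) =
      Fintype.card (FreeIndex k) := finrank_span_eq_card (linearIndependent_invariantCovector hz)
  -- Restriction of a covector to the free coordinates; its injectivity is exactly
  -- `covector_eq_zero`.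
  let T : (feedbackDistribution k z).dualAnnihilator →ₗ[ℝ] (FreeIndex k → ℝ) :=
    { toFun := fun η τ => η.1 (0, Pi.single ⟨τ.1, τ.2.1⟩ 1)
      map_add' := fun _ _ => rfl
      map_smul' := fun _ _ => rfl }
  have hT : Function.Injective T := by
    rw [injective_iff_map_eq_zero]
    intro η hη
    refine Subtype.ext (covector_eq_zero (p := z.ext) (fun a b hab => ?_) (fun σ hσ => ?_)
      hz.1 hz.2.1 (fun _ => hz.2.2.1) hz.2.2.2)
    · exact mem_dualAnnihilator_iff.1 η.2 a b hab
    · unfold covCoeff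
      split_ifs with h
      · exact congrFun hη ⟨σ, h, hσ⟩
      · rfl
  have h2 : Module.finrank ℝ (feedbackDistribution k z).dualAnnihilator ≤
      Fintype.card (FreeIndex k) := by
    have := LinearMap.finrank_le_finrank_of_injective hT
    simpa using this
  have h3 := Submodule.finrank_mono hle
  refine ⟨(Submodule.eq_of_le_of_finrank_eq hle (by omega)).symm, by omega⟩

lemma finrank_feedbackDistribution (hz : IsRegular z) :
    Module.finrank ℝ (feedbackDistribution k z) =
      Module.finrank ℝ (Jet k) - Fintype.card (FreeIndex k) := by
  have := Subspace.finrank_add_finrank_dualAnnihilator_eq (feedbackDistribution k z)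
  rw [(dualAnnihilator_eq_span hz).2] at this
  omega

lemma mem_feedbackDistribution_iff (hz : IsRegular z) (v : Jet k) :
    v ∈ feedbackDistribution k z ↔
      ∀ τ : FreeIndex k, fderiv ℝ (jetInvariant k τ.1) z v = 0 := by
  rw [← Subspace.forall_mem_dualAnnihilator_apply_eq_zero_iff,
    (dualAnnihilator_eq_span hz).1]
  constructor
  · exact fun h τ => h _ (Submodule.subset_span ⟨τ, rfl⟩)
  · intro h η hη
    refine Submodule.span_induction (p := fun η _ => η v = 0) ?_ rfl ?_ ?_ hη
    · rintro _ ⟨τ, rfl⟩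
      exact h τ
    · intro η θ _ _ h1 h2; rw [LinearMap.add_apply, h1, h2, add_zero]
    · intro c η _ h1; rw [LinearMap.smul_apply, h1, smul_zero]

/-- The differential of an invariant vanishes on the common kernel of the differentials of the
basic invariants. -/
lemma IsDiffInvariant.fderiv_eq_zero {W : Set (Jet k)} {I : Jet k → ℝ}
    (hI : IsDiffInvariant k W I) (hzW : z ∈ W) (hz : IsRegular z) {v : Jet k}
    (hv : ∀ τ : FreeIndex k, fderiv ℝ (jetInvariant k τ.1) z v = 0) : fderiv ℝ I z v = 0 := by
  have h1 : (fderiv ℝ I z : Jet k →ₗ[ℝ] ℝ) ∈ (feedbackDistribution k z).dualAnnihilator :=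
    mem_dualAnnihilator_iff.2 fun a b hab => hI.2.2 a b hab.left hab.right z hzW
  exact (Submodule.mem_dualAnnihilator _).1 h1 v ((mem_feedbackDistribution_iff hz v).2 hv)

end Distribution

/-! ### Invariants of order at most one -/

/-- Invariants of order at most one are locally constant. -/
lemma IsDiffInvariant.eventually_eq {k : ℕ} (hk : k ≤ 1) {U : Set (Jet k)} {I : Jet k → ℝ}
    (hI : IsDiffInvariant k U I) {z : Jet k} (hz : z ∈ U) : ∀ᶠ q in 𝓝 z, I q = I z := by
  have h0 : ∀ q ∈ U, fderiv ℝ I q = 0 := by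
    intro q hq
    -- The line adds `t` to `f` and `c t` to `f_1`. The choice of `c` makes `f`, `f_1` and `u₁ f_1 -
    -- f` all nonconstant affine in `t`, hence nonzero for small `t ≠ 0`.
    obtain ⟨c, hc0, hc1⟩ : ∃ c : ℝ, c ≠ 0 ∧ q.1 2 * c - 1 ≠ 0 := by
      by_cases h : q.1 2 = 1
      · exact ⟨2, by norm_num, by rw [h]; norm_num⟩
      · exact ⟨1, one_ne_zero, by rwa [mul_one, sub_ne_zero]⟩
    set w : JetInf := (0, fun σ => if σ = idx 0 0 0 then 1 else if σ = idx 0 0 1 then c else 0)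
      with hw
    have hw1 : w.2 (idx 0 0 0) = 1 := by simp [hw]
    have hw2 : w.2 (idx 0 0 1) = c := by
      have h : idx 0 0 1 ≠ idx 0 0 0 := fun h => by simpa [idx] using congrFun h 2
      simp [hw, h]
    have hne : ∀ α β : ℝ, β ≠ 0 → ∀ᶠ t in 𝓝[≠] (0 : ℝ), α + t * β ≠ 0 := by
      intro α β hβ
      by_cases hα : α = 0
      · filter_upwards [self_mem_nhdsWithin] with t ht
        rw [hα, zero_add]
        exact mul_ne_zero ht hβ
      · have hc : Continuous fun t : ℝ => α + t * β := by fun_prop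
        exact ((hc.tendsto' 0 α (by simp)).eventually_ne hα).filter_mono nhdsWithin_le_nhds
    have hpath : Continuous fun t : ℝ => q + t • w.trunc k := by fun_prop
    have ht : Filter.Tendsto (fun t : ℝ => q + t • w.trunc k) (𝓝[≠] 0) (𝓝 q) :=
      (hpath.tendsto' 0 q (by simp)).mono_left nhdsWithin_le_nhds
    have hcont : ContinuousAt (fderiv ℝ I) q :=
      ((hI.2.1.contDiffAt (hI.1.mem_nhds hq)).fderiv_right (m := ∞) (by simp)).continuousAt
    have hlim := hcont.tendsto.comp ht
    -- `dI` vanishes at the generic points of the line, so by continuity it vanishes at `q`. When `k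
    -- = 0` the value of `f_1` belongs only to the lift above the jet, but it may still be chosen in
    -- this way.
    refine tendsto_nhds_unique (hlim.congr' ?_) tendsto_const_nhds |>.symm ▸ rfl
    filter_upwards [ht.eventually (hI.1.mem_nhds hq), hne (q.ext.2 (idx 0 0 0)) 1 one_ne_zero,
      hne (q.ext.2 (idx 0 0 1)) c hc0,
      hne (q.1 2 * q.ext.2 (idx 0 0 1) - q.ext.2 (idx 0 0 0)) (q.1 2 * c - 1) hc1]
      with t h1 h2 h3 h4
    have e1 : q + t • w.trunc k = (q.ext + t • w).trunc k := by
      rw [trunc_add_smul, Jet.trunc_ext]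
    have key : (fderiv ℝ I (q + t • w.trunc k) : Jet k →ₗ[ℝ] ℝ) = 0 := by
      refine covector_eq_zero (p := q.ext + t • w) (fun a b hab => ?_) (fun σ hσ => ?_) ?_ ?_
        (fun h => absurd h (by omega)) ?_
      · have := hI.2.2 a b hab.left hab.right _ h1
        rw [e1, hab.feedbackField_trunc] at this
        rw [e1]
        exact this
      -- Free indices have length at least 2, so none occurs when `k ≤ 1`.
      · refine covCoeff_of_lt _ ?_
        rw [Fin.sum_univ_three]
        unfold IsFree at hσ
        omega
      · simpa [hw1] using h2
      · simpa [hw2] using h3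
      · have e2 : (q.ext + t • w).1 2 = q.1 2 := by
          change q.1 2 + t * 0 = q.1 2
          ring
        have e3 : (q.ext + t • w).2 (idx 0 0 1) = q.ext.2 (idx 0 0 1) + t * c := by
          simp [hw2]
        have e4 : (q.ext + t • w).2 (idx 0 0 0) = q.ext.2 (idx 0 0 0) + t * 1 := by
          simp [hw1]
        rw [e2, e3, e4]
        intro h
        apply h4
        linear_combination h
    exact ContinuousLinearMap.coe_injective key
  obtain ⟨ε, hε, hball⟩ := Metric.isOpen_iff.1 hI.1 z hz
  filter_upwards [Metric.ball_mem_nhds z hε] with q hq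
  refine Convex.is_const_of_fderivWithin_eq_zero (𝕜 := ℝ) (convex_ball z ε)
    ((hI.2.1.mono hball).differentiableOn (by simp)) (fun x hx => ?_) hq (Metric.mem_ball_self hε)
  rw [fderivWithin_of_isOpen Metric.isOpen_ball hx]
  exact h0 x (hball hx)

/-! ### Submersions, level sets and functional dependence -/

section Submersion

variable {E G : Type*} [NormedAddCommGroup E] [NormedSpace ℝ E] [FiniteDimensional ℝ E]
  [NormedAddCommGroup G] [NormedSpace ℝ G] [FiniteDimensional ℝ G]

/-- Local normal form of a submersion: a smooth family of local sections. -/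
lemma exists_local_sections {Φ : E → G} {U : Set E} (hU : IsOpen U)
    (hΦ : ContDiffOn ℝ ∞ Φ U) {q : E} (hq : q ∈ U)
    (hs : Function.Surjective (fderiv ℝ Φ q)) :
    ∃ (K : Submodule ℝ E) (ψ : G × K → E) (π : E →L[ℝ] K) (ε : ℝ), 0 < ε ∧
      ContDiffOn ℝ ∞ ψ (Metric.ball (Φ q) ε ×ˢ Metric.ball (π q) ε) ∧
      (∀ x ∈ Metric.ball (Φ q) ε ×ˢ Metric.ball (π q) ε, ψ x ∈ U ∧ Φ (ψ x) = x.1) ∧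
      ∀ᶠ r in 𝓝 q, (Φ r, π r) ∈ Metric.ball (Φ q) ε ×ˢ Metric.ball (π q) ε ∧
        ψ (Φ r, π r) = r := by
  have : CompleteSpace E := FiniteDimensional.complete ℝ E
  have : CompleteSpace G := FiniteDimensional.complete ℝ G
  set L := fderiv ℝ Φ q with hL
  set K : Submodule ℝ E := LinearMap.ker (L : E →ₗ[ℝ] G) with hK
  obtain ⟨P, hP⟩ := LinearMap.exists_leftInverse_of_injective K.subtype K.ker_subtype
  have hPK (x : K) : P x = x := LinearMap.congr_fun hP x
  set π : E →L[ℝ] K := LinearMap.toContinuousLinearMap P with hπ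
  have hπK (x : K) : π x = x := hPK x
  have hbij : Function.Bijective (L.prod π) := by
    constructor
    · rw [injective_iff_map_eq_zero]
      intro v hv
      have h1 : L v = 0 := congrArg Prod.fst hv
      have h2 : π v = 0 := congrArg Prod.snd hv
      have h3 := hπK ⟨v, h1⟩
      rw [h2] at h3
      exact (congrArg Subtype.val h3).symm
    · rintro ⟨g, x⟩
      obtain ⟨v, rfl⟩ := hs g
      refine ⟨v + ((x - π v : K) : E), Prod.ext ?_ ?_⟩
      · have h1 : L ((x - π v : K) : E) = 0 := (x - π v : K).2
        change L (v + ((x - π v : K) : E)) = L v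
        rw [map_add, h1, add_zero]
      · change π (v + ((x - π v : K) : E)) = x
        rw [map_add, hπK, add_sub_cancel]
  set T : E ≃L[ℝ] G × K :=
    (LinearEquiv.ofBijective (L.prod π : E →ₗ[ℝ] G × K) hbij).toContinuousLinearEquiv with hT
  have hTL : (T : E →L[ℝ] G × K) = L.prod π := by ext v <;> rfl
  set Ψ : E → G × K := fun r => (Φ r, π r) with hΨ
  have hΨU : ContDiffOn ℝ ∞ Ψ U := hΦ.prodMk π.contDiff.contDiffOn
  have hΨq : ContDiffAt ℝ ∞ Ψ q := hΨU.contDiffAt (hU.mem_nhds hq)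
  have hd : HasFDerivAt Ψ (T : E →L[ℝ] G × K) q := by
    rw [hTL]
    exact (((hΦ.contDiffAt (hU.mem_nhds hq)).differentiableAt (by simp)).hasFDerivAt).prodMk
      π.hasFDerivAt
  set e := hΨq.toOpenPartialHomeomorph Ψ hd (by simp) with he
  have he' : (e : E → G × K) = Ψ := hΨq.toOpenPartialHomeomorph_coe hd (by simp)
  have hqs : q ∈ e.source := hΨq.mem_toOpenPartialHomeomorph_source hd (by simp)
  -- Smoothness of the inverse on a whole box needs an invertible derivative at every nearby point,
  -- not only at `q`; invertibility is an open condition.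
  have hN : ∀ᶠ r in 𝓝 q, r ∈ U ∧ ∃ M : E ≃L[ℝ] G × K, (M : E →L[ℝ] G × K) = fderiv ℝ Ψ r := by
    refine Filter.Eventually.and (hU.mem_nhds hq) ?_
    have hc : ContinuousAt (fderiv ℝ Ψ) q :=
      (hΨq.fderiv_right (m := ∞) (by simp)).continuousAt
    refine hc.eventually (p := fun L => ∃ M : E ≃L[ℝ] G × K, (M : E →L[ℝ] G × K) = L) ?_
    rw [hd.fderiv]
    exact T.nhds
  obtain ⟨N, hN1, hN2, hqN⟩ := eventually_nhds_iff.1 hN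
  have hopen := e.symm.isOpen_inter_preimage hN2
  have hmem : Ψ q ∈ e.symm.source ∩ e.symm ⁻¹' N := by
    refine ⟨?_, ?_⟩
    · rw [← he']; exact e.map_source hqs
    · have : e.symm (Ψ q) = q := by rw [← he']; exact e.left_inv hqs
      simpa [this] using hqN
  obtain ⟨ε, hε, hball⟩ := Metric.isOpen_iff.1 hopen _ hmem
  have hbox : Metric.ball (Φ q) ε ×ˢ Metric.ball (π q) ε ⊆ e.symm.source ∩ e.symm ⁻¹' N := by
    rw [ball_prod_same]; exact hball
  refine ⟨K, e.symm, π, ε, hε, fun x hx => ?_, fun x hx => ?_, ?_⟩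
  · obtain ⟨h1, h2⟩ := hbox hx
    obtain ⟨hU', M, hM⟩ := hN1 _ h2
    have h3 : ContDiffAt ℝ ∞ Ψ (e.symm x) := hΨU.contDiffAt (hU.mem_nhds hU')
    refine (e.contDiffAt_symm (f₀' := M) h1 ?_ ?_).contDiffWithinAt
    · rw [he', hM]
      exact (h3.differentiableAt (by simp)).hasFDerivAt
    · rw [he']; exact h3
  · obtain ⟨h1, h2⟩ := hbox hx
    refine ⟨(hN1 _ h2).1, ?_⟩
    have h3 : Ψ (e.symm x) = x := by rw [← he']; exact e.right_inv h1
    exact congrArg Prod.fst h3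
  · have hc : ContinuousAt Ψ q := hΨq.continuousAt
    have hb : Metric.ball (Φ q) ε ×ˢ Metric.ball (π q) ε ∈ 𝓝 (Ψ q) := by
      rw [ball_prod_same]; exact Metric.ball_mem_nhds _ hε
    filter_upwards [hc.eventually hb, e.open_source.mem_nhds hqs] with r h1 h2
    refine ⟨h1, ?_⟩
    have := e.left_inv h2
    rwa [he'] at this

/-- A function that is smooth near a point agrees near that point with a globally smooth one. -/
lemma exists_contDiff_eventuallyEq {h₀ : G → ℝ} {V : Set G} (hV : IsOpen V)
    (h : ContDiffOn ℝ ∞ h₀ V) {y : G} (hy : y ∈ V) :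
    ∃ h : G → ℝ, ContDiff ℝ ∞ h ∧ ∀ᶠ x in 𝓝 y, h x = h₀ x := by
  obtain ⟨ε, hε, hball⟩ := Metric.isOpen_iff.1 hV y hy
  let χ : ContDiffBump y := ⟨ε / 4, ε / 2, by positivity, by linarith⟩
  refine ⟨fun x => χ x * h₀ x, ?_, ?_⟩
  · rw [contDiff_iff_contDiffAt]
    intro x
    by_cases hx : x ∈ Metric.ball y ε
    · exact χ.contDiffAt.mul (h.contDiffAt (hV.mem_nhds (hball hx)))
    · have hx' : x ∈ (Metric.closedBall y (ε / 2))ᶜ := by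
        simp only [Metric.mem_ball, not_lt, Set.mem_compl_iff, Metric.mem_closedBall,
          not_le] at hx ⊢
        linarith
      refine (contDiffAt_const (c := (0 : ℝ))).congr_of_eventuallyEq ?_
      filter_upwards [Metric.isClosed_closedBall.isOpen_compl.mem_nhds hx'] with x' h'
      have : χ x' = 0 := by
        apply χ.zero_of_le_dist
        simp only [Set.mem_compl_iff, Metric.mem_closedBall, not_le] at h'
        exact h'.le
      rw [this, zero_mul]
  · filter_upwards [χ.eventuallyEq_one] with x hx
    rw [hx]; simp

/-- A function whose differential vanishes on the kernels of the differential of a submersion is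
locally a smooth function of the submersion. -/
lemma exists_eq_comp_of_fderiv_eq_zero {Φ : E → G} {U : Set E} (hU : IsOpen U)
    (hΦ : ContDiffOn ℝ ∞ Φ U) {I : E → ℝ} (hI : ContDiffOn ℝ ∞ I U) {q : E} (hq : q ∈ U)
    (hs : Function.Surjective (fderiv ℝ Φ q))
    (h : ∀ r ∈ U, ∀ v, fderiv ℝ Φ r v = 0 → fderiv ℝ I r v = 0) :
    ∃ h : G → ℝ, ContDiff ℝ ∞ h ∧ ∀ᶠ r in 𝓝 q, I r = h (Φ r) := by
  obtain ⟨K, ψ, π, ε, hε, hψ, hψU, hnear⟩ := exists_local_sections hU hΦ hq hs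
  set S := Metric.ball (Φ q) ε ×ˢ Metric.ball (π q) ε with hS
  have hSo : IsOpen S := Metric.isOpen_ball.prod Metric.isOpen_ball
  -- In the straightened coordinates, motion in the `K`-direction keeps `Φ` fixed, so `dI` vanishes
  -- along it; convexity of the ball makes `I` constant on each fibre.
  have hconst : ∀ y ∈ Metric.ball (Φ q) ε, ∀ z ∈ Metric.ball (π q) ε,
      I (ψ (y, z)) = I (ψ (y, π q)) := by
    intro y hy z hz
    have hder : ∀ z ∈ Metric.ball (π q) ε,
        HasFDerivAt (fun z => I (ψ (y, z))) (0 : K →L[ℝ] ℝ) z := by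
      intro z hz
      have hx : (y, z) ∈ S := ⟨hy, hz⟩
      obtain ⟨hxU, -⟩ := hψU _ hx
      have d1 : HasFDerivAt ψ (fderiv ℝ ψ (y, z)) (y, z) :=
        ((hψ.contDiffAt (hSo.mem_nhds hx)).differentiableAt (by simp)).hasFDerivAt
      have d2 : HasFDerivAt I (fderiv ℝ I (ψ (y, z))) (ψ (y, z)) :=
        ((hI.contDiffAt (hU.mem_nhds hxU)).differentiableAt (by simp)).hasFDerivAt
      have d3 : HasFDerivAt Φ (fderiv ℝ Φ (ψ (y, z))) (ψ (y, z)) :=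
        ((hΦ.contDiffAt (hU.mem_nhds hxU)).differentiableAt (by simp)).hasFDerivAt
      have d4 : HasFDerivAt (fun z : K => (y, z)) (ContinuousLinearMap.inr ℝ G K) z :=
        hasFDerivAt_prodMk_right y z
      have d5 : HasFDerivAt (fun x => Φ (ψ x)) (ContinuousLinearMap.fst ℝ G K) (y, z) := by
        refine (ContinuousLinearMap.fst ℝ G K).hasFDerivAt.congr_of_eventuallyEq ?_
        filter_upwards [hSo.mem_nhds hx] with x hx
        exact (hψU x hx).2
      have d6 := (d3.comp (y, z) d1).unique d5
      have d7 := (d2.comp (y, z) d1).comp z d4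
      refine d7.congr_fderiv ?_
      ext v
      refine h _ hxU _ ?_
      have := congrArg (fun L : G × K →L[ℝ] G => L (0, v)) d6
      exact this
    refine Convex.is_const_of_fderivWithin_eq_zero (𝕜 := ℝ) (f := fun z : K => I (ψ (y, z)))
      (convex_ball (π q) ε) (fun z hz => (hder z hz).differentiableAt.differentiableWithinAt) (fun z hz => ?_) hz
      (Metric.mem_ball_self hε)
    rw [fderivWithin_of_isOpen Metric.isOpen_ball hz, (hder z hz).fderiv]
  have h0 : ContDiffOn ℝ ∞ (fun y => I (ψ (y, π q))) (Metric.ball (Φ q) ε) := by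
    refine hI.comp (hψ.comp (contDiff_prodMk_left (π q)).contDiffOn fun y hy =>
      ⟨hy, Metric.mem_ball_self hε⟩) fun y hy => (hψU _ ⟨hy, Metric.mem_ball_self hε⟩).1
  obtain ⟨g, hg, hg'⟩ := exists_contDiff_eventuallyEq Metric.isOpen_ball h0
    (Metric.mem_ball_self hε)
  refine ⟨g, hg, ?_⟩
  have hc : ContinuousAt Φ q := (hΦ.contDiffAt (hU.mem_nhds hq)).continuousAt
  filter_upwards [hnear, hc.eventually hg'] with r ⟨h1, h2⟩ h3
  rw [h3, ← hconst _ h1.1 _ h1.2, h2]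

/-- Nearby points of a level set of a submersion are joined by smooth paths in it. -/
lemma exists_path_in_level {Φ : E → G} {U : Set E} (hU : IsOpen U)
    (hΦ : ContDiffOn ℝ ∞ Φ U) {q : E} (hq : q ∈ U) (hs : Function.Surjective (fderiv ℝ Φ q)) :
    ∀ᶠ r in 𝓝 q, Φ r = Φ q → ∃ γ : ℝ → E, ContDiff ℝ ∞ γ ∧ γ 0 = q ∧ γ 1 = r ∧
      ∀ t, γ t ∈ U ∧ Φ (γ t) = Φ q := by
  obtain ⟨K, ψ, π, ε, hε, hψ, hψU, hnear⟩ := exists_local_sections hU hΦ hq hs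
  have hSo : IsOpen (Metric.ball (Φ q) ε ×ˢ Metric.ball (π q) ε) :=
    Metric.isOpen_ball.prod Metric.isOpen_ball
  have hq' := hnear.self_of_nhds
  filter_upwards [hnear] with r hr hΦr
  -- The path is a segment in the fibre, reparametrized by a smooth step with values in `[0, 1]`, so
  -- it stays in the box for all real `t`.
  have hx : ∀ t, (Φ q, π q + Real.smoothTransition t • (π r - π q)) ∈
      Metric.ball (Φ q) ε ×ˢ Metric.ball (π q) ε := fun t =>
    ⟨Metric.mem_ball_self hε, (convex_ball (π q) ε).add_smul_sub_mem (Metric.mem_ball_self hε)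
      hr.1.2 ⟨Real.smoothTransition.nonneg t, Real.smoothTransition.le_one t⟩⟩
  refine ⟨fun t => ψ (Φ q, π q + Real.smoothTransition t • (π r - π q)), ?_, ?_, ?_,
    fun t => hψU _ (hx t)⟩
  · rw [contDiff_iff_contDiffAt]
    intro t
    refine (hψ.contDiffAt (hSo.mem_nhds (hx t))).comp t ?_
    exact contDiffAt_const.prodMk (contDiffAt_const.add
      (Real.smoothTransition.contDiffAt.smul contDiffAt_const))
  · simpa using hq'.2
  · have := hr.2
    rw [hΦr] at this
    simpa using this

end Submersion

/-- Velocities in the span of pointwise independent smooth fields have smooth coefficients. -/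
lemma exists_smooth_coefficients {E : Type*} [NormedAddCommGroup E] [NormedSpace ℝ E]
    [FiniteDimensional ℝ E] {d : ℕ} {X : Fin d → E → E} (hX : ∀ i, ContDiff ℝ ∞ (X i)) {q : E}
    (hq : LinearIndependent ℝ fun i => X i q) :
    ∀ᶠ r in 𝓝 q, (LinearIndependent ℝ fun i => X i r) ∧
      ∃ C : E → E →L[ℝ] (Fin d → ℝ), ContDiffAt ℝ ∞ C r ∧
        ∀ᶠ r' in 𝓝 r, ∀ c : Fin d → ℝ, C r' (∑ i, c i • X i r') = c := by
  set A : E → (Fin d → ℝ) →L[ℝ] E := fun r =>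
    ∑ i, (ContinuousLinearMap.proj i : (Fin d → ℝ) →L[ℝ] ℝ).smulRight (X i r) with hA
  have hAa (r : E) (c : Fin d → ℝ) : A r c = ∑ i, c i • X i r := by simp [hA]
  have hAs : ContDiff ℝ ∞ A := ContDiff.sum fun i _ => contDiff_const.smulRight (hX i)
  have hker : LinearMap.ker (A q : (Fin d → ℝ) →ₗ[ℝ] E) = ⊥ := by
    rw [LinearMap.ker_eq_bot']
    intro c hc
    have h1 : ∑ i, c i • X i q = 0 := by rw [← hAa]; exact hc
    exact funext (Fintype.linearIndependent_iff.1 hq c h1)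
  -- A left inverse `B` of the frame map `A q` makes `B ∘ A r` invertible for `r` near `q`. The
  -- coefficients are then read off by `(B ∘ A r)⁻¹ ∘ B`.
  obtain ⟨B₀, hB₀⟩ := LinearMap.exists_leftInverse_of_injective _ hker
  set B : E →L[ℝ] (Fin d → ℝ) := LinearMap.toContinuousLinearMap B₀ with hB
  set M : E → (Fin d → ℝ) →L[ℝ] (Fin d → ℝ) := fun r => B.comp (A r) with hM
  have hMs : ContDiff ℝ ∞ M := contDiff_const.clm_comp hAs
  have hMq : M q = (ContinuousLinearEquiv.refl ℝ (Fin d → ℝ) :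
      (Fin d → ℝ) →L[ℝ] (Fin d → ℝ)) := by
    ext1 c
    exact LinearMap.congr_fun hB₀ c
  have hinv : ∀ᶠ r in 𝓝 q, ∃ e : (Fin d → ℝ) ≃L[ℝ] (Fin d → ℝ),
      (e : (Fin d → ℝ) →L[ℝ] (Fin d → ℝ)) = M r := by
    refine hMs.continuous.continuousAt.eventually (p := fun L =>
      ∃ e : (Fin d → ℝ) ≃L[ℝ] (Fin d → ℝ), (e : (Fin d → ℝ) →L[ℝ] (Fin d → ℝ)) = L) ?_
    rw [hMq]
    exact ContinuousLinearEquiv.nhds _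
  filter_upwards [eventually_eventually_nhds.2 hinv] with r hr
  obtain ⟨e, he⟩ := hr.self_of_nhds
  refine ⟨?_, fun r' => (M r').inverse.comp B, ?_, ?_⟩
  · rw [Fintype.linearIndependent_iff]
    intro c hc i
    have h1 : M r c = 0 := by
      change B (A r c) = 0
      rw [hAa, hc, map_zero]
    rw [← he] at h1
    have h2 : c = 0 := e.injective (by rw [map_zero]; exact h1)
    rw [h2]; rfl
  · refine ContDiffAt.clm_comp ?_ contDiffAt_const
    refine ContDiffAt.comp (g := ContinuousLinearMap.inverse) (f := M) r ?_ hMs.contDiffAt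
    rw [← he]
    exact contDiffAt_map_inverse e
  · filter_upwards [hr] with r' ⟨e', he'⟩ c
    rw [← hAa]
    change (M r').inverse (M r' c) = c
    rw [← he', ContinuousLinearMap.inverse_equiv]
    exact e'.symm_apply_apply c

/-- Linearly independent functionals have independent values. -/
lemma surjective_pi_of_linearIndependent {E ι : Type*} [AddCommGroup E] [Module ℝ E] [Fintype ι]
    {L : ι → E →ₗ[ℝ] ℝ} (hL : LinearIndependent ℝ L) :
    Function.Surjective (LinearMap.pi L) := by
  classical
  rw [← LinearMap.range_eq_top]
  by_contra hne
  obtain ⟨f, hf, hle⟩ := Submodule.exists_le_ker_of_lt_top _ (lt_top_iff_ne_top.2 hne)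
  apply hf
  have h1 : ∀ y : ι → ℝ, f y = ∑ i, f (Pi.single i 1) * y i := by
    intro y
    conv_lhs => rw [pi_eq_sum_univ' y]
    simp [mul_comm, Pi.single]
  have h2 : ∑ i, f (Pi.single i 1) • L i = 0 := by
    refine LinearMap.ext fun v => ?_
    have : f (LinearMap.pi L v) = 0 := hle ⟨v, rfl⟩
    rw [h1] at this
    simpa using this
  have h3 := Fintype.linearIndependent_iff.1 hL _ h2
  refine LinearMap.ext fun y => ?_
  rw [h1]
  simp [h3]

/-! ### Linearity of the prolongation in the feedback field -/

section Linearity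

variable {a a' : ℝ → ℝ} {b b' : ℝ → ℝ → ℝ}

lemma Smooth₂.differentiableAt_left (hb : Smooth₂ b) (x u : ℝ) :
    DifferentiableAt ℝ (fun x => b x u) x := by
  have h : ContDiff ℝ ∞ fun x : ℝ => b x u :=
    ContDiff.comp (g := fun y : ℝ × ℝ => b y.1 y.2) hb (contDiff_prodMk_left u)
  exact h.differentiable (by simp) x

lemma Smooth₂.differentiableAt_right (hb : Smooth₂ b) (x u : ℝ) :
    DifferentiableAt ℝ (fun u => b x u) u := by
  have h : ContDiff ℝ ∞ fun u : ℝ => b x u :=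
    ContDiff.comp (g := fun y : ℝ × ℝ => b y.1 y.2) hb (contDiff_prodMk_right x)
  exact h.differentiable (by simp) u

lemma SmoothPair.add (h : SmoothPair a b) (h' : SmoothPair a' b') :
    SmoothPair (fun x => a x + a' x) fun x u => b x u + b' x u :=
  ⟨h.left.add h'.left, ContDiff.add h.right h'.right⟩

lemma SmoothPair.const_mul (h : SmoothPair a b) (c : ℝ) :
    SmoothPair (fun x => c * a x) fun x u => c * b x u :=
  ⟨contDiff_const.mul h.left, ContDiff.mul contDiff_const h.right⟩

lemma SmoothPair.baseComponent_add (h : SmoothPair a b) (h' : SmoothPair a' b') (p : JetInf)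
    (i : Fin 3) :
    FeedbackJets.baseComponent (fun x => a x + a' x) (fun x u => b x u + b' x u) p i =
      FeedbackJets.baseComponent a b p i + FeedbackJets.baseComponent a' b' p i := by
  fin_cases i
  · rfl
  · rfl
  · simp only [FeedbackJets.baseComponent, Fin.reduceFinMk, Matrix.cons_val]
    rw [deriv_fun_add (h.right.differentiableAt_right _ _) (h'.right.differentiableAt_right _ _),
      deriv_fun_add (h.right.differentiableAt_left _ _) (h'.right.differentiableAt_left _ _)]
    ring

lemma baseComponent_const_mul (c : ℝ) (p : JetInf) (i : Fin 3) :
    baseComponent (fun x => c * a x) (fun x u => c * b x u) p i = c * baseComponent a b p i := by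
  fin_cases i
  · rfl
  · rfl
  · simp only [baseComponent, Fin.reduceFinMk, Matrix.cons_val, deriv_const_mul_field']
    ring

lemma SmoothPair.generatingFunction_add (h : SmoothPair a b) (h' : SmoothPair a' b') :
    FeedbackJets.generatingFunction (fun x => a x + a' x) (fun x u => b x u + b' x u) =
      fun p => FeedbackJets.generatingFunction a b p + FeedbackJets.generatingFunction a' b' p := by
  funext p
  simp only [FeedbackJets.generatingFunction, h.baseComponent_add h', add_mul,
    Finset.sum_add_distrib]
  rw [deriv_fun_add (h.left.differentiable (by simp) _) (h'.left.differentiable (by simp) _)]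
  ring

lemma generatingFunction_const_mul (c : ℝ) :
    generatingFunction (fun x => c * a x) (fun x u => c * b x u) =
      fun p => c * generatingFunction a b p := by
  funext p
  simp only [generatingFunction, baseComponent_const_mul, deriv_const_mul_field', mul_assoc,
    ← Finset.mul_sum]
  ring

lemma iterate_totalDeriv_const_mul (c : ℝ) (i : Fin 3) (n : ℕ) (g : JetInf → ℝ) :
    (totalDeriv i)^[n] (fun p => c * g p) = fun p => c * (totalDeriv i)^[n] g p := by
  induction n generalizing g with
  | zero => rfl
  | succ n ih =>
    have : totalDeriv i (fun p => c * g p) = fun p => c * totalDeriv i g p := by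
      funext p
      simp only [totalDeriv, lineDeriv, deriv_const_mul_field']
    rw [Function.iterate_succ_apply, this, ih]
    rfl

lemma totalDerivIter_const_mul (c : ℝ) (σ : Fin 3 → ℕ) (g : JetInf → ℝ) :
    totalDerivIter σ (fun p => c * g p) = fun p => c * totalDerivIter σ g p := by
  unfold totalDerivIter
  rw [iterate_totalDeriv_const_mul, iterate_totalDeriv_const_mul, iterate_totalDeriv_const_mul]

lemma SmoothPair.feedbackField_add (h : SmoothPair a b) (h' : SmoothPair a' b') {k : ℕ}
    (z : Jet k) :
    feedbackField (fun x => a x + a' x) (fun x u => b x u + b' x u) k z =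
      feedbackField a b k z + feedbackField a' b' k z := by
  refine Prod.ext (funext fun i => h.baseComponent_add h' _ i) (funext fun σ => ?_)
  simp only [feedbackField, JetInf.trunc, prolongInf, Prod.snd_add, Pi.add_apply,
    h.generatingFunction_add h', h.baseComponent_add h',
    h.generatingFunction.totalDerivIter_add h'.generatingFunction, add_mul,
    Finset.sum_add_distrib]
  ring

lemma feedbackField_const_mul (c : ℝ) {k : ℕ} (z : Jet k) :
    feedbackField (fun x => c * a x) (fun x u => c * b x u) k z = c • feedbackField a b k z := by
  refine Prod.ext (funext fun i => baseComponent_const_mul c _ i) (funext fun σ => ?_)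
  simp only [feedbackField, JetInf.trunc, prolongInf, Prod.smul_snd, Pi.smul_apply, smul_eq_mul,
    generatingFunction_const_mul, baseComponent_const_mul, totalDerivIter_const_mul, mul_assoc,
    ← Finset.mul_sum]
  ring

lemma feedbackField_sum {ι : Type*} (s : Finset ι) {a : ι → ℝ → ℝ} {b : ι → ℝ → ℝ → ℝ}
    (h : ∀ i, SmoothPair (a i) (b i)) (c : ι → ℝ) {k : ℕ} (z : Jet k) :
    SmoothPair (fun x => ∑ i ∈ s, c i * a i x) (fun x u => ∑ i ∈ s, c i * b i x u) ∧
    feedbackField (fun x => ∑ i ∈ s, c i * a i x) (fun x u => ∑ i ∈ s, c i * b i x u) k z =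
      ∑ i ∈ s, c i • feedbackField (a i) (b i) k z := by
  classical
  induction s using Finset.induction_on with
  | empty =>
    have h0 : SmoothPair (fun _ => 0) fun _ _ => 0 := ⟨contDiff_const, contDiff_const⟩
    have := feedbackField_const_mul (a := fun _ => 0) (b := fun _ _ => 0) 0 z
    simp only [zero_mul, zero_smul] at this
    simpa using ⟨h0, this⟩
  | insert i s hi ih =>
    simp only [Finset.sum_insert hi]
    refine ⟨((h i).const_mul (c i)).add ih.1, ?_⟩
    rw [((h i).const_mul (c i)).feedbackField_add ih.1, ih.2, feedbackField_const_mul]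

end Linearity

/-! ### Concatenation of feedback paths -/

lemma deriv_smoothTransition_of_nonpos {t : ℝ} (ht : t ≤ 0) :
    deriv Real.smoothTransition t = 0 := by
  refine IsLocalMin.deriv_eq_zero (Filter.Eventually.of_forall fun s => ?_)
  rw [Real.smoothTransition.zero_of_nonpos ht]
  exact Real.smoothTransition.nonneg s

lemma deriv_smoothTransition_of_one_le {t : ℝ} (ht : 1 ≤ t) :
    deriv Real.smoothTransition t = 0 := by
  refine IsLocalMax.deriv_eq_zero (Filter.Eventually.of_forall fun s => ?_)
  rw [Real.smoothTransition.one_of_one_le ht]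
  exact Real.smoothTransition.le_one s

lemma contDiff_deriv_smoothTransition : ContDiff ℝ ∞ (deriv Real.smoothTransition) :=
  (contDiff_infty_iff_deriv.1 Real.smoothTransition.contDiff).2

lemma smoothPair_of_family {a : ℝ → ℝ → ℝ} {b : ℝ → ℝ → ℝ → ℝ}
    (ha : ContDiff ℝ ∞ (fun y : ℝ × ℝ => a y.1 y.2))
    (hb : ContDiff ℝ ∞ (fun y : ℝ × ℝ × ℝ => b y.1 y.2.1 y.2.2)) (t : ℝ) :
    SmoothPair (a t) (b t) :=
  ⟨ContDiff.comp (g := fun y : ℝ × ℝ => a y.1 y.2) ha (contDiff_prodMk_right t),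
    ContDiff.comp (g := fun y : ℝ × ℝ × ℝ => b y.1 y.2.1 y.2.2) hb (contDiff_prodMk_right t)⟩

/-- Smooth steps slow both paths to rest at the junction, so the concatenated family of fields
remains smooth in time. -/
lemma feedbackOrbit_trans {k : ℕ} {p q r : Jet k} (hq : q ∈ feedbackOrbit k p)
    (hr : r ∈ feedbackOrbit k q) : r ∈ feedbackOrbit k p := by
  obtain ⟨a₁, b₁, γ₁, ha₁, hb₁, h10, h11, h1⟩ := hq
  obtain ⟨a₂, b₂, γ₂, ha₂, hb₂, h20, h21, h2⟩ := hr
  set s := Real.smoothTransition with hs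
  have hsd (t : ℝ) : HasDerivAt s (deriv s t) t :=
    (Real.smoothTransition.contDiffAt.differentiableAt (n := 1) (by simp)).hasDerivAt
  have hs0 {t : ℝ} (ht : t ≤ 0) : s t = 0 := Real.smoothTransition.zero_of_nonpos ht
  have hs1 {t : ℝ} (ht : 1 ≤ t) : s t = 1 := Real.smoothTransition.one_of_one_le ht
  have hsI (t : ℝ) : s t ∈ Set.Icc (0 : ℝ) 1 :=
    ⟨Real.smoothTransition.nonneg t, Real.smoothTransition.le_one t⟩
  have hsc : ContDiff ℝ ∞ s := Real.smoothTransition.contDiff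
  have hdc : ContDiff ℝ ∞ (deriv s) := contDiff_deriv_smoothTransition
  refine ⟨fun t x => 2 * deriv s (2 * t) * a₁ (s (2 * t)) x +
      2 * deriv s (2 * t - 1) * a₂ (s (2 * t - 1)) x,
    fun t x u => 2 * deriv s (2 * t) * b₁ (s (2 * t)) x u +
      2 * deriv s (2 * t - 1) * b₂ (s (2 * t - 1)) x u,
    -- At every time at least one of the two summands rests at `q`, so subtracting `q` leaves the
    -- path that is moving.
    fun t => γ₁ (s (2 * t)) + γ₂ (s (2 * t - 1)) - q, ?_, ?_, ?_, ?_, fun t _ => ?_⟩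
  · have e1 : ContDiff ℝ ∞ fun y : ℝ × ℝ => a₁ (s (2 * y.1)) y.2 :=
      ContDiff.comp (g := fun y : ℝ × ℝ => a₁ y.1 y.2) (f := fun y : ℝ × ℝ => (s (2 * y.1), y.2))
        ha₁ (by fun_prop)
    have e2 : ContDiff ℝ ∞ fun y : ℝ × ℝ => a₂ (s (2 * y.1 - 1)) y.2 :=
      ContDiff.comp (g := fun y : ℝ × ℝ => a₂ y.1 y.2) (f := fun y : ℝ × ℝ => (s (2 * y.1 - 1), y.2))
        ha₂ (by fun_prop)
    fun_prop
  · have e1 : ContDiff ℝ ∞ fun y : ℝ × ℝ × ℝ => b₁ (s (2 * y.1)) y.2.1 y.2.2 :=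
      ContDiff.comp (g := fun y : ℝ × ℝ × ℝ => b₁ y.1 y.2.1 y.2.2)
        (f := fun y : ℝ × ℝ × ℝ => (s (2 * y.1), y.2)) hb₁ (by fun_prop)
    have e2 : ContDiff ℝ ∞ fun y : ℝ × ℝ × ℝ => b₂ (s (2 * y.1 - 1)) y.2.1 y.2.2 :=
      ContDiff.comp (g := fun y : ℝ × ℝ × ℝ => b₂ y.1 y.2.1 y.2.2)
        (f := fun y : ℝ × ℝ × ℝ => (s (2 * y.1 - 1), y.2)) hb₂ (by fun_prop)
    fun_prop
  · dsimp only
    rw [hs0 (by norm_num), hs0 (by norm_num), h10, h20, add_sub_cancel_right]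
  · dsimp only
    rw [hs1 (by norm_num), hs1 (by norm_num), h11, h21, add_sub_cancel_left]
  · have f1 := smoothPair_of_family ha₁ hb₁ (s (2 * t))
    have f2 := smoothPair_of_family ha₂ hb₂ (s (2 * t - 1))
    have d1 : HasDerivWithinAt (fun t => s (2 * t)) (2 * deriv s (2 * t)) (Set.Icc 0 1) t := by
      have := (hsd (2 * t)).comp t ((hasDerivAt_id t).const_mul 2)
      refine this.hasDerivWithinAt.congr_deriv ?_
      ring
    have d2 : HasDerivWithinAt (fun t => s (2 * t - 1)) (2 * deriv s (2 * t - 1))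
        (Set.Icc 0 1) t := by
      have := (hsd (2 * t - 1)).comp t (((hasDerivAt_id t).const_mul 2).sub_const 1)
      refine this.hasDerivWithinAt.congr_deriv ?_
      ring
    have d := ((HasDerivWithinAt.scomp t (h := fun t => s (2 * t)) (h1 _ (hsI _)) d1
      fun t _ => hsI _).add (HasDerivWithinAt.scomp t (h := fun t => s (2 * t - 1))
      (h2 _ (hsI _)) d2 fun t _ => hsI _)).sub_const q
    refine d.congr_deriv ?_
    rw [(f1.const_mul _).feedbackField_add (f2.const_mul _), feedbackField_const_mul,
      feedbackField_const_mul]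
    dsimp only
    rcases le_total (2 * t) 1 with ht | ht
    · have e : deriv s (2 * t - 1) = 0 := deriv_smoothTransition_of_nonpos (by linarith)
      rw [e, hs0 (t := 2 * t - 1) (by linarith), h20, add_sub_cancel_right]
      simp
    · have e : deriv s (2 * t) = 0 := deriv_smoothTransition_of_one_le ht
      rw [e, hs1 ht, h11, add_sub_cancel_left]
      simp

/-! ### Local transitivity on level sets of the invariants -/

section Local

variable {k : ℕ} {q : Jet k}

/-- The basic invariants of order `≤ k`, as a map to a Euclidean space. -/
def invariantMap (k : ℕ) (z : Jet k) : FreeIndex k → ℝ := fun τ => jetInvariant k τ.1 z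

lemma contDiffAt_invariantMap (hq : IsRegular q) : ContDiffAt ℝ ∞ (invariantMap k) q :=
  contDiffAt_pi.2 fun τ => contDiffAt_jetInvariant hq τ.2.2 τ.2.1

lemma contDiffOn_invariantMap (k : ℕ) :
    ContDiffOn ℝ ∞ (invariantMap k) {z : Jet k | IsRegular z} :=
  fun _ hz => (contDiffAt_invariantMap hz).contDiffWithinAt

lemma fderiv_invariantMap_apply (hq : IsRegular q) (v : Jet k) (τ : FreeIndex k) :
    fderiv ℝ (invariantMap k) q v τ = fderiv ℝ (jetInvariant k τ.1) q v := by
  have := hasFDerivAt_pi.2 fun τ : FreeIndex k =>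
    ((contDiffAt_jetInvariant hq τ.2.2 τ.2.1).differentiableAt (by simp)).hasFDerivAt
  have e : fderiv ℝ (invariantMap k) q = _ := this.fderiv
  rw [e]
  rfl

lemma fderiv_invariantMap_eq_zero_iff (hq : IsRegular q) (v : Jet k) :
    fderiv ℝ (invariantMap k) q v = 0 ↔ v ∈ feedbackDistribution k q := by
  rw [mem_feedbackDistribution_iff hq, funext_iff]
  simp only [fderiv_invariantMap_apply hq, Pi.zero_apply]

lemma surjective_fderiv_invariantMap (hq : IsRegular q) :
    Function.Surjective (fderiv ℝ (invariantMap k) q) := by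
  intro y
  obtain ⟨v, hv⟩ := surjective_pi_of_linearIndependent (linearIndependent_invariantCovector hq) y
  refine ⟨v, funext fun τ => ?_⟩
  rw [fderiv_invariantMap_apply hq, ← hv]
  rfl

/-- Near a regular point, points with the same invariants lie on the same orbit. -/
lemma eventually_mem_feedbackOrbit (hq : IsRegular q) :
    ∀ᶠ r in 𝓝 q, invariantMap k r = invariantMap k q → r ∈ feedbackOrbit k q := by
  -- A basis of the distribution at `q` is chosen among feedback fields. Because the rank is
  -- constant on regular points, the same fields remain a basis nearby.
  obtain ⟨d, f, hd, hf, hli⟩ : ∃ (d : ℕ) (f : Fin d → Jet k),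
      d = Module.finrank ℝ (feedbackDistribution k q) ∧
      (∀ i, ∃ (a : ℝ → ℝ) (b : ℝ → ℝ → ℝ), ContDiff ℝ ∞ a ∧
        ContDiff ℝ ∞ (fun y : ℝ × ℝ => b y.1 y.2) ∧ f i = feedbackField a b k q) ∧
      LinearIndependent ℝ f := by
    obtain ⟨f, hf, -, hli⟩ := Submodule.exists_fun_fin_finrank_span_eq ℝ
      {v | ∃ (a : ℝ → ℝ) (b : ℝ → ℝ → ℝ), ContDiff ℝ ∞ a ∧
        ContDiff ℝ ∞ (fun y : ℝ × ℝ => b y.1 y.2) ∧ v = feedbackField a b k q}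
    exact ⟨_, f, rfl, hf, hli⟩
  choose a b ha hb hab using hf
  have hp (i) : SmoothPair (a i) (b i) := ⟨ha i, hb i⟩
  obtain rfl : f = fun i => feedbackField (a i) (b i) k q := funext hab
  have hN := exists_smooth_coefficients (X := fun i => feedbackField (a i) (b i) k)
    (fun i => (hp i).contDiff_feedbackField k) hli
  obtain ⟨N, hN, hNo, hqN⟩ := eventually_nhds_iff.1 hN
  set U := N ∩ {z : Jet k | IsRegular z} with hU
  have hUo : IsOpen U := hNo.inter (isOpen_isRegular k)
  have hΦ : ContDiffOn ℝ ∞ (invariantMap k) U :=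
    (contDiffOn_invariantMap k).mono Set.inter_subset_right
  filter_upwards [exists_path_in_level hUo hΦ ⟨hqN, hq⟩ (surjective_fderiv_invariantMap hq)]
    with r hr hrq
  obtain ⟨γ, hγ, h0, h1, hγU⟩ := hr hrq
  have hγd (t : ℝ) : HasDerivAt γ (deriv γ t) t := (hγ.differentiable (by simp) t).hasDerivAt
  have hc (t : ℝ) : ∃ c : Fin d → ℝ,
      ∑ i, c i • feedbackField (a i) (b i) k (γ t) = deriv γ t := by
    obtain ⟨⟨htN, htr⟩, -⟩ := hγU t
    have e1 : deriv γ t ∈ feedbackDistribution k (γ t) := by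
      rw [← fderiv_invariantMap_eq_zero_iff htr]
      have d1 := (((contDiffAt_invariantMap htr).differentiableAt (by simp)).hasFDerivAt).comp_hasDerivAt
        t (hγd t)
      have d2 : HasDerivAt (invariantMap k ∘ γ) 0 t := by
        have : invariantMap k ∘ γ = fun _ => invariantMap k q := funext fun t => (hγU t).2
        rw [this]
        exact hasDerivAt_const _ _
      exact d1.unique d2
    have e2 : Submodule.span ℝ (Set.range fun i => feedbackField (a i) (b i) k (γ t)) =
        feedbackDistribution k (γ t) := by
      refine Submodule.eq_of_le_of_finrank_eq ?_ ?_
      · rw [Submodule.span_le]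
        rintro _ ⟨i, rfl⟩
        exact feedbackField_mem _ (hp i)
      · rw [finrank_span_eq_card (hN _ htN).1, Fintype.card_fin, hd, finrank_feedbackDistribution htr,
          finrank_feedbackDistribution hq]
    rw [← e2] at e1
    exact (Submodule.mem_span_range_iff_exists_fun ℝ).1 e1
  choose c hc using hc
  -- The coefficients of the velocity, so far chosen pointwise, are unique and are recovered by the
  -- smooth operator `C`.
  have hcs : ContDiff ℝ ∞ c := by
    rw [contDiff_iff_contDiffAt]
    intro t
    obtain ⟨-, C, hC, hC'⟩ := hN _ (hγU t).1.1
    have e : c =ᶠ[𝓝 t] fun t => C (γ t) (deriv γ t) := by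
      filter_upwards [hγ.continuous.continuousAt.eventually hC'] with s hs
      rw [← hc s]
      exact (hs (c s)).symm
    refine ContDiffAt.congr_of_eventuallyEq ?_ e
    exact (hC.comp t hγ.contDiffAt).clm_apply (contDiff_infty_iff_deriv.1 hγ).2.contDiffAt
  have hci (i) : ContDiff ℝ ∞ fun t => c t i := contDiff_pi.1 hcs i
  refine ⟨fun t x => ∑ i, c t i * a i x, fun t x u => ∑ i, c t i * b i x u, γ, ?_, ?_, h0, h1,
    fun t _ => ?_⟩
  · exact ContDiff.sum fun i _ => ((hci i).comp contDiff_fst).mul ((ha i).comp contDiff_snd)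
  · exact ContDiff.sum fun i _ => ((hci i).comp contDiff_fst).mul
      (ContDiff.comp (g := fun y : ℝ × ℝ => b i y.1 y.2) (hb i) contDiff_snd)
  · dsimp only
    rw [(feedbackField_sum Finset.univ hp (c t) (γ t)).2, hc t]
    exact (hγd t).hasDerivWithinAt

end Local

/-! ### Invariance of the basic invariants along feedback paths -/

/-- A solution of a scalar linear equation that does not vanish initially never vanishes. -/
lemma ne_zero_of_hasDerivWithinAt_mul {y l : ℝ → ℝ} (hl : ContinuousOn l (Set.Icc 0 1))
    (hy : ∀ t ∈ Set.Icc (0 : ℝ) 1, HasDerivWithinAt y (l t * y t) (Set.Icc 0 1) t)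
    (h0 : y 0 ≠ 0) {t : ℝ} (ht : t ∈ Set.Icc (0 : ℝ) 1) : y t ≠ 0 := by
  obtain ⟨M, hM⟩ := isCompact_Icc.exists_bound_of_continuousOn hl
  -- With `M` a bound for `|l|`, the function `y² e^{2Mt}` has derivative `2 (l + M) y² e^{2Mt} ≥
  -- 0`, so it never falls below its positive initial value.
  have hd : ∀ t ∈ Set.Icc (0 : ℝ) 1, HasDerivWithinAt (fun t => y t ^ 2 * Real.exp (2 * M * t))
      (2 * (l t + M) * (y t ^ 2 * Real.exp (2 * M * t))) (Set.Icc 0 1) t := by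
    intro t ht
    have h1 := ((hy t ht).pow 2).mul
      (((hasDerivAt_id t).const_mul (2 * M)).exp.hasDerivWithinAt (s := Set.Icc 0 1))
    refine h1.congr_deriv ?_
    simp only [id, Pi.pow_apply]
    push_cast
    ring
  have hmono : MonotoneOn (fun t => y t ^ 2 * Real.exp (2 * M * t)) (Set.Icc 0 1) := by
    refine monotoneOn_of_deriv_nonneg (convex_Icc 0 1)
      (fun t ht => (hd t ht).continuousWithinAt)
      (fun t ht => ((hd t (interior_subset ht)).hasDerivAt
        (mem_interior_iff_mem_nhds.1 ht)).differentiableAt.differentiableWithinAt)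
      fun t ht => ?_
    rw [((hd t (interior_subset ht)).hasDerivAt (mem_interior_iff_mem_nhds.1 ht)).deriv]
    have := neg_le_of_abs_le (hM t (interior_subset ht))
    have : 0 ≤ l t + M := by linarith
    positivity
  have h1 := hmono (Set.left_mem_Icc.2 zero_le_one) ht ht.1
  intro h
  simp only [h, mul_zero, Real.exp_zero] at h1
  have : 0 < y 0 ^ 2 := by positivity
  linarith

/-- The coordinate `f_σ` as a continuous functional. -/
def coordCLM {k : ℕ} (σ : JetIndex k) : Jet k →L[ℝ] ℝ :=
  (ContinuousLinearMap.proj σ).comp (ContinuousLinearMap.snd ℝ (Fin 3 → ℝ) (JetIndex k → ℝ))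

section Path

variable {k : ℕ} {a : ℝ → ℝ → ℝ} {b : ℝ → ℝ → ℝ → ℝ} {γ : ℝ → Jet k}

lemma hasDerivWithinAt_coord {t : ℝ} {s : Set ℝ} {a : ℝ → ℝ} {b : ℝ → ℝ → ℝ}
    (hγ : HasDerivWithinAt γ (feedbackField a b k (γ t)) s t)
    {σ : Fin 3 → ℕ} (hσ : ∑ i, σ i ≤ k) :
    HasDerivWithinAt (fun t => (γ t).ext.2 σ) ((prolongInf a b (γ t).ext).2 σ) s t := by
  have := (coordCLM (⟨σ, hσ⟩ : JetIndex k)).hasFDerivAt.comp_hasDerivWithinAt t hγ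
  have e : (fun t => (γ t).ext.2 σ) = coordCLM (⟨σ, hσ⟩ : JetIndex k) ∘ γ :=
    funext fun t => (γ t).ext_snd_of_le hσ
  rw [e]
  exact this

lemma hasDerivWithinAt_base {t : ℝ} {s : Set ℝ} {a : ℝ → ℝ} {b : ℝ → ℝ → ℝ}
    (hγ : HasDerivWithinAt γ (feedbackField a b k (γ t)) s t) (i : Fin 3) :
    HasDerivWithinAt (fun t => (γ t).1 i) ((prolongInf a b (γ t).ext).1 i) s t :=
  ((ContinuousLinearMap.proj i).comp
    (ContinuousLinearMap.fst ℝ (Fin 3 → ℝ) (JetIndex k → ℝ))).hasFDerivAt.comp_hasDerivWithinAt t hγ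

lemma continuous_deriv_family (ha : ContDiff ℝ ∞ (fun y : ℝ × ℝ => a y.1 y.2)) :
    Continuous fun y : ℝ × ℝ => deriv (a y.1) y.2 := by
  have e : (fun y : ℝ × ℝ => deriv (a y.1) y.2) =
      fun y => fderiv ℝ (fun y : ℝ × ℝ => a y.1 y.2) y (0, 1) := by
    funext y
    exact ((ha.differentiable (by simp) y).hasFDerivAt.comp_hasDerivAt y.2
      ((hasDerivAt_const y.2 y.1).prodMk (hasDerivAt_id y.2))).deriv
  rw [e]
  exact (ha.continuous_fderiv (by simp)).clm_apply continuous_const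

lemma continuous_partialX_family
    (hb : ContDiff ℝ ∞ (fun y : ℝ × ℝ × ℝ => b y.1 y.2.1 y.2.2)) :
    Continuous fun y : ℝ × ℝ × ℝ => partialX (b y.1) y.2.1 y.2.2 := by
  have e : (fun y : ℝ × ℝ × ℝ => partialX (b y.1) y.2.1 y.2.2) =
      fun y => fderiv ℝ (fun y : ℝ × ℝ × ℝ => b y.1 y.2.1 y.2.2) y (0, 1, 0) := by
    funext y
    exact ((hb.differentiable (by simp) y).hasFDerivAt.comp_hasDerivAt y.2.1
      ((hasDerivAt_const y.2.1 y.1).prodMk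
        ((hasDerivAt_id y.2.1).prodMk (hasDerivAt_const y.2.1 y.2.2)))).deriv
  rw [e]
  exact (hb.continuous_fderiv (by simp)).clm_apply continuous_const

lemma continuous_partialU_family
    (hb : ContDiff ℝ ∞ (fun y : ℝ × ℝ × ℝ => b y.1 y.2.1 y.2.2)) :
    Continuous fun y : ℝ × ℝ × ℝ => partialU (b y.1) y.2.1 y.2.2 := by
  have e : (fun y : ℝ × ℝ × ℝ => partialU (b y.1) y.2.1 y.2.2) =
      fun y => fderiv ℝ (fun y : ℝ × ℝ × ℝ => b y.1 y.2.1 y.2.2) y (0, 0, 1) := by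
    funext y
    exact ((hb.differentiable (by simp) y).hasFDerivAt.comp_hasDerivAt y.2.2
      ((hasDerivAt_const y.2.2 y.1).prodMk
        ((hasDerivAt_const y.2.2 y.2.1).prodMk (hasDerivAt_id y.2.2)))).deriv
  rw [e]
  exact (hb.continuous_fderiv (by simp)).clm_apply continuous_const

/-- Extension by zero gives `f_11` the value zero when `k < 2`. -/
lemma two_le_of_isRegular {z : Jet k} (hz : IsRegular z) : 2 ≤ k := by
  by_contra h
  refine hz.2.2.1 ?_
  have : ¬ ∑ i, idx 0 0 2 i ≤ k := by rw [idx_sum]; omega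
  exact dif_neg this

/-- Regularity is preserved along feedback paths. -/
lemma isRegular_of_path (ha : ContDiff ℝ ∞ (fun y : ℝ × ℝ => a y.1 y.2))
    (hb : ContDiff ℝ ∞ (fun y : ℝ × ℝ × ℝ => b y.1 y.2.1 y.2.2)) (h0 : IsRegular (γ 0))
    (hγ : ∀ t ∈ Set.Icc (0 : ℝ) 1,
      HasDerivWithinAt γ (feedbackField (a t) (b t) k (γ t)) (Set.Icc 0 1) t)
    {t : ℝ} (ht : t ∈ Set.Icc (0 : ℝ) 1) : IsRegular (γ t) := by
  have hk := two_le_of_isRegular h0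
  have i0 : ∑ i, idx 0 0 0 i ≤ k := by rw [idx_sum]; omega
  have i1 : ∑ i, idx 0 0 1 i ≤ k := by rw [idx_sum]; omega
  have i2 : ∑ i, idx 0 0 2 i ≤ k := by rw [idx_sum]; omega
  have hp (t) := smoothPair_of_family ha hb t
  have d (t) (ht : t ∈ Set.Icc (0 : ℝ) 1) {σ : Fin 3 → ℕ} (hσ : ∑ i, σ i ≤ k) :=
    hasDerivWithinAt_coord (hγ t ht) hσ
  have cx (i : Fin 3) : ContinuousOn (fun t => (γ t).1 i) (Set.Icc 0 1) :=
    fun t ht => (hasDerivWithinAt_base (hγ t ht) i).continuousWithinAt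
  have c1 : ContinuousOn (fun t => (γ t).ext.2 (idx 0 0 1)) (Set.Icc 0 1) :=
    fun t ht => (d t ht i1).continuousWithinAt
  have cA : ContinuousOn (fun t => deriv (a t) ((γ t).1 0)) (Set.Icc 0 1) :=
    (continuous_deriv_family ha).comp_continuousOn (continuousOn_id.prodMk (cx 0))
  have cX : ContinuousOn (fun t => partialX (b t) ((γ t).1 0) ((γ t).1 1)) (Set.Icc 0 1) :=
    (continuous_partialX_family hb).comp_continuousOn
      (continuousOn_id.prodMk ((cx 0).prodMk (cx 1)))
  have cU : ContinuousOn (fun t => partialU (b t) ((γ t).1 0) ((γ t).1 1)) (Set.Icc 0 1) :=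
    (continuous_partialU_family hb).comp_continuousOn
      (continuousOn_id.prodMk ((cx 0).prodMk (cx 1)))
  -- All four quantities are relative invariants: along a feedback path each satisfies a linear
  -- equation `y' = λ y` with continuous `λ`.
  refine ⟨ne_zero_of_hasDerivWithinAt_mul (y := fun t => (γ t).ext.2 (idx 0 0 0)) cA (fun t ht => ?_) h0.1 ht,
    ne_zero_of_hasDerivWithinAt_mul (y := fun t => (γ t).ext.2 (idx 0 0 1))
      (cA.sub (cU.add (c1.mul cX))) (fun t ht => ?_) h0.2.1 ht,
    ne_zero_of_hasDerivWithinAt_mul (y := fun t => (γ t).ext.2 (idx 0 0 2))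
      ((cA.sub ((continuousOn_const (c := (2 : ℝ))).mul cU)).sub
        (((continuousOn_const (c := (3 : ℝ))).mul c1).mul cX)) (fun t ht => ?_) h0.2.2.1 ht,
    ne_zero_of_hasDerivWithinAt_mul (y := fun t => (γ t).1 2 * (γ t).ext.2 (idx 0 0 1) -
      (γ t).ext.2 (idx 0 0 0)) (cA.sub (c1.mul cX)) (fun t ht => ?_) h0.2.2.2 ht⟩
  · exact (d t ht i0).congr_deriv (prolongInf_f _)
  · exact (d t ht i1).congr_deriv (prolongInf_f₁ (hp t) _)
  · exact (d t ht i2).congr_deriv (prolongInf_f₁₁ (hp t) _)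
  · refine (((hasDerivWithinAt_base (hγ t ht) 2).mul (d t ht i1)).sub (d t ht i0)).congr_deriv ?_
    rw [prolongInf_f, prolongInf_f₁ (hp t), prolongInf_u₁]
    change (_ : ℝ) = (deriv (a t) ((γ t).1 0) - (γ t).ext.2 (idx 0 0 1) *
      partialX (b t) ((γ t).1 0) ((γ t).1 1)) *
        ((γ t).1 2 * (γ t).ext.2 (idx 0 0 1) - (γ t).ext.2 (idx 0 0 0))
    change (((γ t).1 2 * partialU (b t) ((γ t).1 0) ((γ t).1 1) + (γ t).ext.2 (idx 0 0 0) *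
      partialX (b t) ((γ t).1 0) ((γ t).1 1)) * _ + (γ t).1 2 * ((deriv (a t) ((γ t).1 0) -
        (partialU (b t) ((γ t).1 0) ((γ t).1 1) + (γ t).ext.2 (idx 0 0 1) *
          partialX (b t) ((γ t).1 0) ((γ t).1 1))) * (γ t).ext.2 (idx 0 0 1)) -
      deriv (a t) ((γ t).1 0) * (γ t).ext.2 (idx 0 0 0) : ℝ) = _
    ring

end Path

/-- Points on the orbit of a regular point are regular and have the same invariants. -/
lemma invariantMap_eq_of_mem_feedbackOrbit {k : ℕ} {p q : Jet k} (hp : IsRegular p)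
    (hq : q ∈ feedbackOrbit k p) : IsRegular q ∧ invariantMap k q = invariantMap k p := by
  obtain ⟨a, b, γ, ha, hb, rfl, rfl, hγ⟩ := hq
  have h1 : (1 : ℝ) ∈ Set.Icc (0 : ℝ) 1 := ⟨zero_le_one, le_rfl⟩
  have hr {t : ℝ} (ht : t ∈ Set.Icc (0 : ℝ) 1) := isRegular_of_path ha hb hp hγ ht
  refine ⟨hr h1, ?_⟩
  have d : ∀ t ∈ Set.Icc (0 : ℝ) 1,
      HasDerivWithinAt (fun t => invariantMap k (γ t)) 0 (Set.Icc 0 1) t := by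
    intro t ht
    refine ((((contDiffAt_invariantMap (hr ht)).differentiableAt
      (by simp)).hasFDerivAt).comp_hasDerivWithinAt t (hγ t ht)).congr_deriv ?_
    exact (fderiv_invariantMap_eq_zero_iff (hr ht) _).2
      (feedbackField_mem _ (smoothPair_of_family ha hb t))
  exact constant_of_derivWithin_zero (fun t ht => (d t ht).differentiableWithinAt)
    (fun t ht => (d t (Set.Ico_subset_Icc_self ht)).derivWithin
      (uniqueDiffOn_Icc zero_lt_one t (Set.Ico_subset_Icc_self ht))) 1 h1

/-- Orbits of regular points are embedded submanifolds. -/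
lemma isEmbeddedSubmanifold_feedbackOrbit {k : ℕ} {p : Jet k} (hp : IsRegular p) :
    IsEmbeddedSubmanifold (feedbackOrbit k p)
      (Module.finrank ℝ (Jet k) - Fintype.card (FreeIndex k)) := by
  intro q hq
  obtain ⟨hqr, hqp⟩ := invariantMap_eq_of_mem_feedbackOrbit hp hq
  obtain ⟨N, hN, hNo, hqN⟩ := eventually_nhds_iff.1 (eventually_mem_feedbackOrbit hqr)
  set e := Fintype.equivFin (FreeIndex k) with he
  set T : (FreeIndex k → ℝ) ≃L[ℝ] (Fin (Fintype.card (FreeIndex k)) → ℝ) :=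
    (LinearEquiv.funCongrLeft ℝ ℝ e.symm).toContinuousLinearEquiv with hT
  refine ⟨N ∩ {z | IsRegular z}, Fintype.card (FreeIndex k), fun z => T (invariantMap k z),
    hNo.inter (isOpen_isRegular k), ⟨hqN, hqr⟩, Nat.sub_add_cancel (card_freeIndex_le k),
    T.contDiff.comp_contDiffOn ((contDiffOn_invariantMap k).mono Set.inter_subset_right),
    fun r hr => ?_, fun r hr => ?_⟩
  · have : fderiv ℝ (fun z => T (invariantMap k z)) r =
        (T : (FreeIndex k → ℝ) →L[ℝ] _).comp (fderiv ℝ (invariantMap k) r) :=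
      T.comp_fderiv
    rw [this]
    exact T.surjective.comp (surjective_fderiv_invariantMap hr.2)
  -- The invariants are constant on the orbit. Conversely, a point of `N` with the invariants of `q`
  -- is reached from `q`, hence from `p` by concatenation.
  · constructor
    · intro h
      dsimp only
      rw [(invariantMap_eq_of_mem_feedbackOrbit hp h).2, hqp]
    · intro h
      exact feedbackOrbit_trans hq (hN r hr.1 (T.injective h))

/-! ### Generation of the algebra of invariants -/

section Generation

variable {k : ℕ}

lemma IsDiffInvariant.exists_eq_comp {W : Set (Jet k)} {I : Jet k → ℝ}
    (hI : IsDiffInvariant k W I) {q : Jet k} (hqW : q ∈ W) (hq : IsRegular q) :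
    ∃ h : (FreeIndex k → ℝ) → ℝ, ContDiff ℝ ∞ h ∧ ∀ᶠ r in 𝓝 q, I r = h (invariantMap k r) := by
  refine exists_eq_comp_of_fderiv_eq_zero (U := W ∩ {z | IsRegular z})
    (hI.1.inter (isOpen_isRegular k)) ((contDiffOn_invariantMap k).mono Set.inter_subset_right)
    (hI.2.1.mono Set.inter_subset_left) ⟨hqW, hq⟩ (surjective_fderiv_invariantMap hq)
    fun r hr v hv => hI.fderiv_eq_zero hr.1 hr.2 fun τ => ?_
  rw [← fderiv_invariantMap_apply hr.2, hv]
  rfl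

lemma hasInvariantDimension {p : Jet k} (hp : IsRegular p) :
    HasInvariantDimension k p (Fintype.card (FreeIndex k)) := by
  set e := Fintype.equivFin (FreeIndex k) with he
  refine ⟨{z | IsRegular z}, fun i => jetInvariant k (e.symm i).1, hp,
    fun i => isDiffInvariant_jetInvariant (e.symm i).2.2 (e.symm i).2.1, isOpen_isRegular k,
    fun q hq => (linearIndependent_fderiv_jetInvariant hq).comp _ e.symm.injective,
    fun q hq W I hqW hI => ?_⟩
  obtain ⟨h, hh, heq⟩ := hI.exists_eq_comp hqW hq
  refine ⟨fun y => h fun τ => y (e τ), hh.comp (by fun_prop), heq.mono fun r hr => ?_⟩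
  rw [hr]
  simp only [Equiv.symm_apply_apply]
  rfl

/-- This identifies the polynomial symbol used for independence with the vector of top-order partial
derivatives. -/
lemma fderiv_trunc_symbolVec (I : Jet k → ℝ) (z : Jet k) (w : Fin 3 → ℝ) :
    fderiv ℝ I z ((symbolVec k w).trunc k) =
      ∑ σ : {σ : JetIndex k // ∑ i, σ.1 i = k}, jetSymbol k I z σ * ∏ n, w n ^ σ.1.1 n := by
  classical
  have e1 : ((symbolVec k w).trunc k).1 = 0 := rfl
  rw [jet_sum ((symbolVec k w).trunc k), e1]
  simp only [Pi.zero_apply, zero_smul, Finset.sum_const_zero, zero_add, map_sum, map_smul,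
    smul_eq_mul]
  symm
  refine Finset.sum_of_injOn (fun σ => σ.1) (Subtype.val_injective.injOn)
    (fun _ _ => Finset.mem_coe.2 (Finset.mem_univ _)) (fun σ _ hσ => ?_) (fun σ _ => ?_)
  · have h : ∑ i, σ.1 i ≠ k := fun h => hσ ⟨⟨σ, h⟩, Finset.mem_coe.2 (Finset.mem_univ _), rfl⟩
    have : ((symbolVec k w).trunc k).2 σ = 0 := if_neg h
    rw [this, zero_mul]
  · have : ((symbolVec k w).trunc k).2 σ.1 = ∏ n, w n ^ σ.1.1 n := if_pos σ.2
    rw [this, mul_comm]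
    rfl

lemma linearIndependent_jetSymbol {z : Jet k} (hz : IsRegular z) :
    LinearIndependent ℝ fun τ : PureIndex k => jetSymbol k (jetInvariant k τ.1) z := by
  rw [Fintype.linearIndependent_iff]
  intro c hc
  refine pure_coeff_eq_zero hz le_rfl fun w => ?_
  simp only [fderiv_trunc_symbolVec, Finset.mul_sum]
  rw [Finset.sum_comm]
  refine Finset.sum_eq_zero fun σ _ => ?_
  have := congrFun hc σ
  simp only [Finset.sum_apply, Pi.smul_apply, smul_eq_mul, Pi.zero_apply] at this
  simp only [← mul_assoc]
  rw [← Finset.sum_mul, this, zero_mul]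

lemma proj_ext_trunc (l : ℕ) (z : Jet k) : (z.proj l).ext.trunc l = z.ext.trunc l :=
  Jet.trunc_ext _

lemma proj_ext_snd {l : ℕ} (z : Jet k) {σ : Fin 3 → ℕ} (h : ∑ i, σ i ≤ l) :
    (z.proj l).ext.2 σ = z.ext.2 σ :=
  Jet.ext_snd_of_le _ h

lemma IsRegular.proj {z : Jet k} (hz : IsRegular z) {l : ℕ} (hl : 2 ≤ l) :
    IsRegular (z.proj l) := by
  have e (m : ℕ) (hm : m ≤ 2) := proj_ext_snd (l := l) z (σ := idx 0 0 m)
    (by rw [idx_sum]; omega)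
  unfold IsRegular
  rw [e 0 (by norm_num), e 1 (by norm_num), e 2 le_rfl]
  exact hz

lemma jetInvariant_proj {z : Jet k} (hz : IsRegular z) {τ : Fin 3 → ℕ} (hτ : IsFree τ) {l : ℕ}
    (h : ∑ i, τ i ≤ l) : jetInvariant l τ (z.proj l) = jetInvariant k τ z :=
  (((isInvariant_basicInvariant hτ) z.ext hz).1.mono h).1 _ _ (proj_ext_trunc l z)

lemma isEmpty_freeIndex {l : ℕ} (hl : l < 2) : IsEmpty (FreeIndex l) := by
  refine ⟨fun ⟨τ, h, h'⟩ => ?_⟩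
  rw [Fin.sum_univ_three] at h
  unfold IsFree at h'
  omega

/-- Near the projection of a regular point, the basic invariants of lower order are invariants. -/
lemma exists_isDiffInvariant_proj {z : Jet k} (hz : IsRegular z) (l : ℕ) :
    ∃ V : Set (Jet l), IsOpen V ∧ z.proj l ∈ V ∧
      ∀ τ : FreeIndex l, IsDiffInvariant l V (jetInvariant l τ.1) := by
  -- For `l < 2` regularity on `J^l` is not available, but there are no basic invariants to
  -- consider.
  rcases lt_or_ge l 2 with hl | hl
  · have := isEmpty_freeIndex hl
    exact ⟨Set.univ, isOpen_univ, Set.mem_univ _, fun τ => isEmptyElim τ⟩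
  · exact ⟨{z | IsRegular z}, isOpen_isRegular l, hz.proj hl,
      fun τ => isDiffInvariant_jetInvariant τ.2.2 τ.2.1⟩

lemma hasPureOrderDimension {p : Jet k} (hp : IsRegular p) :
    HasPureOrderDimension k p (Fintype.card (PureIndex k)) := by
  set e := Fintype.equivFin (PureIndex k) with he
  refine ⟨{z | IsRegular z}, fun i => jetInvariant k (e.symm i).1, hp,
    fun i => isDiffInvariant_jetInvariant (e.symm i).2.2 (e.symm i).2.1.le, isOpen_isRegular k,
    fun q hq => (linearIndependent_jetSymbol hq).comp _ e.symm.injective,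
    fun q hq W I hqW hI => ?_⟩
  obtain ⟨h, hh, heq⟩ := hI.exists_eq_comp hqW hq
  obtain ⟨V, hV, hqV, hL⟩ := exists_isDiffInvariant_proj hq (k - 1)
  set e' := Fintype.equivFin (FreeIndex (k - 1)) with he'
  have hlt (τ : FreeIndex k) (hτ : ¬ ∑ i, τ.1 i = k) : ∑ i, τ.1 i ≤ k - 1 := by
    have := τ.2.1
    omega
  -- The basic invariants of order `≤ k` split into those of length exactly `k` and those pulled
  -- back from `J^(k-1)`; `h` is the common function with its arguments distributed accordingly.
  refine ⟨_, V, fun j => jetInvariant (k - 1) (e'.symm j).1, fun y => h fun τ =>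
    if hτ : ∑ i, τ.1 i = k then y.1 (e ⟨τ.1, hτ, τ.2.2⟩) else y.2 (e' ⟨τ.1, hlt τ hτ, τ.2.2⟩),
    hV, hqV, fun j => hL _, hh.comp (contDiff_pi.2 fun τ => ?_), ?_⟩
  · split_ifs <;> fun_prop
  · filter_upwards [heq, (isOpen_isRegular k).mem_nhds hq] with r hr hreg
    rw [hr]
    congr 1
    funext τ
    split_ifs with hτ
    · simp only [Equiv.symm_apply_apply]
      rfl
    · simp only [Equiv.symm_apply_apply]
      exact (jetInvariant_proj hreg τ.2.2 (hlt τ hτ)).symm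

end Generation

/-! ### Invariants of order two -/

lemma isFree_idx_two : IsFree (idx 0 0 2) := Or.inl le_rfl

lemma invariantJ_eq : invariantJ = jetInvariant 2 (idx 0 0 2) := rfl

lemma eq_idx_of_freeIndex_two (τ : FreeIndex 2) : τ.1 = idx 0 0 2 := by
  obtain ⟨τ, h, h'⟩ := τ
  rw [Fin.sum_univ_three] at h
  unfold IsFree at h'
  have h0 : τ 0 = 0 := by omega
  have h1 : τ 1 = 0 := by omega
  have h2 : τ 2 = 2 := by omega
  exact (eq_idx τ).trans (by rw [h0, h1, h2])

lemma isDiffInvariant_invariantJ : IsDiffInvariant 2 {p | IsRegular p} invariantJ :=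
  isDiffInvariant_jetInvariant isFree_idx_two (by rw [idx_sum])

lemma fderiv_invariantJ_ne_zero {p : Jet 2} (hp : IsRegular p) : fderiv ℝ invariantJ p ≠ 0 :=
  (linearIndependent_fderiv_jetInvariant hp).ne_zero
    (⟨idx 0 0 2, by rw [idx_sum], isFree_idx_two⟩ : FreeIndex 2)

lemma IsDiffInvariant.exists_eq_comp_invariantJ {U : Set (Jet 2)} {I : Jet 2 → ℝ}
    (hI : IsDiffInvariant 2 U I) {p : Jet 2} (hpU : p ∈ U) (hp : IsRegular p) :
    ∃ h : ℝ → ℝ, ContDiff ℝ ∞ h ∧ ∀ᶠ q in 𝓝 p, I q = h (invariantJ q) := by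
  obtain ⟨h, hh, heq⟩ := hI.exists_eq_comp hpU hp
  refine ⟨fun x => h fun _ => x, hh.comp (by fun_prop), heq.mono fun r hr => ?_⟩
  rw [hr]
  congr 1
  funext τ
  rw [invariantJ_eq, invariantMap, eq_idx_of_freeIndex_two τ]

lemma cast_finrank_sub_card {k : ℕ} (hk : 2 ≤ k) :
    ((Module.finrank ℝ (Jet k) - Fintype.card (FreeIndex k) : ℕ) : ℝ) =
      ((k : ℝ) + 1) ^ 2 / 2 + 5 * (k : ℝ) / 2 + 5 / 2 := by
  rw [Nat.cast_sub (card_freeIndex_le k), card_freeIndex hk, finrank_jet, Nat.cast_add,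
    card_jetIndex]
  push_cast
  ring

end FeedbackJets

end

theorem mainTheorem1 :
    -- order at most 1: only locally constant invariants
    (∀ k : ℕ, k ≤ 1 → ∀ (U : Set (FeedbackJets.Jet k)) (I : FeedbackJets.Jet k → ℝ),
      FeedbackJets.IsDiffInvariant k U I → ∀ p ∈ U, ∀ᶠ q in 𝓝 p, I q = I p) ∧
    -- order 2: `J` is a nowhere locally constant invariant, and all others are functions of it
    (FeedbackJets.IsDiffInvariant 2 {p | FeedbackJets.IsRegular p} FeedbackJets.invariantJ ∧
      (∀ p : FeedbackJets.Jet 2, FeedbackJets.IsRegular p →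
        fderiv ℝ FeedbackJets.invariantJ p ≠ 0) ∧
      ∀ (U : Set (FeedbackJets.Jet 2)) (I : FeedbackJets.Jet 2 → ℝ),
        FeedbackJets.IsDiffInvariant 2 U I → ∀ p ∈ U, FeedbackJets.IsRegular p →
          ∃ h : ℝ → ℝ, ContDiff ℝ ∞ h ∧ ∀ᶠ q in 𝓝 p, I q = h (FeedbackJets.invariantJ q)) ∧
    -- independent invariants of pure order `k`
    (∀ k : ℕ, 2 ≤ k → ∃ n : ℕ, (n : ℝ) = (k : ℝ) * (k + 1) / 2 - 2 ∧
      ∀ p : FeedbackJets.Jet k, FeedbackJets.IsRegular p →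
        FeedbackJets.HasPureOrderDimension k p n) ∧
    -- dimension of the algebra of invariants of order at most `k`
    (∀ k : ℕ, 2 ≤ k → ∃ n : ℕ, (n : ℝ) = (k : ℝ) ^ 3 / 6 + (k : ℝ) ^ 2 / 2 - 5 * (k : ℝ) / 3 + 1 ∧
      ∀ p : FeedbackJets.Jet k, FeedbackJets.IsRegular p →
        FeedbackJets.HasInvariantDimension k p n) ∧
    -- dimension of the regular orbits
    (∀ k : ℕ, 2 ≤ k → ∃ d : ℕ, (d : ℝ) = ((k : ℝ) + 1) ^ 2 / 2 + 5 * (k : ℝ) / 2 + 5 / 2 ∧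
      ∀ p : FeedbackJets.Jet k, FeedbackJets.IsRegular p →
        Module.finrank ℝ (FeedbackJets.feedbackDistribution k p) = d ∧
        FeedbackJets.IsEmbeddedSubmanifold (FeedbackJets.feedbackOrbit k p) d) := by
  refine ⟨fun k hk U I hI p hp => hI.eventually_eq hk hp,
    ⟨FeedbackJets.isDiffInvariant_invariantJ, fun p hp => FeedbackJets.fderiv_invariantJ_ne_zero hp,
      fun U I hI p hpU hp => hI.exists_eq_comp_invariantJ hpU hp⟩,
    fun k hk => ⟨_, FeedbackJets.card_pureIndex hk, fun p hp =>
      FeedbackJets.hasPureOrderDimension hp⟩,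
    fun k hk => ⟨_, FeedbackJets.card_freeIndex hk, fun p hp =>
      FeedbackJets.hasInvariantDimension hp⟩,
    fun k hk => ⟨_, FeedbackJets.cast_finrank_sub_card hk, fun p hp =>
      ⟨FeedbackJets.finrank_feedbackDistribution hp,
        FeedbackJets.isEmbeddedSubmanifold_feedbackOrbit hp⟩⟩⟩
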